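/- All graphs are finite, connected, simple and unweighted; $d_G$ is the shortest-path distance, $I_G(u,v)=\{x : d_G(u,x)+d_G(x,v)=d_G(u,v)\}$, $e_G(v)=\max_u d_G(u,v)$ is the eccentricity of $v$, and the center $C(G)$ is the set of vertices of minimum eccentricity (the central vertices); $C(C(G))$ is the center of the subgraph of $G$ induced by $C(G)$. A graph $G$ is $\alpha_1$-metric if for all vertices $u,v,w,x$ such that $v\in I_G(u,w)$ and $w\in I_G(v,x)$ are adjacent, $d_G(u,x)\ge d_G(u,v)+d_G(v,x)-1$. A spanning tree $T$ of $G$ is an eccentricity $k$-approximating spanning tree if $e_T(v)\le e_G(v)+k$ for every vertex $v$. A BFS tree of $G$ rooted at $c$ is a spanning tree $T$ with $d_T(c,v)=d_G(c,v)$ for all vertices $v$. Theorem. Let $G$ be an $\alpha_1$-metric graph. (1) $G$ admits an eccentricity 3-approximating spanning tree; namely, there is a BFS tree of $G$ rooted at a vertex of $C(C(G))$, and every such BFS tree is an eccentricity 3-approximating spanning tree of $G$. (2) Every BFS tree of $G$ rooted at a vertex of $C(G)$ is an eccentricity 4-approximating spanning tree of $G$. (3) An additive 4-approximation of all vertex eccentricities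 can be computed in truly subquadratic time: there are a constant $b<2$ and an algorithm (a word-RAM program with words of $O(\log m)$ bits and unit-cost operations) which, given the adjacency lists of any $\alpha_1$-metric graph $G$ with $m$ edges, computes in $O((m+1)^{b})$ time a vertex $c\in C(G)$, a BFS tree $T$ of $G$ rooted at $c$, and the numbers $e_T(v)$ for all vertices $v$, which satisfy $e_G(v)\le e_T(v)\le e_G(v)+4$. -/

import Mathlib

/-! ### Metric notions in graphs -/

namespace SimpleGraph

/-- The interval `I(u, v)`: the vertices lying metrically between `u` and `v`. -/
def metricInterval {V : Type*} (G : SimpleGraph V) (u v : V) : Set V :=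
  {x | G.dist u x + G.dist x v = G.dist u v}

/-- `G` is an `α_i`-metric graph: whenever `v ∈ I(u, w)` and `w ∈ I(v, x)` are adjacent,
`d(u, x) ≥ d(u, v) + d(v, x) - i` (written without subtraction). -/
def IsAlphaMetric {V : Type*} (i : ℕ) (G : SimpleGraph V) : Prop :=
  ∀ u v w x : V, v ∈ G.metricInterval u w → w ∈ G.metricInterval v x → G.Adj v w →
    G.dist u v + G.dist v x ≤ G.dist u x + i

/-- `C(C(G))`: the central vertices of the subgraph of `G` induced by the center `C(G)`. -/
def centerOfCenter {V : Type*} (G : SimpleGraph V) : Set V :=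
  Subtype.val '' (G.induce G.center).center

/-- `T` is a spanning tree of `G`. -/
def IsSpanningTreeOf {V : Type*} (T G : SimpleGraph V) : Prop :=
  T ≤ G ∧ T.IsTree

/-- `T` is a breadth-first-search tree of `G` rooted at `c`: a spanning tree of `G` that preserves
all distances from `c`. -/
def IsBFSTree {V : Type*} (G : SimpleGraph V) (c : V) (T : SimpleGraph V) : Prop :=
  T.IsSpanningTreeOf G ∧ ∀ v : V, T.dist c v = G.dist c v

/-- `T` is an eccentricity `k`-approximating spanning tree of `G`. -/
def IsEccApproxSpanningTree {V : Type*} (G : SimpleGraph V) (k : ℕ) (T : SimpleGraph V) : Prop :=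
  T.IsSpanningTreeOf G ∧ ∀ v : V, T.eccent v ≤ G.eccent v + k

/-- The array `parent` describes the tree `T` rooted at `c`: the edges of `T` are exactly the pairs
consisting of a vertex other than `c` and its parent (the entry at `c` is irrelevant). -/
def IsParentArray {n : ℕ} (T : SimpleGraph (Fin n)) (c : Fin n) (parent : ℕ → ℕ) : Prop :=
  ∀ v w : Fin n, T.Adj v w ↔
    (v ≠ c ∧ parent v = w) ∨ (w ≠ c ∧ parent w = v)

end SimpleGraph

/-! ### Word random access machine

Programs are structured programs over finitely many scalar registers and finitely many one-dimensional
arrays of machine words, with indirect (computed) addressing of the arrays.  Every elementary operation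
(reading a constant or register, accessing an array entry, an arithmetic operation, a comparison,
an assignment, a branch) takes one unit of time.  The parameter `W` bounds the machine words: every
number occurring during the execution must be smaller than `W`, otherwise the execution is stuck. -/

namespace WordRAM

/-- A memory configuration: scalar registers, and arrays (`arr a i` is entry `i` of array `a`). -/
structure State where
  var : ℕ → ℕ
  arr : ℕ → ℕ → ℕ

/-- Assign the value `z` to the register `x`. -/
def State.setVar (s : State) (x z : ℕ) : State :=
  { s with var := Function.update s.var x z }

/-- Write the value `z` into entry `i` of the array `a`. -/
def State.setArr (s : State) (a i z : ℕ) : State :=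
  { s with arr := Function.update s.arr a (Function.update (s.arr a) i z) }

/-- Elementary binary operations. -/
inductive Op where
  | add | sub | mul | div | lt | eq

/-- Subtraction is truncated, division is integer division, and comparisons return `1` or `0`. -/
def Op.eval : Op → ℕ → ℕ → ℕ
  | .add, x, y => x + y
  | .sub, x, y => x - y
  | .mul, x, y => x * y
  | .div, x, y => x / y
  | .lt, x, y => if x < y then 1 else 0
  | .eq, x, y => if x = y then 1 else 0

/-- Expressions: `get a e` reads the entry of the array `a` whose index is the value of `e`. -/
inductive Expr where
  | const (z : ℕ)
  | var (x : ℕ)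
  | get (a : ℕ) (e : Expr)
  | bin (o : Op) (e₁ e₂ : Expr)

/-- The value of an expression. -/
def Expr.eval (s : State) : Expr → ℕ
  | .const z => z
  | .var x => s.var x
  | .get a e => s.arr a (e.eval s)
  | .bin o e₁ e₂ => o.eval (e₁.eval s) (e₂.eval s)

/-- The time for evaluating an expression: one unit per elementary operation. -/
def Expr.cost : Expr → ℕ
  | .const _ => 1
  | .var _ => 1
  | .get _ e => e.cost + 1
  | .bin _ e₁ e₂ => e₁.cost + e₂.cost + 1

/-- All values (including intermediate ones) occurring in the evaluation are smaller than `W`. -/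
def Expr.Fits (W : ℕ) (s : State) : Expr → Prop
  | .const z => z < W
  | .var x => s.var x < W
  | .get a e => e.Fits W s ∧ s.arr a (e.eval s) < W
  | .bin o e₁ e₂ => e₁.Fits W s ∧ e₂.Fits W s ∧ o.eval (e₁.eval s) (e₂.eval s) < W

/-- Programs. -/
inductive Prog where
  | skip
  | assign (x : ℕ) (e : Expr)
  | put (a : ℕ) (i e : Expr)
  | seq (p q : Prog)
  | ite (e : Expr) (p q : Prog)
  | loop (e : Expr) (p : Prog)

/-- `Exec W p s t s'`: with words smaller than `W`, the program `p` started in the configuration `s`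
halts after `t` steps in the configuration `s'`.  A condition holds when its value is nonzero, and
`loop e p` repeats `p` as long as `e` holds. -/
inductive Exec (W : ℕ) : Prog → State → ℕ → State → Prop where
  | skip (s : State) : Exec W .skip s 1 s
  | assign (x : ℕ) (e : Expr) (s : State) (he : e.Fits W s) :
      Exec W (.assign x e) s (e.cost + 1) (s.setVar x (e.eval s))
  | put (a : ℕ) (i e : Expr) (s : State) (hi : i.Fits W s) (he : e.Fits W s) :
      Exec W (.put a i e) s (i.cost + e.cost + 1) (s.setArr a (i.eval s) (e.eval s))
  | seq (p q : Prog) (s s' s'' : State) (t t' : ℕ) (hp : Exec W p s t s')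
      (hq : Exec W q s' t' s'') : Exec W (.seq p q) s (t + t') s''
  | iteTrue (e : Expr) (p q : Prog) (s s' : State) (t : ℕ) (he : e.Fits W s)
      (hv : e.eval s ≠ 0) (hp : Exec W p s t s') : Exec W (.ite e p q) s (e.cost + 1 + t) s'
  | iteFalse (e : Expr) (p q : Prog) (s s' : State) (t : ℕ) (he : e.Fits W s)
      (hv : e.eval s = 0) (hq : Exec W q s t s') : Exec W (.ite e p q) s (e.cost + 1 + t) s'
  | loopTrue (e : Expr) (p : Prog) (s s' s'' : State) (t t' : ℕ) (he : e.Fits W s)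
      (hv : e.eval s ≠ 0) (hp : Exec W p s t s') (hl : Exec W (.loop e p) s' t' s'') :
      Exec W (.loop e p) s (e.cost + 1 + t + t') s''
  | loopFalse (e : Expr) (p : Prog) (s : State) (he : e.Fits W s) (hv : e.eval s = 0) :
      Exec W (.loop e p) s (e.cost + 1) s

/-! ### Graphs as inputs -/

/-- Adjacency lists of a graph on the vertices `0, …, n - 1`; each list is in arbitrary order. -/
structure AdjLists {n : ℕ} (G : SimpleGraph (Fin n)) where
  nbrs : Fin n → List (Fin n)
  nodup : ∀ v, (nbrs v).Nodup
  mem_nbrs : ∀ v w, w ∈ nbrs v ↔ G.Adj v w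

/-- The initial configuration: register `0` holds the number `n` of vertices; array `1` holds the
concatenation of the adjacency lists of the vertices `0, …, n - 1`; entry `v ≤ n` of array `0` holds
the position in array `1` at which the list of `v` starts (so entry `n` is the total length);
everything else is `0`. -/
def AdjLists.init {n : ℕ} {G : SimpleGraph (Fin n)} (A : AdjLists G) : State where
  var x := if x = 0 then n else 0
  arr a i :=
    if a = 0 then
      if i ≤ n then (((List.ofFn A.nbrs).take i).map List.length).sum else 0
    else if a = 1 then ((List.ofFn A.nbrs).flatten.map Fin.val).getD i 0
    else 0

end WordRAM

/-! Metric part. Everything rests on one propagation principle, `IsAlphaMetric.dist_add_dist_le`: if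
`t` lies on a geodesic from `a` to `b` and is farther from `c` than `a` is, then `d(c,b) ≥ d(c,t) +
d(t,b) - 1`. It makes disks convex, hence also the center. It also gives, for every `v`, a central
`c'` with `d(v,c') + e(c') ≤ e(v) + 1`: a step from the nearest central vertex towards `v` raises
the eccentricity, and this increase propagates to `v`. If all central vertices are within `k` of a
central root `c`, a path through the root of a BFS tree therefore has length at most `d(v,c) +
d(c,u) ≤ e(v) + k + 1`. So (1) and (2) reduce to `k = 2` and `k = 3`.

For `k = 3`, suppose central `x`, `y` are at distance four, and take a midpoint `c` with the fewest
farthest vertices. A step from `c` towards a farthest vertex `z` gives another midpoint `q`; it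
loses `z`, so by minimality it gains some `w`, and `d(z,w)` is at least twice the radius minus two.
`IsAlphaMetric.false_of_equidistant_pair` excludes this configuration. The same counting, now of
central vertices at distance three, gives a central vertex within two of the whole center; by
convexity this bounds the radius of the induced subgraph, hence `k = 2` for its central vertices.

Algorithmic part. Distances to a geodesic behave as in a tree up to constants (`IsNearTree`), so the
middle of a pair found by two sweeps has eccentricity at most the radius plus 14. From a noncentral
`c`, with `v` farthest from `c`, `IsAlphaMetric.exists_ecc_lt` finds a better vertex in a small set:
the vertices `a` within two of `c` on geodesics to `v`, and their neighbours towards a vertex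
farthest from `a`. Neighbours closer to a fixed target form a clique, so each layer of this set is
covered by cliques indexed by the previous layer, and Cauchy–Schwarz bounds the layers by constants
times `N^(1/2)`, `N^(3/4)`, `N^(7/8)` with `N = n + 2m`. One search per candidate and 14 rounds cost
`O(N^(15/8))` and end at a central vertex. The eccentricities in its BFS tree are maxima of the
distances to two ends of a longest path of the tree. -/

namespace SimpleGraph
variable {V : Type*} {G : SimpleGraph V}

/-! ### Consequences of the `α₁` condition for geodesics -/

/-- A vertex on a geodesic from `a` to `b`, at a prescribed distance from `a`. -/
theorem Connected.exists_dist_eq_add (hG : G.Connected) {a b : V} {i : ℕ} (h : i ≤ G.dist a b) :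
    ∃ t, G.dist a t = i ∧ G.dist a t + G.dist t b = G.dist a b := by
  obtain ⟨p, hp⟩ := hG.exists_walk_length_eq_dist a b
  refine ⟨p.getVert i, ?_⟩
  have h1 : G.dist a (p.getVert i) ≤ i := by
    refine (dist_le (p.take i)).trans ?_
    simp [Walk.take_length]
  have h2 : G.dist (p.getVert i) b ≤ G.dist a b - i := by
    refine (dist_le (p.drop i)).trans ?_
    simp [Walk.drop_length, hp]
  have h3 := hG.dist_triangle (u := a) (v := p.getVert i) (w := b)
  omega

/-- A neighbor of `a` on a geodesic from `a` to `t`. -/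
theorem Connected.exists_adj_dist_eq_add_one (hG : G.Connected) {a t : V} (h : a ≠ t) :
    ∃ b, G.Adj a b ∧ G.dist a t = G.dist b t + 1 := by
  have := hG.pos_dist_of_ne h
  obtain ⟨b, hb, hb'⟩ := hG.exists_dist_eq_add (a := a) (b := t) (i := 1) (by omega)
  exact ⟨b, dist_eq_one_iff_adj.1 hb, by omega⟩

/-- In an `α₁`-metric graph, once the distance to `c` has increased on the way from `a` to a vertex
`t` of `I(a, b)`, it keeps increasing up to `b`, with a defect of at most one. -/
theorem IsAlphaMetric.dist_add_dist_le (hα : G.IsAlphaMetric 1) (hG : G.Connected) (a t b c : V)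
    (ht : G.dist a t + G.dist t b ≤ G.dist a b) (h : G.dist c a < G.dist c t) :
    G.dist c t + G.dist a b ≤ G.dist c b + G.dist a t + 1 := by
  induction hn : G.dist a t using Nat.strong_induction_on generalizing a with
  | _ n ih =>
    have hne : a ≠ t := by rintro rfl; omega
    obtain ⟨a', ha, ha'⟩ := hG.exists_adj_dist_eq_add_one hne
    have h1 := dist_eq_one_iff_adj.2 ha
    have t1 := hG.dist_triangle (u := a') (v := t) (w := b)
    have t2 := hG.dist_triangle (u := a) (v := a') (w := b)
    have t3 := hG.dist_triangle (u := c) (v := a) (w := a')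
    have t5 := hG.dist_triangle (u := a) (v := t) (w := b)
    -- Advance from `a` towards `t` as long as the next vertex `a'` is still closer to `c` than `t`.
    -- At the last such moment `d(c,a') = d(c,t) = d(c,a) + 1`, and the edge from `a` to `a'` meets
    -- the hypotheses of the `α₁` condition.
    by_cases hc : G.dist c a' < G.dist c t
    · have := ih (G.dist a' t) (by omega) a' (by omega) hc rfl
      omega
    · have := hα c a a' b (by simp only [metricInterval, Set.mem_ofPred_eq]; omega)
        (by simp only [metricInterval, Set.mem_ofPred_eq]; omega) ha
      have t4 := hG.dist_triangle (u := c) (v := a') (w := t)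
      omega

/-- Disks of `α₁`-metric graphs are convex. -/
theorem IsAlphaMetric.dist_le_of_mem_interval (hα : G.IsAlphaMetric 1) (hG : G.Connected)
    {a t b c : V} {k : ℕ} (ht : G.dist a t + G.dist t b = G.dist a b)
    (ha : G.dist c a ≤ k) (hb : G.dist c b ≤ k) : G.dist c t ≤ k := by
  by_contra! h
  -- If `t` left the disk, then `d(c,b) ≥ d(c,t) + d(t,b) - 1 ≥ d(c,t) > k`.
  have := hα.dist_add_dist_le hG a t b c ht.le (by omega)
  have h0 : t ≠ b := by rintro rfl; omega
  have := hG.pos_dist_of_ne h0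
  omega

/-- Let `c` be at distance two from `u`, with a common neighbor `p`, and let `v` be equidistant from
`c` and `p`, and closer to `u`. Then the next vertices towards `v` from `c` and from `u` are close. -/
theorem IsAlphaMetric.dist_eq_one_or_dist_eq_two (hα : G.IsAlphaMetric 1) (hG : G.Connected)
    {c p u v a t : V} (hcp : G.dist c p = 1) (hpu : G.dist p u = 1) (hcu : G.dist c u = 2)
    (hp : G.dist p v = G.dist c v) (hu : G.dist u v + 1 = G.dist c v)
    (ha : G.dist c a = 1) (hav : G.dist a v + 1 = G.dist c v)
    (ht : G.dist u t = 1) (htv : G.dist t v + 2 = G.dist c v) :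
    G.dist a u = 1 ∨ G.dist c t = 2 := by
  -- Suppose `d(c,t) = 3`. Seen from `a`, the geodesics from `c` through `p` to `t` and from `p`
  -- through `t` to `v` force `d(a,p) ≤ 1`. The geodesic from `p` through `a` to `v`, seen from `u`,
  -- then gives `d(a,u) = 1`.
  have R := hα.dist_add_dist_le hG
  have h0 := hG.dist_triangle (u := c) (v := u) (w := t)
  have h1 := hG.dist_triangle (u := c) (v := t) (w := v)
  have h2 := hG.dist_triangle (u := p) (v := u) (w := t)
  have h3 := R c p t a
  have h4 := R p t v a
  have h5 := R p a v u
  have h6 := hG.dist_triangle (u := c) (v := a) (w := u)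
  have c0 := G.dist_comm (u := c) (v := p)
  have c1 := G.dist_comm (u := c) (v := u)
  have c2 := G.dist_comm (u := c) (v := v)
  have c3 := G.dist_comm (u := c) (v := a)
  have c4 := G.dist_comm (u := c) (v := t)
  have c5 := G.dist_comm (u := p) (v := u)
  have c6 := G.dist_comm (u := p) (v := v)
  have c7 := G.dist_comm (u := p) (v := a)
  have c8 := G.dist_comm (u := p) (v := t)
  have c9 := G.dist_comm (u := u) (v := v)
  have c10 := G.dist_comm (u := u) (v := a)
  have c11 := G.dist_comm (u := u) (v := t)
  have c12 := G.dist_comm (u := v) (v := a)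
  have c13 := G.dist_comm (u := v) (v := t)
  have c14 := G.dist_comm (u := a) (v := t)
  omega

/-- A geodesic of length six is not contained in a sphere. -/
theorem IsAlphaMetric.false_of_equidistant (hα : G.IsAlphaMetric 1) (hG : G.Connected)
    {x c y z : V} (hxc : G.dist x c = 3) (hcy : G.dist c y = 3) (hxy : G.dist x y = 6)
    (hx : G.dist x z = G.dist c z) (hy : G.dist y z = G.dist c z) : False := by
  have hyc : y ≠ c := by rintro rfl; simp at hcy
  have hyz : y ≠ z := by rintro rfl; simp at hy; omega
  -- Propagation towards `x` shows that `a` is also equidistant from `z`, while `b` is one step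
  -- closer. If `d(b,x) = 5`, then `a` and `b` are adjacent, `d(b,c) ≥ 3`, and the geodesic from `a`
  -- through `b` to `z` is too long as seen from `c`. If `d(b,x) = 6`, then `d(b,c) = 3`, and the
  -- geodesic from `b` through `c` to `x` is too long as seen from `z`.
  obtain ⟨a, ha, hac⟩ := hG.exists_adj_dist_eq_add_one hyc
  obtain ⟨b, hb, hbz⟩ := hG.exists_adj_dist_eq_add_one hyz
  rw [← dist_eq_one_iff_adj] at ha hb
  have R := hα.dist_add_dist_le hG
  have h0 := hG.dist_triangle (u := x) (v := a) (w := y)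
  have h1 := hG.dist_triangle (u := x) (v := b) (w := y)
  have h2 := hG.dist_triangle (u := x) (v := c) (w := a)
  have h3 := R y a x z
  have h4 := R a b z c
  have h5 := R a c x z
  have h6 := R b c x z
  have h7 := R y b x a
  have h8 := R y b z c
  grind (splits := 40) [dist_comm]

set_option linter.unusedVariables false in
/-- If `z` and `w` are at distance at least `2 * r - 2`, then a geodesic of length four between two
vertices at distance `r` from both of them cannot be equidistant from `z` through a neighbor of `q` and
equidistant from `w` through `q`. -/
theorem IsAlphaMetric.false_of_equidistant_pair (hα : G.IsAlphaMetric 1) (hG : G.Connected) {r : ℕ}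
    {z w p0 p1 p2 p3 p4 q q1 q3 : V} (hr : 0 < r)
    (hzw : 2 * r ≤ G.dist z w + 2) (hzw' : G.dist z w ≤ 2 * r)
    (h01 : G.dist p0 p1 = 1) (h12 : G.dist p1 p2 = 1) (h23 : G.dist p2 p3 = 1)
    (h34 : G.dist p3 p4 = 1) (h02 : G.dist p0 p2 = 2) (h13 : G.dist p1 p3 = 2)
    (h24 : G.dist p2 p4 = 2) (h03 : G.dist p0 p3 = 3) (h14 : G.dist p1 p4 = 3)
    (h04 : G.dist p0 p4 = 4)
    (hz0 : G.dist p0 z = r) (hz1 : G.dist p1 z = r) (hz2 : G.dist p2 z = r)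
    (hz3 : G.dist p3 z = r) (hz4 : G.dist p4 z = r)
    (hw0 : G.dist p0 w = r) (hw1 : G.dist p1 w ≤ r) (hw2 : G.dist p2 w + 1 = r)
    (hw3 : G.dist p3 w ≤ r) (hw4 : G.dist p4 w = r)
    (h2q : G.dist p2 q = 1) (h0q : G.dist p0 q = 2) (h4q : G.dist p4 q = 2)
    (hqq1 : G.dist q q1 = 1) (h0q1 : G.dist p0 q1 = 1)
    (hqq3 : G.dist q q3 = 1) (h4q3 : G.dist p4 q3 = 1)
    (hqz : G.dist q z + 1 = r) (hq1z : G.dist q1 z ≤ r) (hq3z : G.dist q3 z ≤ r)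
    (hqw : G.dist q w = r) (hq1w : G.dist q1 w = r) (hq3w : G.dist q3 w = r) : False := by
  have hne (v : V) (h : G.dist p0 v = r) : p0 ≠ v := by rintro rfl; simp at h; omega
  -- The only new vertices are the first steps `a` and `b` from `p0` towards `z` and `w`; the
  -- instances of propagation below leave no admissible distances for them.
  obtain ⟨a, ha, haz⟩ := hG.exists_adj_dist_eq_add_one (hne z hz0)
  obtain ⟨b, hb, hbw⟩ := hG.exists_adj_dist_eq_add_one (hne w hw0)
  rw [← dist_eq_one_iff_adj] at ha hb
  have R := hα.dist_add_dist_le hG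
  have h0 := hG.dist_triangle (u := p0) (v := b) (w := p4)
  have h1 := hG.dist_triangle (u := p0) (v := a) (w := p4)
  have h2 := hG.dist_triangle (u := p0) (v := q3) (w := p3)
  have h3 := hG.dist_triangle (u := p4) (v := q) (w := q1)
  have h4 := hG.dist_triangle (u := p2) (v := q) (w := q1)
  have h5 := hG.dist_triangle (u := b) (v := a) (w := w)
  have h6 := R p0 q1 p4 a
  have h7 := R b q p4 w
  have h8 := R p0 q1 p4 p1
  have h9 := R q1 p2 w b
  have h10 := R q p1 w p4
  have h11 := R p2 q q1 p1
  have h12 := R q p2 b a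
  have h13 := R p1 p0 a p4
  have h14 := R q1 q z a
  have h15 := R b p0 q w
  have h16 := R q1 p2 p4 z
  have h17 := R p0 b p4 a
  have h18 := R p1 p2 w b
  have h19 := R p0 a z q
  have h20 := R p0 b p4 p1
  have h21 := R a p2 p4 z
  have h22 := R b q1 p4 w
  have h23 := R p0 q1 p4 b
  have h24 := R a p1 q z
  have h25 := R p4 p3 p0 q3
  grind (splits := 40) [dist_comm]

end SimpleGraph

namespace SimpleGraph
variable {V : Type*} {G : SimpleGraph V}

/-! ### Eccentricities as natural numbers -/

/-- The eccentricity of a vertex, as a natural number. -/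
noncomputable def ecc (G : SimpleGraph V) (v : V) : ℕ := (G.eccent v).toNat

theorem Connected.coe_ecc [Finite V] (hG : G.Connected) (v : V) : (G.ecc v : ℕ∞) = G.eccent v := by
  obtain ⟨u, hu⟩ := exists_edist_eq_eccent_of_finite (G := G) v
  rw [ecc, ← hu, (hG.preconnected v u).coe_dist_eq_edist.symm]
  simp

theorem Connected.dist_le_ecc [Finite V] (hG : G.Connected) (v u : V) : G.dist v u ≤ G.ecc v := by
  have := edist_le_eccent (G := G) (u := v) (v := u)
  rw [← hG.coe_ecc, ← (hG.preconnected v u).coe_dist_eq_edist] at this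
  exact_mod_cast this

theorem Connected.exists_dist_eq_ecc [Finite V] (hG : G.Connected) (v : V) :
    ∃ u, G.dist v u = G.ecc v := by
  obtain ⟨u, hu⟩ := exists_edist_eq_eccent_of_finite (G := G) v
  rw [← hG.coe_ecc, ← (hG.preconnected v u).coe_dist_eq_edist] at hu
  exact ⟨u, by exact_mod_cast hu⟩

theorem Connected.mem_center_iff_ecc [Finite V] (hG : G.Connected) {c : V} :
    c ∈ G.center ↔ ∀ u, G.ecc c ≤ G.ecc u := by
  rw [mem_center_iff]
  constructor
  · intro h u
    have : G.eccent c ≤ G.eccent u := h ▸ radius_le_eccent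
    rw [← hG.coe_ecc, ← hG.coe_ecc] at this
    exact_mod_cast this
  · intro h
    refine le_antisymm (le_iInf fun u => ?_) radius_le_eccent
    rw [← hG.coe_ecc, ← hG.coe_ecc]
    exact_mod_cast h u

/-- The vertices at maximum distance from `v`. -/
def farthest (G : SimpleGraph V) (v : V) : Set V := {z | G.dist v z = G.ecc v}

/-! ### Center and eccentricities of `α₁`-metric graphs -/

section
variable [Finite V]

/-- For every `u`, both ends lie in the disk of radius `ecc u` around a vertex farthest from `t`,
and disks are convex. -/
theorem IsAlphaMetric.mem_center_of_mem_interval (hα : G.IsAlphaMetric 1) (hG : G.Connected)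
    {a b t : V} (ha : a ∈ G.center) (hb : b ∈ G.center)
    (ht : G.dist a t + G.dist t b = G.dist a b) : t ∈ G.center := by
  rw [hG.mem_center_iff_ecc] at *
  intro u
  obtain ⟨z, hz⟩ := hG.exists_dist_eq_ecc t
  rw [← hz, dist_comm]
  refine hα.dist_le_of_mem_interval hG ht ?_ ?_
  · rw [dist_comm]; exact (hG.dist_le_ecc a z).trans (ha u)
  · rw [dist_comm]; exact (hG.dist_le_ecc b z).trans (hb u)

/-- The eccentricity of `v` is at least the radius plus the distance to the center, minus one. -/
theorem IsAlphaMetric.exists_center_dist_add_ecc_le (hα : G.IsAlphaMetric 1) (hG : G.Connected)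
    (v : V) : ∃ c ∈ G.center, G.dist v c + G.ecc c ≤ G.ecc v + 1 := by
  have := hG.nonempty
  obtain ⟨c, hc, hmin⟩ := Set.exists_min_image G.center (G.dist v) (Set.toFinite _) center_nonempty
  refine ⟨c, hc, ?_⟩
  have hc' := hG.mem_center_iff_ecc.1 hc
  rcases eq_or_ne c v with rfl | hne
  · simp
  obtain ⟨p, hp, hpv⟩ := hG.exists_adj_dist_eq_add_one hne
  rw [← dist_eq_one_iff_adj] at hp
  have hpc : p ∉ G.center := fun h => by
    have := hmin p h
    rw [G.dist_comm (u := v), G.dist_comm (u := v)] at this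
    omega
  have hlt : G.ecc c < G.ecc p := by
    by_contra! h
    exact hpc (hG.mem_center_iff_ecc.2 fun u => h.trans (hc' u))
  -- The distance to `z` increases from `c` to `p`, because the eccentricity does; this increase
  -- propagates to `v`.
  obtain ⟨z, hz⟩ := hG.exists_dist_eq_ecc p
  have h1 := hG.dist_le_ecc c z
  have h2 := hG.dist_le_ecc v z
  have := hα.dist_add_dist_le hG c p v z (by omega)
    (by rw [G.dist_comm (u := z), G.dist_comm (u := z)]; omega)
  rw [G.dist_comm (u := z), G.dist_comm (u := z), G.dist_comm (u := c) (v := v)] at this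
  omega

/-- From a non-central vertex `c`, the nearest vertex of smaller eccentricity is at distance at most
two. -/
theorem IsAlphaMetric.exists_ecc_lt_dist_le_two (hα : G.IsAlphaMetric 1) (hG : G.Connected) {c : V}
    (hc : c ∉ G.center) : ∃ u, G.ecc u < G.ecc c ∧ G.dist c u ≤ 2 ∧
      ∀ u', G.ecc u' < G.ecc c → G.dist c u ≤ G.dist c u' := by
  have hne : {u | G.ecc u < G.ecc c}.Nonempty := by
    rw [hG.mem_center_iff_ecc] at hc
    push Not at hc
    exact hc
  obtain ⟨u, hu, hmin⟩ := Set.exists_min_image _ (G.dist c) (Set.toFinite _) hne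
  refine ⟨u, hu, ?_, hmin⟩
  have hu' : G.ecc u < G.ecc c := hu
  rcases eq_or_ne u c with rfl | hne
  · simp
  obtain ⟨p, hp, hpc⟩ := hG.exists_adj_dist_eq_add_one hne
  rw [← dist_eq_one_iff_adj] at hp
  have hle : G.ecc c ≤ G.ecc p := by
    by_contra! h
    have := hmin p h
    rw [G.dist_comm (u := c), G.dist_comm (u := c)] at this
    omega
  -- The distance to `z` increases from `u` to `p`, where it is at least `ecc c`. It cannot exceed
  -- `ecc c` at `c`, so only one more edge fits between `p` and `c`.
  obtain ⟨z, hz⟩ := hG.exists_dist_eq_ecc p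
  have h1 := hG.dist_le_ecc u z
  have h2 := hG.dist_le_ecc c z
  have := hα.dist_add_dist_le hG u p c z (by omega)
    (by rw [G.dist_comm (u := z), G.dist_comm (u := z)]; omega)
  rw [G.dist_comm (u := z), G.dist_comm (u := z), G.dist_comm (u := u) (v := c)] at this
  omega

/-- A small set of vertices, described by distances from `c`, from `v`, and from farthest vertices `z a`
of the vertices `a` between `c` and `v`, contains a vertex of smaller eccentricity than `c`. -/
theorem IsAlphaMetric.exists_ecc_lt (hα : G.IsAlphaMetric 1) (hG : G.Connected) {c v : V}
    (hc : c ∉ G.center) (hv : G.dist c v = G.ecc c) {z : V → V}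
    (hz : ∀ a, G.dist a (z a) = G.ecc a) :
    ∃ u, G.ecc u < G.ecc c ∧ ∃ a, G.dist c a ≤ 2 ∧ G.dist c a + G.dist a v = G.dist c v ∧
      (u = a ∨ G.dist a u = 1 ∧ G.dist u (z a) + 1 = G.dist a (z a)) := by
  obtain ⟨u, hu, hu2, hmin⟩ := hα.exists_ecc_lt_dist_le_two hG hc
  -- A neighbour `t` of `u` in the near part of the interval suffices: either `t` itself improves on
  -- `c`, or `ecc u < ecc t`, so that `u` is closer than `t` to `z t`.
  have key : ∀ t, G.dist c t ≤ 2 → G.dist c t + G.dist t v = G.dist c v → G.dist t u = 1 →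
      ∃ u, G.ecc u < G.ecc c ∧ ∃ a, G.dist c a ≤ 2 ∧ G.dist c a + G.dist a v = G.dist c v ∧
      (u = a ∨ G.dist a u = 1 ∧ G.dist u (z a) + 1 = G.dist a (z a)) := by
    intro t ht1 ht2 ht3
    by_cases ht : G.ecc t < G.ecc c
    · exact ⟨t, ht, t, ht1, ht2, .inl rfl⟩
    · have h1 := hz t
      have h2 := hG.dist_le_ecc u (z t)
      have h3 := hG.dist_triangle (u := t) (v := u) (w := z t)
      exact ⟨u, hu, t, ht1, ht2, .inr ⟨ht3, by omega⟩⟩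
  have huv := hG.dist_le_ecc u v
  have t1 := hG.dist_triangle (u := c) (v := u) (w := v)
  by_cases huI : G.dist c u + G.dist u v = G.dist c v
  · exact ⟨u, hu, u, hu2, huI, .inl rfl⟩
  -- Off the geodesics only one case remains: `d(c,u) = 2` and `d(u,v) = d(c,v) - 1`. A neighbour of
  -- `u` on a geodesic from `c` to `v` is then sought among `p`, `a` and `t`.
  have hcu : G.dist c u = 2 := by
    rcases eq_or_ne c u with rfl | h
    · simp at huI
    have := hG.pos_dist_of_ne h
    omega
  have hucv : c ≠ u := by rintro rfl; simp at hcu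
  have hcv : c ≠ v := by rintro rfl; simp at hv; omega
  have huv' : u ≠ v := by rintro rfl; simp at huI
  obtain ⟨p, hp, hpu⟩ := hG.exists_adj_dist_eq_add_one hucv
  rw [← dist_eq_one_iff_adj] at hp
  have t2 := hG.dist_triangle (u := p) (v := u) (w := v)
  have t3 := hG.dist_triangle (u := c) (v := p) (w := v)
  rcases Nat.lt_or_ge (G.dist p v) (G.dist c v) with h | h
  · exact key p (by omega) (by omega) (by omega)
  obtain ⟨a, ha, hav⟩ := hG.exists_adj_dist_eq_add_one hcv
  obtain ⟨t, ht, htv⟩ := hG.exists_adj_dist_eq_add_one huv'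
  rw [← dist_eq_one_iff_adj] at ha ht
  rcases hα.dist_eq_one_or_dist_eq_two hG hp (by omega) hcu (v := v) (by omega) (by omega) ha
    (by omega) ht (by omega) with h | h
  · exact key a (by omega) (by omega) h
  · exact key t (by omega) (by omega) (by rw [dist_comm]; exact ht)

/-! ### Diameter and radius of the center -/

omit [Finite V] in
-- If `p` or `x` were closer to `z` than `t`, the increase up to `t` would propagate to `y` and push
-- it beyond distance `r`.
theorem IsAlphaMetric.dist_eq_of_flat (hα : G.IsAlphaMetric 1) (hG : G.Connected) {r : ℕ}
    {x p t y z : V} (hxp : G.dist x p = 1) (hpt : G.dist p t = 1) (hxt : G.dist x t = 2)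
    (hty : G.dist t y = 2) (hxy : G.dist x y = 4) (hz : G.dist t z = r) (hxz : G.dist x z ≤ r)
    (hyz : G.dist y z ≤ r) : G.dist p z = r ∧ G.dist x z = r := by
  have t1 := hG.dist_triangle (u := x) (v := p) (w := y)
  have t2 := hG.dist_triangle (u := p) (v := t) (w := y)
  have h1 := hα.dist_add_dist_le hG p t y z (by omega)
  have h2 := hα.dist_add_dist_le hG x t y z (by omega)
  have h3 := hα.dist_le_of_mem_interval hG (a := x) (t := p) (b := y) (c := z) (k := r) (by omega)
    (by rwa [dist_comm]) (by rwa [dist_comm])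
  have c1 := G.dist_comm (u := z) (v := p)
  have c2 := G.dist_comm (u := z) (v := t)
  have c3 := G.dist_comm (u := z) (v := x)
  have c4 := G.dist_comm (u := z) (v := y)
  omega

set_option maxHeartbeats 1000000 in
/-- The center of an `α₁`-metric graph has diameter at most three. -/
theorem IsAlphaMetric.dist_le_three_of_mem_center (hα : G.IsAlphaMetric 1) (hG : G.Connected)
    {x y : V} (hx : x ∈ G.center) (hy : y ∈ G.center) : G.dist x y ≤ 3 := by
  by_contra! hxy
  obtain ⟨y', hxy', hy'⟩ := hG.exists_dist_eq_add (a := x) (b := y) (i := 4) hxy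
  replace hy : y' ∈ G.center := hα.mem_center_of_mem_interval hG hx hy hy'
  clear hy' hxy
  clear y
  rename' y' => y, hxy' => hxy
  have hS : {t | G.dist x t = 2 ∧ G.dist t y = 2}.Nonempty := by
    obtain ⟨t, h1, h2⟩ := hG.exists_dist_eq_add (a := x) (b := y) (i := 2) (by omega)
    exact ⟨t, h1, by omega⟩
  -- By minimality no other midpoint can have a strictly smaller set of farthest vertices; this
  -- produces `w` below.
  obtain ⟨c, ⟨hxc, hcy⟩, hmin⟩ :=
    Set.exists_min_image _ (fun t => (G.farthest t).ncard) (Set.toFinite _) hS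
  have hC : ∀ t, G.dist x t + G.dist t y = G.dist x y → G.ecc t = G.ecc x := fun t ht =>
    le_antisymm (hG.mem_center_iff_ecc.1 (hα.mem_center_of_mem_interval hG hx hy ht) x)
      (hG.mem_center_iff_ecc.1 hx t)
  have hle : ∀ t, G.dist x t + G.dist t y = G.dist x y → ∀ z, G.dist t z ≤ G.ecc x := fun t ht z =>
    hC t ht ▸ hG.dist_le_ecc t z
  have hlx : ∀ z, G.dist x z ≤ G.ecc x := hG.dist_le_ecc x
  have hly : ∀ z, G.dist y z ≤ G.ecc x := hle y (by simp)
  have hr : 4 ≤ G.ecc x := hxy ▸ hlx y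
  have hec := hC c (by omega)
  obtain ⟨z, hz⟩ := hG.exists_dist_eq_ecc c
  have hcz : c ≠ z := by rintro rfl; simp at hz; omega
  obtain ⟨q, hq, hqz⟩ := hG.exists_adj_dist_eq_add_one hcz
  rw [← dist_eq_one_iff_adj] at hq
  -- common neighbours of `c` with `x` and `y`
  have mid : ∀ a b : V, G.dist a b = 2 → ∃ p, G.dist a p = 1 ∧ G.dist p b = 1 := fun a b h => by
    obtain ⟨p, h1, h2⟩ := hG.exists_dist_eq_add (a := a) (b := b) (i := 1) (by omega)
    exact ⟨p, h1, by omega⟩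
  have hyx : G.dist y x = 4 := by rw [dist_comm]; exact hxy
  have flat : ∀ t z : V, G.dist x t = 2 → G.dist t y = 2 → G.dist t z = G.ecc x →
      ∃ p p', G.dist x p = 1 ∧ G.dist p t = 1 ∧ G.dist t p' = 1 ∧ G.dist p' y = 1 ∧
        G.dist p z = G.ecc x ∧ G.dist p' z = G.ecc x ∧ G.dist x z = G.ecc x ∧
        G.dist y z = G.ecc x := by
    intro t z h1 h2 h3
    obtain ⟨p, hp, hp'⟩ := mid x t h1
    obtain ⟨o, ho, ho'⟩ := mid y t (by rw [dist_comm]; exact h2)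
    have f1 := hα.dist_eq_of_flat hG hp hp' h1 h2 hxy h3 (hlx z) (hly z)
    have f2 := hα.dist_eq_of_flat hG ho ho' (by rw [dist_comm]; exact h2)
      (by rw [dist_comm]; exact h1) hyx h3 (hly z) (hlx z)
    exact ⟨p, o, hp, hp', by rw [dist_comm]; exact ho', by rw [dist_comm]; exact ho, f1.1, f2.1,
      f1.2, f2.2⟩
  obtain ⟨p1, p3, h01, h12, h23, h34, hz1, hz3, hz0, hz4⟩ := flat c z hxc hcy (by omega)
  -- If `d(x,q) ≥ 3`, then propagation from `q` to `z` gives `d(x,z) ≥ ecc x + 1`. Applied to both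
  -- ends, this shows that `q` is a midpoint too.
  have hq2 : ∀ x y : V, G.dist x c = 2 → G.dist x z ≤ G.ecc x → G.ecc x = G.ecc c →
      G.dist x q ≤ 2 := by
    intro x y h1 h2 h3
    by_contra! h
    have := hα.dist_add_dist_le hG c q z x (by omega) (by omega)
    omega
  have hxq := hq2 x y hxc (hlx z) hec.symm
  have hyq := hq2 y x (by rw [dist_comm]; exact hcy) (by rw [hC y (by simp)]; exact hly z)
    (by rw [hC y (by simp)]; exact hec.symm)
  have t1 := hG.dist_triangle (u := x) (v := q) (w := y)
  rw [G.dist_comm (u := q)] at t1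
  have hqS : G.dist x q = 2 ∧ G.dist q y = 2 := ⟨by omega, by rw [dist_comm]; omega⟩
  have heq := hC q (by omega)
  obtain ⟨w, hw, hwc⟩ : ∃ w ∈ G.farthest q, w ∉ G.farthest c := by
    by_contra! hsub
    have : (G.farthest q).ncard < (G.farthest c).ncard := by
      refine Set.ncard_lt_ncard ⟨hsub, fun h => ?_⟩ (Set.toFinite _)
      have : G.dist q z = G.ecc q := h hz
      omega
    exact absurd (hmin q hqS) (by simpa using this)
  have hw : G.dist q w = G.ecc q := hw
  have hwc : G.dist c w ≠ G.ecc c := hwc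
  obtain ⟨q1, q3, g01, g12, g23, g34, hw1, hw3, hw0, hw4⟩ := flat q w hqS.1 hqS.2 (by omega)
  have t2 := hG.dist_triangle (u := q) (v := c) (w := w)
  have t3 := hle c (by omega) w
  have t4 := hG.dist_triangle (u := z) (v := c) (w := w)
  have t5 := hG.dist_triangle (u := p1) (v := c) (w := p3)
  have t6 := hG.dist_triangle (u := x) (v := p1) (w := p3)
  have t7 := hG.dist_triangle (u := x) (v := p3) (w := y)
  have t8 := hG.dist_triangle (u := x) (v := p1) (w := y)
  have t9 := hG.dist_triangle (u := p1) (v := p3) (w := y)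
  have c1 := G.dist_comm (u := w) (v := z)
  have c2 := G.dist_comm (u := w) (v := c)
  have c3 := G.dist_comm (u := w) (v := q)
  have c4 := G.dist_comm (u := z) (v := c)
  have c5 := G.dist_comm (u := c) (v := q)
  -- Since `w` is farther from `q` than from `c`, propagation to `z` yields `d(w,z) ≥ 2 * ecc x -
  -- 2`.
  have h5 := hα.dist_add_dist_le hG c q z w (by omega) (by omega)
  have e1 := hle q1 (by
    have := hG.dist_triangle (u := q1) (v := q) (w := y)
    have := hG.dist_triangle (u := x) (v := q1) (w := y)
    omega) z
  have e3 := hle q3 (by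
    have := hG.dist_triangle (u := x) (v := q) (w := q3)
    have := hG.dist_triangle (u := x) (v := q3) (w := y)
    omega) z
  refine hα.false_of_equidistant_pair hG (r := G.ecc x) (z := z) (w := w) (p0 := x) (p1 := p1)
    (p2 := c) (p3 := p3) (p4 := y) (q := q) (q1 := q1) (q3 := q3) ?_ ?_ ?_ h01 h12 h23 h34 hxc ?_ hcy
    ?_ ?_ hxy hz0 hz1 ?_ hz3 hz4 hw0 ?_ ?_ ?_ hw4 hq ?_ ?_ ?_ g01 g23 ?_ ?_ ?_ ?_ ?_ hw1 hw3
  all_goals first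
    | omega
    | exact hle _ (by omega) _
    | (rw [dist_comm]; omega)

/-- The center of an `α₁`-metric graph contains a vertex at distance at most two from all of its
vertices. -/
theorem IsAlphaMetric.exists_center_dist_le_two (hα : G.IsAlphaMetric 1) (hG : G.Connected) :
    ∃ c ∈ G.center, ∀ y ∈ G.center, G.dist c y ≤ 2 := by
  by_contra! hcon
  have := hG.nonempty
  -- The extremal choice is repeated with central vertices at distance three. The step to `q` loses
  -- `z` and gains `w`, and propagation gives `d(w,z) ≥ 3 + 2 - 1`, too much for the center.
  obtain ⟨c, hc, hmin⟩ := Set.exists_min_image G.center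
    (fun t => {z | z ∈ G.center ∧ G.dist t z = 3}.ncard) (Set.toFinite _) center_nonempty
  obtain ⟨z, hz, hcz⟩ := hcon c hc
  have hcz' := hα.dist_le_three_of_mem_center hG hc hz
  have hne : c ≠ z := by rintro rfl; simp at hcz
  obtain ⟨q, hq, hqz⟩ := hG.exists_adj_dist_eq_add_one hne
  rw [← dist_eq_one_iff_adj] at hq
  have hqC := hα.mem_center_of_mem_interval hG hc hz (t := q) (by omega)
  obtain ⟨w, ⟨hwC, hw⟩, hwc⟩ : ∃ w ∈ {z | z ∈ G.center ∧ G.dist q z = 3},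
      w ∉ {z | z ∈ G.center ∧ G.dist c z = 3} := by
    by_contra! hsub
    have : {z | z ∈ G.center ∧ G.dist q z = 3}.ncard < {z | z ∈ G.center ∧ G.dist c z = 3}.ncard := by
      refine Set.ncard_lt_ncard ⟨hsub, fun h => ?_⟩ (Set.toFinite _)
      have : G.dist q z = 3 := (h (a := z) ⟨hz, by omega⟩).2
      omega
    exact absurd (hmin q hqC) (by simpa using this)
  have h1 := hα.dist_le_three_of_mem_center hG hc hwC
  have h2 := hα.dist_le_three_of_mem_center hG hwC hz
  have h3 : G.dist c w ≠ 3 := fun h => hwc ⟨hwC, h⟩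
  have h5 := hα.dist_add_dist_le hG c q z w (by omega)
    (by rw [G.dist_comm (u := w), G.dist_comm (u := w)]; omega)
  rw [G.dist_comm (u := w) (v := q)] at h5
  omega

/-- Since the center is convex, distances at most two between central vertices are realized inside
it. The induced subgraph thus has radius at most two, which bounds the eccentricity of its central
vertices. -/
theorem IsAlphaMetric.dist_le_two_of_mem_centerOfCenter (hα : G.IsAlphaMetric 1)
    (hG : G.Connected) {c : V} (hc : c ∈ G.centerOfCenter) :
    c ∈ G.center ∧ ∀ y ∈ G.center, G.dist c y ≤ 2 := by
  obtain ⟨⟨c, hcC⟩, hc, rfl⟩ := hc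
  refine ⟨hcC, fun y hy => ?_⟩
  obtain ⟨b, hbC, hb⟩ := hα.exists_center_dist_le_two hG
  have h1 : (G.induce G.center).eccent ⟨b, hbC⟩ ≤ 2 := by
    rw [eccent_le_iff]
    rintro ⟨v, hv⟩
    have hbv := hb v hv
    rcases eq_or_ne b v with rfl | hne
    · simp
    have := hG.pos_dist_of_ne hne
    have hd : G.dist b v = 1 ∨ G.dist b v = 2 := by omega
    rcases hd with hd | hd
    · have hbv' : G.Adj b v := dist_eq_one_iff_adj.1 hd
      have hadj : (G.induce G.center).Adj ⟨b, hbC⟩ ⟨v, hv⟩ := hbv'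
      rw [edist_eq_one_iff_adj.2 hadj]
      norm_num
    · obtain ⟨p, hp, hp'⟩ := hG.exists_adj_dist_eq_add_one hne
      have hpv : G.Adj p v := dist_eq_one_iff_adj.1 (by omega)
      have hpC := hα.mem_center_of_mem_interval hG hbC hv (t := p)
        (by rw [dist_eq_one_iff_adj.2 hp]; omega)
      have a1 : (G.induce G.center).Adj ⟨b, hbC⟩ ⟨p, hpC⟩ := hp
      have a2 : (G.induce G.center).Adj ⟨p, hpC⟩ ⟨v, hv⟩ := hpv
      exact edist_le (Walk.cons a1 (Walk.cons a2 Walk.nil))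
  have h2 : (G.induce G.center).edist ⟨c, hcC⟩ ⟨y, hy⟩ ≤ 2 :=
    edist_le_eccent.trans ((mem_center_iff _).1 hc ▸ radius_le_eccent.trans h1)
  obtain ⟨p, hp⟩ := exists_walk_of_edist_ne_top
    (ne_top_of_le_ne_top (by decide : (2 : ℕ∞) ≠ ⊤) h2)
  rw [← hp] at h2
  have h3 := dist_le (p.map (Embedding.induce G.center).toHom)
  rw [Walk.length_map] at h3
  exact h3.trans (by exact_mod_cast h2)

omit [Finite V] in
theorem centerOfCenter_nonempty (hG : G.Connected) : G.centerOfCenter.Nonempty := by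
  have := hG.nonempty
  have : Nonempty G.center := (center_nonempty (G := G)).to_subtype
  exact center_nonempty.image _

/-! ### Breadth-first-search trees -/

/-- A tree path through the root has length at most `d(v,c) + d(c,u) ≤ d(v,c') + k + ecc c`, with
`c'` from `exists_center_dist_add_ecc_le`; the defect in that lemma is the extra `1`. -/
theorem IsAlphaMetric.isEccApproxSpanningTree (hα : G.IsAlphaMetric 1) (hG : G.Connected) {c : V}
    {k : ℕ} (hc : c ∈ G.center) (hk : ∀ y ∈ G.center, G.dist c y ≤ k) {T : SimpleGraph V}
    (hT : G.IsBFSTree c T) : G.IsEccApproxSpanningTree (k + 1) T := by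
  refine ⟨hT.1, fun v => ?_⟩
  have hTc := hT.1.2.connected
  rw [← hTc.coe_ecc, ← hG.coe_ecc]
  obtain ⟨u, hu⟩ := hTc.exists_dist_eq_ecc v
  obtain ⟨c', hc', h⟩ := hα.exists_center_dist_add_ecc_le hG v
  have t1 := hTc.dist_triangle (u := v) (v := c) (w := u)
  rw [T.dist_comm (u := v) (v := c), hT.2, hT.2] at t1
  have h1 := hG.dist_le_ecc c u
  have h2 := hG.mem_center_iff_ecc.1 hc c'
  have t2 := hG.dist_triangle (u := c) (v := c') (w := v)
  rw [G.dist_comm (u := c') (v := v)] at t2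
  have h3 := hk c' hc'
  exact_mod_cast (by omega : T.ecc v ≤ G.ecc v + (k + 1))

end

/-- The tree in which every vertex `v ≠ c` is joined to its parent. -/
def parentTree (c : V) (par : V → V) : SimpleGraph V :=
  fromRel fun v w => v ≠ c ∧ par v = w

theorem isBFSTree_parentTree [Finite V] (hG : G.Connected) {c : V} {par : V → V}
    (hpar : ∀ v ≠ c, G.Adj v (par v) ∧ G.dist c v = G.dist c (par v) + 1) :
    G.IsBFSTree c (parentTree c par) := by
  classical
  have := Fintype.ofFinite V
  have hle : parentTree c par ≤ G := by
    intro v w h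
    rw [parentTree, fromRel_adj] at h
    rcases h with ⟨_, ⟨h, rfl⟩ | ⟨h, rfl⟩⟩
    · exact (hpar _ h).1
    · exact (hpar _ h).1.symm
  have hadj : ∀ v ≠ c, (parentTree c par).Adj v (par v) := fun v hv =>
    (fromRel_adj ..).2 ⟨(hpar v hv).1.ne, .inl ⟨hv, rfl⟩⟩
  have hwalk : ∀ k v, G.dist c v = k → ∃ p : (parentTree c par).Walk c v, p.length = k := by
    intro k
    induction k with
    | zero =>
      intro v hv
      rw [hG.dist_eq_zero_iff] at hv
      subst hv
      exact ⟨.nil, rfl⟩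
    | succ k ih =>
      intro v hv
      have hvc : v ≠ c := by rintro rfl; simp at hv
      obtain ⟨p, hp⟩ := ih (par v) (by have := (hpar v hvc).2; omega)
      exact ⟨p.concat (hadj v hvc).symm, by simp [hp]⟩
  have hcon : (parentTree c par).Connected := by
    have : Nonempty V := ⟨c⟩
    refine connected_iff_exists_forall_reachable _ |>.2 ⟨c, fun v => ?_⟩
    obtain ⟨p, -⟩ := hwalk _ v rfl
    exact ⟨p⟩
  refine ⟨⟨hle, ?_⟩, fun v => ?_⟩
  · rw [isTree_iff_connected_and_card]
    refine ⟨hcon, le_antisymm ?_ hcon.card_vert_le_card_edgeSet_add_one⟩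
    -- Each edge is charged to its child, so the connected graph has at most `n - 1` edges and is a
    -- tree.
    have : (parentTree c par).edgeSet ⊆ (fun v => s(v, par v)) '' {v | v ≠ c} := by
      intro e
      induction e with | _ v w => ?_
      intro h
      rw [mem_edgeSet, parentTree, fromRel_adj] at h
      rcases h with ⟨_, ⟨h, rfl⟩ | ⟨h, rfl⟩⟩
      · exact ⟨v, h, rfl⟩
      · exact ⟨w, h, Sym2.eq_swap⟩
    have h1 := (Set.ncard_le_ncard this (Set.toFinite _)).trans (Set.ncard_image_le (Set.toFinite _))
    have h2 : ({v | v ≠ c} : Set V) ⊂ Set.univ := by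
      rw [Set.ssubset_univ_iff, Ne, Set.eq_univ_iff_forall]
      push Not
      exact ⟨c, by simp⟩
    have h3 := Set.ncard_lt_ncard h2
    rw [Set.ncard_univ] at h3
    rw [Nat.card_coe_set_eq]
    omega
  · obtain ⟨p, hp⟩ := hwalk _ v rfl
    refine le_antisymm ((dist_le p).trans hp.le) ?_
    obtain ⟨q, hq⟩ := hcon.exists_walk_length_eq_dist c v
    rw [← hq, ← Walk.length_map (Hom.ofLE hle) q]
    exact dist_le _

theorem exists_isBFSTree [Finite V] (hG : G.Connected) (c : V) : ∃ T, G.IsBFSTree c T := by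
  have : ∀ v, ∃ w, v ≠ c → G.Adj v w ∧ G.dist c v = G.dist c w + 1 := fun v => by
    rcases eq_or_ne v c with rfl | h
    · exact ⟨v, fun h => absurd rfl h⟩
    · obtain ⟨w, h1, h2⟩ := hG.exists_adj_dist_eq_add_one h
      exact ⟨w, fun _ => ⟨h1, by rw [dist_comm, h2, dist_comm]⟩⟩
  choose par hpar using this
  exact ⟨_, isBFSTree_parentTree hG hpar⟩

end SimpleGraph

namespace SimpleGraph
variable {V : Type*} {G : SimpleGraph V}

/-! ### Tree-like distance functions -/

theorem Walk.dist_add_dist_eq_of_mem_support (hG : G.Connected) {a b t : V} (p : G.Walk a b)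
    (hp : p.length = G.dist a b) (ht : t ∈ p.support) :
    G.dist a t + G.dist t b = G.dist a b := by
  classical
  have h1 := dist_le (p.takeUntil t ht)
  have h2 := dist_le (p.dropUntil t ht)
  have h3 := congrArg Walk.length (p.take_spec ht)
  rw [Walk.length_append] at h3
  have h4 := hG.dist_triangle (u := a) (v := t) (w := b)
  omega

/-- Every walk between the two sides of an edge of a tree passes through the edge. -/
theorem IsTree.mem_support {T : SimpleGraph V} (hT : T.IsTree) {u v w x : V} (hvw : T.Adj v w)
    (hu : T.dist u v ≤ T.dist u w) (hx : T.dist x w ≤ T.dist x v) (p : T.Walk u x) :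
    v ∈ p.support := by
  have hb := isBridge_iff_forall_walk_mem_edges.1
    (isAcyclic_iff_forall_adj_isBridge.1 hT.isAcyclic hvw)
  -- Each side condition provides a geodesic avoiding the edge. Together with `p` these form a walk
  -- from `v` to `w`, which must use the bridge, and only `p` can do so.
  have avoid : ∀ a b c : V, T.Adj b c → T.dist a b ≤ T.dist a c →
      ∃ q : T.Walk a b, s(b, c) ∉ q.edges := fun a b c hbc h => by
    obtain ⟨q, hq⟩ := hT.connected.exists_walk_length_eq_dist a b
    refine ⟨q, fun hm => ?_⟩
    have := q.dist_add_dist_eq_of_mem_support hT.connected hq (q.snd_mem_support_of_mem_edges hm)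
    have := dist_eq_one_iff_adj.2 hbc.symm
    omega
  obtain ⟨q, hq⟩ := avoid u v w hvw hu
  obtain ⟨q', hq'⟩ := avoid x w v hvw.symm hx
  have := hb (q.reverse.append (p.append q'))
  simp only [Walk.edges_append, Walk.edges_reverse, List.mem_append, List.mem_reverse] at this
  rw [Sym2.eq_swap (a := w)] at hq'
  rcases this with h | h | h
  · exact absurd h hq
  · exact p.fst_mem_support_of_mem_edges h
  · exact absurd h hq'

/-- Otherwise the trivial walk at `u` would have to contain both ends of the edge. -/
theorem IsTree.dist_ne {T : SimpleGraph V} (hT : T.IsTree) {u v w : V} (hvw : T.Adj v w) :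
    T.dist u v ≠ T.dist u w := by
  intro h
  have hv := hT.mem_support hvw h.le h.symm.le (Walk.nil : T.Walk u u)
  have hw := hT.mem_support hvw.symm h.symm.le h.le (Walk.nil : T.Walk u u)
  simp only [Walk.support_nil, List.mem_singleton] at hv hw
  exact hvw.ne (hv.trans hw.symm)

theorem IsTree.dist_eq_add {T : SimpleGraph V} (hT : T.IsTree) {u v w x : V} (hvw : T.Adj v w)
    (hu : T.dist u w = T.dist u v + 1) (hx : T.dist v x = T.dist w x + 1) :
    T.dist u x = T.dist u v + T.dist v x := by
  obtain ⟨p, hp⟩ := hT.connected.exists_walk_length_eq_dist u x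
  rw [p.dist_add_dist_eq_of_mem_support hT.connected hp (hT.mem_support hvw (by omega) ?_ p)]
  rw [T.dist_comm, T.dist_comm (u := x)]
  omega

/-- The distances from a vertex to the vertices of an interval behave as in a tree, up to errors `κ`
and `γ`. -/
structure IsNearTree (G : SimpleGraph V) (κ γ : ℕ) : Prop where
  dist_add_dist_le : ∀ x y c v, G.dist x c + G.dist c y = G.dist x y →
    G.dist v c + G.dist x c ≤ G.dist v x + κ ∨ G.dist v c + G.dist c y ≤ G.dist v y + κ
  exists_gate : ∀ x y v, ∃ g, G.dist x g + G.dist g y = G.dist x y ∧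
    G.dist v g + G.dist x g ≤ G.dist v x + γ ∧ G.dist v g + G.dist g y ≤ G.dist v y + γ

/-- No edge of a tree is equidistant from `v`. Comparing `c` with its neighbour towards `x`
therefore decides through which side `c` separates; the gate is the vertex of the interval nearest
to `v`. -/
theorem IsTree.isNearTree {T : SimpleGraph V} (hT : T.IsTree) : T.IsNearTree 0 0 := by
  have hTc := hT.connected
  have toward : ∀ x y c : V, c ≠ x → T.dist x c + T.dist c y = T.dist x y →
      ∃ p, T.Adj c p ∧ T.dist c x = T.dist p x + 1 ∧ T.dist p y = T.dist c y + 1 ∧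
        T.dist x p + T.dist p y = T.dist x y := fun x y c hne h => by
    obtain ⟨p, hp, hpx⟩ := hTc.exists_adj_dist_eq_add_one hne
    have h1 := dist_eq_one_iff_adj.2 hp
    have h2 := hTc.dist_triangle (u := x) (v := p) (w := y)
    have h3 := hTc.dist_triangle (u := p) (v := c) (w := y)
    have c1 := T.dist_comm (u := c) (v := x)
    have c2 := T.dist_comm (u := p) (v := x)
    have c3 := T.dist_comm (u := p) (v := c)
    exact ⟨p, hp, hpx, by omega, by omega⟩
  have step : ∀ v c p x : V, T.Adj c p → T.dist c x = T.dist p x + 1 → T.dist v c < T.dist v p →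
      T.dist v x = T.dist v c + T.dist c x := fun v c p x hp hpx h => by
    have h1 := dist_eq_one_iff_adj.2 hp
    have h2 := hTc.dist_triangle (u := v) (v := c) (w := p)
    exact hT.dist_eq_add hp (by omega) hpx
  constructor
  · intro x y c v h
    rcases eq_or_ne c x with rfl | hne
    · left; simp
    obtain ⟨p, hp, hpx, hpy, -⟩ := toward x y c hne h
    rcases lt_or_gt_of_ne (hT.dist_ne (u := v) hp) with h' | h'
    · left
      rw [step v c p x hp hpx h', T.dist_comm (u := x)]
      omega
    · right
      have := step v p c y hp.symm hpy h'
      have h2 := hTc.dist_triangle (u := v) (v := p) (w := c)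
      rw [T.dist_comm (u := p), dist_eq_one_iff_adj.2 hp] at h2
      omega
  · intro x y v
    obtain ⟨g, hg, hmin⟩ := (measure (T.dist v)).wf.has_min
      {g | T.dist x g + T.dist g y = T.dist x y} ⟨x, by simp⟩
    replace hmin : ∀ p, T.dist x p + T.dist p y = T.dist x y → T.dist v g ≤ T.dist v p :=
      fun p hp => not_lt.1 (hmin p hp)
    replace hg : T.dist x g + T.dist g y = T.dist x y := hg
    refine ⟨g, hg, ?_, ?_⟩
    · rcases eq_or_ne g x with rfl | hne
      · simp
      obtain ⟨p, hp, hpx, -, hpI⟩ := toward x y g hne hg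
      rw [step v g p x hp hpx ((hmin p hpI).lt_of_ne (hT.dist_ne hp)), T.dist_comm (u := x)]
      omega
    · rcases eq_or_ne g y with rfl | hne
      · simp
      obtain ⟨p, hp, hpx, -, hpI⟩ := toward y x g hne
        (by rw [T.dist_comm (u := y) (v := x), T.dist_comm (u := y), T.dist_comm (u := g) (v := x)]; omega)
      have := hmin p
        (by rw [T.dist_comm (u := y) (v := x), T.dist_comm (u := y), T.dist_comm (u := p) (v := x)] at hpI
            omega)
      rw [step v g p y hp hpx (this.lt_of_ne (hT.dist_ne hp))]
      omega

/-- Within distance two of an end of the geodesic, the error 4 is just the triangle inequality.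
Otherwise `v` cannot be equidistant from `c` and the two vertices three steps away, and any strict
inequality propagates to one of the ends. -/
theorem IsAlphaMetric.isNearTree (hα : G.IsAlphaMetric 1) (hG : G.Connected) :
    G.IsNearTree 4 6 := by
  have main : ∀ x y c v, G.dist x c + G.dist c y = G.dist x y →
      G.dist v c + G.dist x c ≤ G.dist v x + 4 ∨ G.dist v c + G.dist c y ≤ G.dist v y + 4 := by
    intro x y c v h
    have t1 := hG.dist_triangle (u := v) (v := x) (w := c)
    have t2 := hG.dist_triangle (u := v) (v := y) (w := c)
    have c1 := G.dist_comm (u := x) (v := c)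
    have c2 := G.dist_comm (u := y) (v := c)
    rcases Nat.lt_or_ge (G.dist x c) 3 with h1 | h1
    · left; omega
    rcases Nat.lt_or_ge (G.dist c y) 3 with h2 | h2
    · right; omega
    obtain ⟨x', hx, hx'⟩ := hG.exists_dist_eq_add (a := c) (b := x) (i := 3) (by omega)
    obtain ⟨y', hy, hy'⟩ := hG.exists_dist_eq_add (a := c) (b := y) (i := 3) (by omega)
    have c3 := G.dist_comm (u := x') (v := c)
    have c4 := G.dist_comm (u := y') (v := c)
    have c5 := G.dist_comm (u := x') (v := x)
    have c6 := G.dist_comm (u := y') (v := x)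
    have c7 := G.dist_comm (u := y') (v := x')
    have c8 := G.dist_comm (u := y) (v := x)
    have t3 := hG.dist_triangle (u := x') (v := c) (w := y)
    have t4 := hG.dist_triangle (u := x) (v := x') (w := y)
    have t5 := hG.dist_triangle (u := y') (v := c) (w := x)
    have t6 := hG.dist_triangle (u := x) (v := y') (w := y)
    have t7 := hG.dist_triangle (u := x') (v := y') (w := y)
    have t8 := hG.dist_triangle (u := x') (v := c) (w := y')
    rcases lt_trichotomy (G.dist v x') (G.dist v c) with h3 | h3 | h3
    · have := hα.dist_add_dist_le hG x' c y v (by omega) h3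
      omega
    · rcases lt_trichotomy (G.dist v y') (G.dist v c) with h4 | h4 | h4
      · have := hα.dist_add_dist_le hG y' c x v (by omega) h4
        omega
      · refine (hα.false_of_equidistant hG (x := x') (c := c) (y := y') (z := v) (by omega) hy
          (by omega) ?_ ?_).elim
        · rw [G.dist_comm, h3, G.dist_comm]
        · rw [G.dist_comm, h4, G.dist_comm]
      · have := hα.dist_add_dist_le hG c y' y v (by omega) h4
        omega
    · have := hα.dist_add_dist_le hG c x' x v (by omega) h3
      omega
  refine ⟨main, fun x y v => ?_⟩
  -- The gate is a vertex closest to `y` among those satisfying the first alternative. The next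
  -- vertex `p` must satisfy the second, and going back from `p` to `c` costs 2, whence `6 = 4 + 2`.
  obtain ⟨c, ⟨hc, hcv⟩, hmax⟩ := (measure fun c => G.dist c y).wf.has_min
    {c | G.dist x c + G.dist c y = G.dist x y ∧ G.dist v c + G.dist x c ≤ G.dist v x + 4}
    ⟨x, by simp⟩
  refine ⟨c, hc, by omega, ?_⟩
  rcases eq_or_ne c y with rfl | hne
  · simp
  obtain ⟨p, hp, hpy⟩ := hG.exists_adj_dist_eq_add_one hne
  rw [← dist_eq_one_iff_adj] at hp
  have t1 := hG.dist_triangle (u := x) (v := c) (w := p)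
  have t2 := hG.dist_triangle (u := x) (v := p) (w := y)
  have t3 := hG.dist_triangle (u := v) (v := p) (w := c)
  rw [G.dist_comm (u := p) (v := c)] at t3
  rcases main x y p v (by omega) with h | h
  · exact absurd (show G.dist p y < G.dist c y by omega) (hmax p ⟨by omega, h⟩)
  · omega

/-- A vertex farthest from some vertex is almost an end of a diametral pair. -/
theorem IsNearTree.dist_le_or_dist_le {κ γ : ℕ} (h : G.IsNearTree κ γ) (hG : G.Connected) {s x : V}
    (hx : ∀ u, G.dist s u ≤ G.dist s x) (v y : V) :
    G.dist v y ≤ G.dist x v + κ + γ ∨ G.dist v y ≤ G.dist x y + κ + γ := by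
  -- Since `x` is farthest from `s`, neither `d(v,g)` nor `d(g,y)` exceeds `d(g,x)` by more than
  -- `γ`.
  obtain ⟨g, hg, h1, h2⟩ := h.exists_gate v y s
  have h3 := hx v
  have h4 := hx y
  have t1 := hG.dist_triangle (u := s) (v := g) (w := x)
  have c1 := G.dist_comm (u := x) (v := g)
  rcases h.dist_add_dist_le v y g x hg with h5 | h5
  · left; omega
  · right; omega

/-- Two sweeps: `a` and `b` are ends of a longest path, and the gate of `v` on it shows that a
vertex farthest from `v` can be found among them. -/
theorem IsTree.dist_le_max {T : SimpleGraph V} (hT : T.IsTree) {s a b : V}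
    (ha : ∀ u, T.dist s u ≤ T.dist s a) (hb : ∀ u, T.dist a u ≤ T.dist a b) (v w : V) :
    T.dist v w ≤ max (T.dist a v) (T.dist b v) := by
  have hn := hT.isNearTree
  have hd : T.dist b w ≤ T.dist a b := by
    have := hb w
    rcases hn.dist_le_or_dist_le hT.connected ha b w <;> omega
  have hd' := hb w
  obtain ⟨g, hg, h1, h2⟩ := hn.exists_gate a b v
  have t1 := hT.connected.dist_triangle (u := v) (v := g) (w := w)
  have c1 := T.dist_comm (u := a) (v := v)
  have c2 := T.dist_comm (u := b) (v := v)
  have c3 := T.dist_comm (u := w) (v := a)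
  have c4 := T.dist_comm (u := w) (v := b)
  have c5 := T.dist_comm (u := w) (v := g)
  rcases hn.dist_add_dist_le a b g w hg with h5 | h5 <;> omega

/-- Here `14 = 4 + (4 + 6)`: a farthest vertex `v` from `c` has `d(v,y) ≤ d(x,y) + 10` because `x`
came from a sweep, the near-tree inequality at `c` loses another 4, and `2 * ecc o ≥ d(x,y)`. -/
theorem IsAlphaMetric.ecc_mid_le [Finite V] (hα : G.IsAlphaMetric 1) (hG : G.Connected)
    {s x y c o : V} (hx : ∀ u, G.dist s u ≤ G.dist s x) (hy : ∀ u, G.dist x u ≤ G.dist x y)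
    (hc : G.dist x c = G.dist x y / 2) (hc' : G.dist x c + G.dist y c = G.dist x y) :
    G.ecc c ≤ G.ecc o + 14 := by
  have hn := hα.isNearTree hG
  obtain ⟨v, hv⟩ := hG.exists_dist_eq_ecc c
  have h1 := hG.dist_le_ecc o x
  have h2 := hG.dist_le_ecc o y
  have t1 := hG.dist_triangle (u := x) (v := o) (w := y)
  have h3 := hy v
  have h4 := hn.dist_le_or_dist_le hG hx v y
  have c1 := G.dist_comm (u := o) (v := x)
  have c2 := G.dist_comm (u := v) (v := x)
  have c3 := G.dist_comm (u := v) (v := c)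
  have c4 := G.dist_comm (u := y) (v := c)
  rcases hn.dist_add_dist_le x y c v (by omega) with h5 | h5 <;> omega

/-! ### Counting vertices covered by few cliques -/

/-- The squared fibre sizes count ordered pairs with equal `f`, each diagonal or an oriented edge;
Cauchy–Schwarz over the fibres does the rest. -/
theorem card_sq_le_of_clique_cover {ι : Type*} [Fintype V] [DecidableEq ι] (U : Finset V)
    (I : Finset ι) (f : V → ι) (hf : ∀ v ∈ U, f v ∈ I)
    (hU : ∀ v ∈ U, ∀ w ∈ U, f v = f w → v ≠ w → G.Adj v w) :
    U.card ^ 2 ≤ I.card * (2 * G.edgeSet.ncard + U.card) := by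
  classical
  have h1 : U.card = ∑ i ∈ I, (U.filter (f · = i)).card :=
    Finset.card_eq_sum_card_fiberwise hf
  have h2 : ∑ i ∈ I, (U.filter (f · = i)).card ^ 2 ≤ 2 * G.edgeSet.ncard + U.card := by
    have h3 : ∑ i ∈ I, (U.filter (f · = i)).card ^ 2 =
        ((U ×ˢ U).filter fun p => f p.1 = f p.2).card := by
      rw [Finset.card_eq_sum_card_fiberwise (f := fun p => f p.1) (t := I)]
      · refine Finset.sum_congr rfl fun i _ => ?_
        rw [sq, ← Finset.card_product]
        congr 1
        ext ⟨a, b⟩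
        simp only [Finset.mem_product, Finset.mem_filter]
        constructor
        · rintro ⟨⟨h1, h2⟩, h3, h4⟩
          exact ⟨⟨⟨h1, h3⟩, h2.trans h4.symm⟩, h2⟩
        · rintro ⟨⟨⟨h1, h3⟩, h2⟩, h4⟩
          exact ⟨⟨h1, h4⟩, h3, h2 ▸ h4⟩
      · intro p hp
        simp only [Finset.coe_filter, Finset.mem_product, Set.mem_ofPred_eq] at hp
        exact hf _ hp.1.1
    rw [h3]
    have h4 : ((U ×ˢ U).filter fun p => f p.1 = f p.2) ⊆
        (Finset.univ : Finset G.Dart).image (fun d => d.toProd) ∪ U.diag := by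
      rintro ⟨a, b⟩ h
      simp only [Finset.mem_filter, Finset.mem_product] at h
      simp only [Finset.mem_union, Finset.mem_image, Finset.mem_univ, true_and, Finset.mem_diag]
      by_cases hab : a = b
      · exact .inr ⟨h.1.1, hab⟩
      · exact .inl ⟨⟨(a, b), hU a h.1.1 b h.1.2 h.2 hab⟩, rfl⟩
    refine (Finset.card_le_card h4).trans ((Finset.card_union_le _ _).trans ?_)
    rw [Finset.diag_card]
    refine Nat.add_le_add_right (Finset.card_image_le.trans ?_) _
    rw [Finset.card_univ, dart_card_eq_twice_card_edges, ← coe_edgeFinset, Set.ncard_coe_finset]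
  calc U.card ^ 2 = (∑ i ∈ I, (U.filter (f · = i)).card) ^ 2 := by rw [← h1]
    _ ≤ I.card * ∑ i ∈ I, (U.filter (f · = i)).card ^ 2 := sq_sum_le_card_mul_sum_sq
    _ ≤ _ := Nat.mul_le_mul_left _ h2

/-- The neighbours of `c` towards `z` form a clique. -/
theorem IsAlphaMetric.adj_of_adj_of_dist_lt (hα : G.IsAlphaMetric 1) (hG : G.Connected)
    {c z a b : V} (ha : G.Adj c a) (hb : G.Adj c b) (haz : G.dist a z < G.dist c z)
    (hbz : G.dist b z < G.dist c z) (hab : a ≠ b) : G.Adj a b := by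
  rw [← dist_eq_one_iff_adj] at *
  have h1 := hG.pos_dist_of_ne hab
  have h2 := hG.dist_triangle (u := a) (v := c) (w := b)
  have c1 := G.dist_comm (u := a) (v := c)
  by_contra h
  -- If `a` and `b` were not adjacent, `c` would lie between them, hence in the convex disk of
  -- radius `d(c,z) - 1` around `z`.
  have := hα.dist_le_of_mem_interval hG (a := a) (t := c) (b := b) (c := z)
    (k := G.dist c z - 1) (by omega) (by rw [G.dist_comm]; omega) (by rw [G.dist_comm]; omega)
  rw [G.dist_comm] at this
  omega

end SimpleGraph

namespace SimpleGraph
variable {V : Type*} {G : SimpleGraph V}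

theorem le_of_sq_le {a b : ℝ} (h : a ^ 2 ≤ b ^ 2) (hb : 0 ≤ b) : a ≤ b :=
  (le_abs_self a).trans ((sq_le_sq.1 h).trans (abs_of_nonneg hb).le)

/-! ### The candidates for a vertex of smaller eccentricity -/

section
variable [Fintype V]

open Classical in
/-- The vertices at distance at most two from `c` on geodesics from `c` to `v`. -/
noncomputable def nearSet (G : SimpleGraph V) (c v : V) : Finset V :=
  {a | G.dist c a ≤ 2 ∧ G.dist c a + G.dist a v = G.dist c v}

open Classical in
/-- The vertices `a` of `nearSet G c v`, and their neighbours towards `z a`. -/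
noncomputable def candSet (G : SimpleGraph V) (c v : V) (z : V → V) : Finset V :=
  {u | ∃ a ∈ G.nearSet c v, u = a ∨ G.dist a u = 1 ∧ G.dist u (z a) + 1 = G.dist a (z a)}

theorem mem_nearSet {c v a : V} :
    a ∈ G.nearSet c v ↔ G.dist c a ≤ 2 ∧ G.dist c a + G.dist a v = G.dist c v := by
  simp [nearSet]

theorem mem_candSet {c v u : V} {z : V → V} : u ∈ G.candSet c v z ↔
    ∃ a ∈ G.nearSet c v, u = a ∨ G.dist a u = 1 ∧ G.dist u (z a) + 1 = G.dist a (z a) := by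
  simp [candSet]

theorem nearSet_subset_candSet {c v : V} {z : V → V} : G.nearSet c v ⊆ G.candSet c v z :=
  fun a ha => mem_candSet.2 ⟨a, ha, .inl rfl⟩

theorem card_sq_le_of_clique_cover' {ι : Type*} [DecidableEq ι] (U : Finset V)
    (I : Finset ι) (f : V → ι) (hf : ∀ v ∈ U, f v ∈ I)
    (hU : ∀ v ∈ U, ∀ w ∈ U, f v = f w → v ≠ w → G.Adj v w) :
    (U.card : ℝ) ^ 2 ≤ I.card * (2 * G.edgeSet.ncard + Fintype.card V : ℕ) := by
  have h1 := card_sq_le_of_clique_cover U I f hf hU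
  have h2 : I.card * (2 * G.edgeSet.ncard + U.card) ≤
      I.card * (2 * G.edgeSet.ncard + Fintype.card V) :=
    Nat.mul_le_mul_left _ (Nat.add_le_add_left U.card_le_univ _)
  exact_mod_cast h1.trans h2

/-- The first layer is a single clique, the second is covered by cliques indexed by the first, and
the remaining candidates by cliques indexed by the near set. With `x` the eighth root of `N`,
repeated square roots give the integral powers `x ^ 4`, `x ^ 6`, `x ^ 7`. -/
theorem IsAlphaMetric.card_candSet_le (hα : G.IsAlphaMetric 1) (hG : G.Connected) (c v : V)
    (z : V → V) : ((G.candSet c v z).card : ℝ) ≤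
      5 * ((2 * G.edgeSet.ncard + Fintype.card V : ℕ) : ℝ) ^ (7 / 8 : ℝ) := by
  classical
  set N := 2 * G.edgeSet.ncard + Fintype.card V with hN
  have hN1 : (1 : ℝ) ≤ N := by
    have : 0 < Fintype.card V := Fintype.card_pos_iff.2 ⟨c⟩
    exact_mod_cast (by omega : 1 ≤ N)
  set x : ℝ := (N : ℝ) ^ (1 / 8 : ℝ) with hx
  have hx0 : 0 ≤ x := by positivity
  have hx1 : 1 ≤ x := Real.one_le_rpow hN1 (by norm_num)
  have hx8 : (N : ℝ) = x ^ 8 := by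
    rw [hx, ← Real.rpow_natCast, ← Real.rpow_mul (by positivity)]
    norm_num
  have hx7 : (N : ℝ) ^ (7 / 8 : ℝ) = x ^ 7 := by
    rw [hx, ← Real.rpow_natCast, ← Real.rpow_mul (by positivity)]
    norm_num
  have c1 (a : V) := G.dist_comm (u := c) (v := a)
  -- the cliques
  set U1 := (G.nearSet c v).filter (G.dist c · = 1) with hU1
  set U2 := (G.nearSet c v).filter (G.dist c · = 2) with hU2
  have n1 : (U1.card : ℝ) ^ 2 ≤ x ^ 8 := by
    have := card_sq_le_of_clique_cover' (G := G) U1 {()} (fun _ => ()) (by simp)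
      (fun a ha b hb _ hab => by
        simp only [hU1, Finset.mem_filter, mem_nearSet] at ha hb
        exact hα.adj_of_adj_of_dist_lt hG (c := c) (z := v) (dist_eq_one_iff_adj.1 ha.2)
          (dist_eq_one_iff_adj.1 hb.2) (by omega) (by omega) hab)
    rw [← hN, hx8] at this
    simpa using this
  have par : ∀ a, ∃ p, a ∈ U2 → p ∈ U1 ∧ G.Adj p a ∧ G.dist a v < G.dist p v := fun a => by
    by_cases ha : a ∈ U2
    · simp only [hU2, Finset.mem_filter, mem_nearSet] at ha
      have hne : c ≠ a := by rintro rfl; simp at ha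
      obtain ⟨p, hp, hpa⟩ := hG.exists_adj_dist_eq_add_one hne
      have t1 := hG.dist_triangle (u := c) (v := p) (w := v)
      have t2 := hG.dist_triangle (u := p) (v := a) (w := v)
      have hp' := dist_eq_one_iff_adj.2 hp
      refine ⟨p, fun _ => ⟨?_, dist_eq_one_iff_adj.1 (by omega), by omega⟩⟩
      simp only [hU1, Finset.mem_filter, mem_nearSet]
      omega
    · exact ⟨a, fun h => absurd h ha⟩
  choose f hf using par
  have n2 : (U2.card : ℝ) ^ 2 ≤ U1.card * x ^ 8 := by
    rw [← hx8]
    refine card_sq_le_of_clique_cover' (G := G) U2 U1 f (fun a ha => (hf a ha).1)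
      (fun a ha b hb h hab => ?_)
    obtain ⟨h1, h2, h3⟩ := hf a ha
    obtain ⟨h4, h5, h6⟩ := hf b hb
    rw [h] at h2 h3
    exact hα.adj_of_adj_of_dist_lt hG h2 h5 h3 h6 hab
  have hnear : (G.nearSet c v).card ≤ 1 + U1.card + U2.card := by
    have : G.nearSet c v ⊆ {c} ∪ U1 ∪ U2 := fun a ha => by
      have ha' := mem_nearSet.1 ha
      simp only [hU1, hU2, Finset.mem_union, Finset.mem_singleton, Finset.mem_filter]
      have : G.dist c a = 0 ∨ G.dist c a = 1 ∨ G.dist c a = 2 := by omega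
      rcases this with h | h | h
      · exact .inl (.inl ((hG.dist_eq_zero_iff).1 h).symm)
      · exact .inl (.inr ⟨ha, h⟩)
      · exact .inr ⟨ha, h⟩
    refine (Finset.card_le_card this).trans ((Finset.card_union_le _ _).trans ?_)
    exact Nat.add_le_add_right ((Finset.card_union_le _ _).trans (by simp)) _
  set U3 := G.candSet c v z \ G.nearSet c v with hU3
  have src : ∀ u, ∃ a, u ∈ U3 → a ∈ G.nearSet c v ∧ G.Adj a u ∧
      G.dist u (z a) < G.dist a (z a) := fun u => by
    by_cases hu : u ∈ U3
    · obtain ⟨h1, h2⟩ := Finset.mem_sdiff.1 hu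
      obtain ⟨a, ha, rfl | ⟨h3, h4⟩⟩ := mem_candSet.1 h1
      · exact absurd ha h2
      · exact ⟨a, fun _ => ⟨ha, dist_eq_one_iff_adj.1 h3, by omega⟩⟩
    · exact ⟨u, fun h => absurd h hu⟩
  choose g hg using src
  have n3 : (U3.card : ℝ) ^ 2 ≤ (G.nearSet c v).card * x ^ 8 := by
    rw [← hx8]
    refine card_sq_le_of_clique_cover' (G := G) U3 _ g (fun a ha => (hg a ha).1)
      (fun a ha b hb h hab => ?_)
    obtain ⟨h1, h2, h3⟩ := hg a ha
    obtain ⟨h4, h5, h6⟩ := hg b hb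
    rw [h] at h2 h3
    exact hα.adj_of_adj_of_dist_lt hG h2 h5 h3 h6 hab
  have hcand : (G.candSet c v z).card ≤ U3.card + (G.nearSet c v).card := by
    rw [hU3, Finset.card_sdiff_add_card]
    exact Finset.card_le_card Finset.subset_union_left
  -- the estimate
  have p6 : x ^ 4 ≤ x ^ 6 := pow_le_pow_right₀ hx1 (by norm_num)
  have p7 : x ^ 6 ≤ x ^ 7 := pow_le_pow_right₀ hx1 (by norm_num)
  have p0 : 1 ≤ x ^ 6 := one_le_pow₀ hx1
  have e1 : (U1.card : ℝ) ≤ x ^ 4 := le_of_sq_le (by nlinarith) (by positivity)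
  have e2 : (U2.card : ℝ) ≤ x ^ 6 := by
    refine le_of_sq_le (n2.trans ?_) (by positivity)
    calc (U1.card : ℝ) * x ^ 8 ≤ x ^ 4 * x ^ 8 := by gcongr
      _ = (x ^ 6) ^ 2 := by ring
  have e3 : ((G.nearSet c v).card : ℝ) ≤ 3 * x ^ 6 := by
    have : ((G.nearSet c v).card : ℝ) ≤ 1 + U1.card + U2.card := by exact_mod_cast hnear
    linarith
  have e4 : (U3.card : ℝ) ≤ 2 * x ^ 7 := by
    refine le_of_sq_le (n3.trans ?_) (by positivity)
    calc ((G.nearSet c v).card : ℝ) * x ^ 8 ≤ 3 * x ^ 6 * x ^ 8 := by gcongr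
      _ ≤ 4 * x ^ 6 * x ^ 8 := by gcongr; norm_num
      _ = (2 * x ^ 7) ^ 2 := by ring
  have e5 : ((G.candSet c v z).card : ℝ) ≤ U3.card + (G.nearSet c v).card := by
    exact_mod_cast hcand
  rw [hx7]
  linarith

end

end SimpleGraph

namespace WordRAM

/-! ### Reasoning about programs -/

@[simp] theorem State.var_setVar (s : State) (x z y : ℕ) :
    (s.setVar x z).var y = if y = x then z else s.var y := by
  simp [State.setVar, Function.update_apply]

@[simp] theorem State.arr_setVar (s : State) (x z a : ℕ) : (s.setVar x z).arr a = s.arr a := rfl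

@[simp] theorem State.var_setArr (s : State) (a i z x : ℕ) : (s.setArr a i z).var x = s.var x := rfl

theorem State.arr_setArr (s : State) (a i z b : ℕ) :
    (s.setArr a i z).arr b = if b = a then Function.update (s.arr a) i z else s.arr b := by
  simp [State.setArr, Function.update_apply]

@[simp] theorem State.arr_setArr_apply (s : State) (a i z b j : ℕ) :
    (s.setArr a i z).arr b j = if b = a ∧ j = i then z else s.arr b j := by
  rw [State.arr_setArr]
  by_cases h : b = a
  · subst h
    simp [Function.update_apply]
  · simp [h]

theorem Op.lt_eval_le_one (x y : ℕ) : Op.lt.eval x y ≤ 1 := by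
  by_cases h : x < y <;> simp [Op.eval, h]

theorem Op.eq_eval_le_one (x y : ℕ) : Op.eq.eval x y ≤ 1 := by
  by_cases h : x = y <;> simp [Op.eval, h]

/-- The program `p` started in `s` halts within `T` steps in a configuration satisfying `Q`. -/
def Runs (W : ℕ) (p : Prog) (s : State) (T : ℕ) (Q : State → Prop) : Prop :=
  ∃ t s', Exec W p s t s' ∧ t ≤ T ∧ Q s'

section
variable {W : ℕ} {s : State} {T T' : ℕ} {Q Q' : State → Prop}

theorem Runs.mono {p : Prog} (h : Runs W p s T Q) (hT : T ≤ T') (hQ : ∀ s', Q s' → Q' s') :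
    Runs W p s T' Q' :=
  let ⟨t, s', h1, h2, h3⟩ := h
  ⟨t, s', h1, h2.trans hT, hQ _ h3⟩

theorem Runs.skip (hQ : Q s) : Runs W .skip s 1 Q := ⟨_, _, .skip s, le_rfl, hQ⟩

theorem Runs.assign {x : ℕ} {e : Expr} (he : e.Fits W s) (hQ : Q (s.setVar x (e.eval s))) :
    Runs W (.assign x e) s (e.cost + 1) Q := ⟨_, _, .assign x e s he, le_rfl, hQ⟩

theorem Runs.put {a : ℕ} {i e : Expr} (hi : i.Fits W s) (he : e.Fits W s)
    (hQ : Q (s.setArr a (i.eval s) (e.eval s))) : Runs W (.put a i e) s (i.cost + e.cost + 1) Q :=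
  ⟨_, _, .put a i e s hi he, le_rfl, hQ⟩

theorem Runs.seq {p q : Prog} (h : Runs W p s T fun s' => Runs W q s' T' Q) :
    Runs W (.seq p q) s (T + T') Q :=
  let ⟨_, _, h1, h2, _, _, h3, h4, h5⟩ := h
  ⟨_, _, .seq _ _ _ _ _ _ _ h1 h3, Nat.add_le_add h2 h4, h5⟩

theorem Runs.ite {e : Expr} {p q : Prog} (he : e.Fits W s) (hp : e.eval s ≠ 0 → Runs W p s T Q)
    (hq : e.eval s = 0 → Runs W q s T Q) : Runs W (.ite e p q) s (e.cost + 1 + T) Q := by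
  by_cases h : e.eval s = 0
  · obtain ⟨t, s', h1, h2, h3⟩ := hq h
    exact ⟨_, _, .iteFalse _ _ _ _ _ _ he h h1, by omega, h3⟩
  · obtain ⟨t, s', h1, h2, h3⟩ := hp h
    exact ⟨_, _, .iteTrue _ _ _ _ _ _ he h h1, by omega, h3⟩

theorem Runs.seq_le {p q : Prog} (hT : T' ≤ T)
    (h : Runs W p s T' fun s' => Runs W q s' (T - T') Q) : Runs W (.seq p q) s T Q :=
  (Runs.seq h).mono (by omega) fun _ h => h

theorem Runs.assign_seq {x : ℕ} {e : Expr} {p : Prog} (he : e.Fits W s) (hT : e.cost + 1 ≤ T)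
    (h : Runs W p (s.setVar x (e.eval s)) (T - (e.cost + 1)) Q) :
    Runs W (.seq (.assign x e) p) s T Q :=
  (Runs.seq (Runs.assign he h)).mono (by omega) fun _ h => h

theorem Runs.put_seq {a : ℕ} {i e : Expr} {p : Prog} (hi : i.Fits W s) (he : e.Fits W s)
    (hT : i.cost + e.cost + 1 ≤ T)
    (h : Runs W p (s.setArr a (i.eval s) (e.eval s)) (T - (i.cost + e.cost + 1)) Q) :
    Runs W (.seq (.put a i e) p) s T Q :=
  (Runs.seq (Runs.put hi he h)).mono (by omega) fun _ h => h

theorem Runs.assign_le {x : ℕ} {e : Expr} (he : e.Fits W s) (hT : e.cost + 1 ≤ T)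
    (hQ : Q (s.setVar x (e.eval s))) : Runs W (.assign x e) s T Q :=
  (Runs.assign he hQ).mono hT fun _ h => h

theorem Runs.put_le {a : ℕ} {i e : Expr} (hi : i.Fits W s) (he : e.Fits W s)
    (hT : i.cost + e.cost + 1 ≤ T) (hQ : Q (s.setArr a (i.eval s) (e.eval s))) :
    Runs W (.put a i e) s T Q :=
  (Runs.put hi he hQ).mono hT fun _ h => h

theorem Runs.ite_le {e : Expr} {p q : Prog} (he : e.Fits W s) (hT : e.cost + 1 ≤ T)
    (hp : e.eval s ≠ 0 → Runs W p s (T - (e.cost + 1)) Q)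
    (hq : e.eval s = 0 → Runs W q s (T - (e.cost + 1)) Q) : Runs W (.ite e p q) s T Q :=
  (Runs.ite he hp hq).mono (by omega) fun _ h => h

theorem Runs.skip_le (hT : 1 ≤ T) (hQ : Q s) : Runs W .skip s T Q :=
  (Runs.skip hQ).mono hT fun _ h => h

/-- Loops, with an invariant `I` depending on auxiliary data, and a bound `Φ` on the remaining time. -/
theorem Runs.loop {σ : Type*} {e : Expr} {p : Prog} (I : σ → State → Prop) (Φ : σ → ℕ)
    (hfits : ∀ g s, I g s → e.Fits W s)
    (hbody : ∀ g s, I g s → e.eval s ≠ 0 →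
      ∃ T, Runs W p s T fun s' => ∃ g', I g' s' ∧ e.cost + 1 + T + Φ g' ≤ Φ g)
    (hend : ∀ g s, I g s → e.eval s = 0 → e.cost + 1 ≤ Φ g ∧ Q s) {g : σ} (hg : I g s) :
    Runs W (.loop e p) s (Φ g) Q := by
  -- Every iteration pays at least for its test, so `Φ` strictly decreases and bounds termination as
  -- well as time.
  induction hn : Φ g using Nat.strong_induction_on generalizing g s with
  | _ n ih =>
    subst hn
    by_cases h : e.eval s = 0
    · exact ⟨_, _, .loopFalse _ _ _ (hfits g s hg) h, (hend g s hg h).1, (hend g s hg h).2⟩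
    · obtain ⟨T, t, s', h1, h2, g', h3, h4⟩ := hbody g s hg h
      obtain ⟨t', s'', h5, h6, h7⟩ := ih (Φ g') (by omega) h3 rfl
      exact ⟨_, _, .loopTrue _ _ _ _ _ _ _ (hfits g s hg) h h1 h5, by omega, h7⟩

end

/-! ### Frame conditions and counting loops -/

/-- Whether a program contains an assignment to the register `y`. -/
def Prog.writesVar : Prog → ℕ → Bool
  | .skip, _ => false
  | .assign x _, y => x == y
  | .put _ _ _, _ => false
  | .seq p q, y => p.writesVar y || q.writesVar y
  | .ite _ p q, y => p.writesVar y || q.writesVar y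
  | .loop _ p, y => p.writesVar y

/-- Whether a program contains an assignment to an entry of the array `b`. -/
def Prog.writesArr : Prog → ℕ → Bool
  | .skip, _ => false
  | .assign _ _, _ => false
  | .put a _ _, b => a == b
  | .seq p q, b => p.writesArr b || q.writesArr b
  | .ite _ p q, b => p.writesArr b || q.writesArr b
  | .loop _ p, b => p.writesArr b

theorem Exec.var_eq {W : ℕ} {p : Prog} {s s' : State} {t y : ℕ} (h : Exec W p s t s')
    (hy : p.writesVar y = false) : s'.var y = s.var y := by
  induction h <;> simp_all [Prog.writesVar, Ne.symm]

theorem Exec.arr_eq {W : ℕ} {p : Prog} {s s' : State} {t b : ℕ} (h : Exec W p s t s')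
    (hb : p.writesArr b = false) : s'.arr b = s.arr b := by
  induction h <;> simp_all [Prog.writesArr, State.arr_setArr]
  intro h
  exact absurd h.symm hb

/-- Only the registers and arrays written by `p` differ. -/
def Frame (p : Prog) (s s' : State) : Prop :=
  (∀ y, p.writesVar y = false → s'.var y = s.var y) ∧
    ∀ b, p.writesArr b = false → s'.arr b = s.arr b

theorem Runs.frame {W : ℕ} {p : Prog} {s : State} {T : ℕ} {Q : State → Prop}
    (h : Runs W p s T Q) : Runs W p s T fun s' => Q s' ∧ Frame p s s' :=
  let ⟨t, s', h1, h2, h3⟩ := h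
  ⟨t, s', h1, h2, h3, fun _ => h1.var_eq, fun _ => h1.arr_eq⟩

/-- Run `body` with the register `i` equal to `0, …, n - 1`, where `n` is the content of register
`0`. -/
def forN (i : ℕ) (body : Prog) : Prog :=
  .seq (.assign i (.const 0)) (.loop (.bin .lt (.var i) (.var 0))
    (.seq body (.assign i (.bin .add (.var i) (.const 1)))))

/-- By `hset` the invariant ignores the counter. The 8 pays for one test and one increment, the 6
for the initialization and the last test. -/
theorem Runs.forN {W n i : ℕ} {body : Prog} {s : State} (I : ℕ → State → Prop) (T : ℕ → ℕ)
    (hn : n + 1 < W) (hi : body.writesVar i = false) (h0 : I 0 s)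
    (hvar : ∀ k s, I k s → s.var 0 = n) (hset : ∀ k s z, I k s → I k (s.setVar i z))
    (hbody : ∀ k < n, ∀ s, I k s → s.var i = k → Runs W body s (T k) (I (k + 1))) :
    Runs W (forN i body) s (6 + ∑ k ∈ Finset.range n, (T k + 8)) (I n) := by
  have hi0 : i ≠ 0 ∨ n = 0 := by
    by_contra! h
    have := hvar _ _ (hset 0 s (n + 1) h0)
    simp [h.1] at this
  refine (Runs.seq (T := 2) (T' := 4 + ∑ k ∈ Finset.range n, (T k + 8)) ?_).mono (by omega)
    fun _ h => h
  refine (Runs.assign (by simp [Expr.Fits]; omega) ?_).mono (by simp [Expr.cost]) fun _ h => h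
  have := Runs.loop (W := W) (s := s.setVar i 0) (Q := I n) (e := .bin .lt (.var i) (.var 0))
    (p := .seq body (.assign i (.bin .add (.var i) (.const 1))))
    (fun (k : ℕ) s => k ≤ n ∧ s.var i = k ∧ I k s)
    (fun k => 4 + ∑ j ∈ Finset.Ico k n, (T j + 8)) ?_ ?_ ?_ (g := 0) ?_
  · simpa [Expr.eval] using this
  · rintro k s ⟨h1, h2, h3⟩
    have := hvar k s h3
    exact ⟨by simp only [Expr.Fits]; omega, by simp only [Expr.Fits]; omega,
      (Op.lt_eval_le_one _ _).trans_lt (by omega)⟩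
  · rintro k s ⟨h1, h2, h3⟩ hlt
    have h4 := hvar k s h3
    have hk : k < n := by simpa [Expr.eval, Op.eval, h2, h4] using hlt
    refine ⟨T k + 4, (Runs.seq (T := T k) (T' := 4) ?_)⟩
    refine (hbody k hk s h3 h2).frame.mono le_rfl ?_
    rintro s' ⟨h5, h6, -⟩
    have h7 := h6 i hi
    refine (Runs.assign ?_ ⟨k + 1, ⟨hk, ?_, ?_⟩, ?_⟩).mono (by simp [Expr.cost]) fun _ h => h
    · refine ⟨?_, ?_, ?_⟩ <;> simp only [Expr.Fits, Expr.eval, Op.eval] <;> omega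
    · simp [Expr.eval, Op.eval, h7, h2]
    · exact hset _ _ _ h5
    · rw [Finset.sum_eq_sum_Ico_succ_bot hk]
      simp only [Expr.cost]
      omega
  · rintro k s ⟨h1, h2, h3⟩ hlt
    have h4 := hvar k s h3
    have hk : n ≤ k := by simpa [Expr.eval, Op.eval, h2, h4] using hlt
    obtain rfl : k = n := by omega
    simp [Expr.cost, h3]
  · exact ⟨by omega, by simp, hset _ _ _ h0⟩

end WordRAM


/-! ### The queue of a breadth-first search -/

namespace SimpleGraph

/-- The queue `q` of a breadth-first search of `H` from `src`, whose first `h` vertices have been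
processed; all vertices of the queue are at distance at most `D + 1`. -/
structure QueueInv {V : Type*} (H : SimpleGraph V) (src : V) (q : List V) (h D : ℕ) : Prop where
  nodup : q.Nodup
  src_mem : src ∈ q
  sorted : q.Pairwise fun x y => H.dist src x ≤ H.dist src y
  closed : ∀ i (hi : i < q.length), i < h → ∀ w, H.Adj q[i] w → w ∈ q
  near : ∀ x ∈ q, H.dist src x ≤ D + 1

namespace QueueInv
variable {V : Type*} {H : SimpleGraph V} {src : V} {q : List V} {h D : ℕ}

theorem init : H.QueueInv src [src] 0 0 where
  nodup := by simp
  src_mem := by simp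
  sorted := by simp
  closed := by simp
  near := by simp

/-- A predecessor of `v` is closer to `src` than the head `u`; since the queue is sorted it stands
before position `h`, so its neighbours have already been entered. Hence a newly discovered vertex
has distance exactly one more than the head. -/
theorem mem_of_dist_le (hI : H.QueueInv src q h D) (hH : H.Connected) {u : V} (hu : q[h]? = some u)
    (v : V) (hv : H.dist src v ≤ H.dist src u) : v ∈ q := by
  induction hn : H.dist src v generalizing v with
  | zero =>
    rw [hH.dist_eq_zero_iff] at hn
    exact hn ▸ hI.src_mem
  | succ k ih =>
    have hne : v ≠ src := by rintro rfl; simp at hn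
    obtain ⟨p, hp, hpv⟩ := hH.exists_adj_dist_eq_add_one hne
    rw [H.dist_comm, H.dist_comm (u := p)] at hpv
    have hpq := ih p (by omega) (by omega)
    obtain ⟨i, hi, rfl⟩ := List.mem_iff_getElem.1 hpq
    obtain ⟨hh, hhu⟩ := List.getElem?_eq_some_iff.1 hu
    have hih : i < h := by
      by_contra! hle
      rcases hle.eq_or_lt with rfl | hlt
      · rw [hhu] at hpv; omega
      · have := List.pairwise_iff_getElem.1 hI.sorted h i hh hi hlt
        rw [hhu] at this
        omega
    exact hI.closed i hi hih v hp.symm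

theorem dist_eq_add_one (hI : H.QueueInv src q h D) (hH : H.Connected) {u : V}
    (hu : q[h]? = some u) {v : V} (huv : H.Adj u v) (hv : v ∉ q) :
    H.dist src v = H.dist src u + 1 := by
  have h1 : ¬ H.dist src v ≤ H.dist src u := fun h => hv (hI.mem_of_dist_le hH hu v h)
  have h2 := hH.dist_triangle (u := src) (v := u) (w := v)
  rw [dist_eq_one_iff_adj.2 huv] at h2
  omega

theorem concat {u : V} (hI : H.QueueInv src q h (H.dist src u)) (hH : H.Connected)
    (hu : q[h]? = some u) {v : V} (huv : H.Adj u v) (hv : v ∉ q) :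
    H.QueueInv src (q ++ [v]) h (H.dist src u) where
  nodup := by
    rw [List.nodup_append]
    exact ⟨hI.nodup, by simp, by simpa using fun a ha => ne_of_mem_of_not_mem ha hv⟩
  src_mem := by simp [hI.src_mem]
  sorted := by
    rw [List.pairwise_append]
    refine ⟨hI.sorted, by simp, fun a ha b hb => ?_⟩
    rw [List.mem_singleton.1 hb, hI.dist_eq_add_one hH hu huv hv]
    exact hI.near a ha
  closed := fun i hi hih w hw => by
    obtain ⟨hh, -⟩ := List.getElem?_eq_some_iff.1 hu
    rw [List.getElem_append_left (by omega)] at hw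
    exact List.mem_append_left _ (hI.closed i (by omega) hih w hw)
  near := fun x hx => by
    rcases List.mem_append.1 hx with hx | hx
    · exact hI.near x hx
    · rw [List.mem_singleton.1 hx, hI.dist_eq_add_one hH hu huv hv]

theorem process {u : V} (hI : H.QueueInv src q h (H.dist src u)) (hu : q[h]? = some u)
    (hw : ∀ w, H.Adj u w → w ∈ q) {D' : ℕ} (hD : ∀ u', q[h + 1]? = some u' → D' = H.dist src u')
    (hD' : q.length ≤ h + 1 → D' = H.dist src u) : H.QueueInv src q (h + 1) D' where
  nodup := hI.nodup
  src_mem := hI.src_mem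
  sorted := hI.sorted
  closed := fun i hi hih w hiw => by
    rcases Nat.lt_succ_iff_lt_or_eq.1 hih with h1 | rfl
    · exact hI.closed i hi h1 w hiw
    · obtain ⟨_, rfl⟩ := List.getElem?_eq_some_iff.1 hu
      exact hw w hiw
  near := fun x hx => by
    have := hI.near x hx
    rcases Nat.lt_or_ge (h + 1) q.length with h1 | h1
    · obtain ⟨h2, rfl⟩ := List.getElem?_eq_some_iff.1 hu
      rw [hD _ (List.getElem?_eq_getElem h1)]
      have := List.pairwise_iff_getElem.1 hI.sorted h (h + 1) h2 h1 (by omega)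
      omega
    · rw [hD' h1]
      exact this

theorem mem_of_length_le (hI : H.QueueInv src q h D) (hH : H.Connected) (hh : q.length ≤ h)
    (v : V) : v ∈ q := by
  induction hn : H.dist src v generalizing v with
  | zero =>
    rw [hH.dist_eq_zero_iff] at hn
    exact hn ▸ hI.src_mem
  | succ k ih =>
    have hne : v ≠ src := by rintro rfl; simp at hn
    obtain ⟨p, hp, hpv⟩ := hH.exists_adj_dist_eq_add_one hne
    rw [H.dist_comm, H.dist_comm (u := p)] at hpv
    obtain ⟨i, hi, rfl⟩ := List.mem_iff_getElem.1 (ih p (by omega))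
    exact hI.closed i hi (by omega) v hp.symm

end QueueInv

end SimpleGraph

namespace WordRAM

/-! ### Breadth-first search -/

/-- The configuration contains the adjacency lists of `G`, and `N` is `n` plus their total length. -/
structure HoldsGraph {n : ℕ} (G : SimpleGraph (Fin n)) (N : ℕ) (s : State) : Prop where
  var_zero : s.var 0 = n
  zero : s.arr 0 0 = 0
  mono : ∀ i < n, s.arr 0 i ≤ s.arr 0 (i + 1)
  total : n + s.arr 0 n = N
  adj : ∀ v w : Fin n, G.Adj v w ↔ ∃ j, s.arr 0 v ≤ j ∧ j < s.arr 0 (v + 1) ∧ s.arr 1 j = w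
  lt : ∀ j < s.arr 0 n, s.arr 1 j < n

theorem HoldsGraph.congr {n : ℕ} {G : SimpleGraph (Fin n)} {N : ℕ} {s s' : State}
    (h : HoldsGraph G N s) (h0 : s'.var 0 = s.var 0) (h1 : s'.arr 0 = s.arr 0)
    (h2 : s'.arr 1 = s.arr 1) : HoldsGraph G N s' := by
  constructor
  · rw [h0, h.var_zero]
  · rw [h1, h.zero]
  · rw [h1]; exact h.mono
  · rw [h1, h.total]
  · rw [h1, h2]; exact h.adj
  · rw [h1, h2]; exact h.lt

theorem HoldsGraph.mono_le {n : ℕ} {G : SimpleGraph (Fin n)} {N : ℕ} {s : State}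
    (h : HoldsGraph G N s) {i j : ℕ} (hij : i ≤ j) (hj : j ≤ n) : s.arr 0 i ≤ s.arr 0 j := by
  induction j, hij using Nat.le_induction with
  | base => exact le_rfl
  | succ k hk ih => exact (ih (by omega)).trans (h.mono k (by omega))

theorem HoldsGraph.sum_eq {n : ℕ} {G : SimpleGraph (Fin n)} {N : ℕ} {s : State}
    (h : HoldsGraph G N s) : ∑ v : Fin n, (s.arr 0 (v + 1) - s.arr 0 v) + n = N := by
  rw [Fin.sum_univ_eq_sum_range (fun i => s.arr 0 (i + 1) - s.arr 0 i) n]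
  have : ∀ k ≤ n, ∑ i ∈ Finset.range k, (s.arr 0 (i + 1) - s.arr 0 i) = s.arr 0 k := by
    intro k hk
    induction k with
    | zero => simp [h.zero]
    | succ k ih =>
      rw [Finset.sum_range_succ, ih (by omega)]
      have := h.mono k (by omega)
      omega
  rw [this n le_rfl, ← h.total]
  omega

/-- Examine the next entry of the adjacency list of the vertex in register `24`. -/
def bfsVisit (d par : ℕ) (F : Expr) : Prog :=
  .seq (.assign 27 (.get 1 (.var 25))) <|
  .seq (.assign 25 (.bin .add (.var 25) (.const 1))) <|
  .ite (.get d (.var 27)) .skip <|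
  .ite F
    (.seq (.put d (.var 27) (.bin .add (.get d (.var 24)) (.const 1))) <|
     .seq (.put par (.var 27) (.var 24)) <|
     .seq (.put 10 (.var 23) (.var 27)) <|
     .assign 23 (.bin .add (.var 23) (.const 1)))
    .skip

/-- Process the next vertex of the queue. -/
def bfsStep (d par : ℕ) (F : Expr) : Prog :=
  .seq (.assign 24 (.get 10 (.var 22))) <|
  .seq (.assign 25 (.get 0 (.var 24))) <|
  .seq (.assign 26 (.get 0 (.bin .add (.var 24) (.const 1)))) <|
  .seq (.loop (.bin .lt (.var 25) (.var 26)) (bfsVisit d par F)) <|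
  .assign 22 (.bin .add (.var 22) (.const 1))

/-- Breadth-first search from the vertex in register `20`, using the edges from register `24` to
register `27` for which `F` holds. The distances plus one are written to the array `d`, the parents to
the array `par`, a farthest vertex to register `28`, and its distance plus one to register `29`. -/
def bfs (d par : ℕ) (F : Expr) : Prog :=
  .seq (forN 21 (.put d (.var 21) (.const 0))) <|
  .seq (.put 10 (.const 0) (.var 20)) <|
  .seq (.put d (.var 20) (.const 1)) <|
  .seq (.assign 22 (.const 0)) <|
  .seq (.assign 23 (.const 1)) <|
  .seq (.loop (.bin .lt (.var 22) (.var 23)) (bfsStep d par F)) <|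
  .seq (.assign 28 (.get 10 (.bin .sub (.var 23) (.const 1)))) <|
  .assign 29 (.get d (.var 28))

/-- The arrays contain the queue `q`, the distances and the parents. -/
structure HoldsQueue {n : ℕ} (H : SimpleGraph (Fin n)) (src : Fin n) (d par : ℕ)
    (q : List (Fin n)) (s : State) : Prop where
  tail : s.var 23 = q.length
  queue : ∀ i (hi : i < q.length), s.arr 10 i = q[i]
  -- Stored distances are shifted by one, so that `0` can mean undiscovered.
  dist : ∀ v : Fin n, s.arr d v = if v ∈ q then H.dist src v + 1 else 0
  parent : ∀ v ∈ q, v ≠ src → ∃ w : Fin n, s.arr par v = w ∧ H.Adj v w ∧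
    H.dist src v = H.dist src w + 1

theorem HoldsQueue.congr {n : ℕ} {H : SimpleGraph (Fin n)} {src : Fin n} {d par : ℕ}
    {q : List (Fin n)} {s s' : State} (h : HoldsQueue H src d par q s) (h1 : s'.var 23 = s.var 23)
    (h2 : s'.arr = s.arr) : HoldsQueue H src d par q s' := by
  constructor
  · rw [h1, h.tail]
  · rw [h2]; exact h.queue
  · rw [h2]; exact h.dist
  · rw [h2]; exact h.parent

end WordRAM

namespace SimpleGraph

theorem Connected.dist_lt_card {V : Type*} [Fintype V] {G : SimpleGraph V} (hG : G.Connected)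
    (u v : V) : G.dist u v < Fintype.card V := by
  obtain ⟨p, hp⟩ := hG.exists_walk_length_eq_dist u v
  exact hp ▸ (p.isPath_of_length_eq_dist hp).length_lt

end SimpleGraph

namespace WordRAM

/-! ### Correctness and running time of one search -/

section
variable {n : ℕ} {G H : SimpleGraph (Fin n)} {N W d par : ℕ} {F : Expr} {src : Fin n} {s s' : State}
  {q : List (Fin n)}

theorem HoldsQueue.push (hs : HoldsQueue H src d par q s) {u w : Fin n}
    (hw : w ∉ q) (hwu : H.Adj w u) (hdist : H.dist src w = H.dist src u + 1)
    (h1 : s'.var 23 = s.var 23 + 1) (h2 : s'.arr 10 = Function.update (s.arr 10) (s.var 23) w)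
    (h3 : s'.arr d = Function.update (s.arr d) w (H.dist src u + 2))
    (h4 : s'.arr par = Function.update (s.arr par) w u) :
    HoldsQueue H src d par (q ++ [w]) s' where
  tail := by simp [h1, hs.tail]
  queue := fun i hi => by
    rw [h2, hs.tail, Function.update_apply]
    split_ifs with h
    · simp [h]
    · have hi' : i < q.length := by simp at hi; omega
      rw [hs.queue i hi', List.getElem_append_left hi']
  dist := fun v => by
    rw [h3, Function.update_apply]
    by_cases hv : v = w
    · simp [hv, hdist]
    · have : (v : ℕ) ≠ w := fun h => hv (Fin.ext h)
      simp [hv, this, hs.dist]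
  parent := fun v hv hne => by
    rw [h4, Function.update_apply]
    by_cases hvw : v = w
    · subst hvw
      exact ⟨u, by simp, hwu, hdist⟩
    · have : (v : ℕ) ≠ w := fun h => hvw (Fin.ext h)
      rw [if_neg this]
      exact hs.parent v (by simpa [hvw] using hv) hne

/-- `s'` differs from `s` only in the arrays `d`, `par` and `10` used by a search, and in registers
other than `0`. -/
def SearchAgree (d par : ℕ) (s s' : State) : Prop :=
  s'.var 0 = s.var 0 ∧ ∀ a, a ≠ d → a ≠ par → a ≠ 10 → s'.arr a = s.arr a

/-- In all states arising in a search started in `s`, the expression `F` tells whether an edge of `G`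
is an edge of `H`. -/
def SelectsEdges (W d par : ℕ) (F : Expr) (G H : SimpleGraph (Fin n)) (s : State) : Prop :=
  ∀ s', SearchAgree d par s s' → ∀ u v : Fin n, G.Adj u v → s'.var 24 = u → s'.var 27 = v →
    F.Fits W s' ∧ (F.eval s' ≠ 0 ↔ H.Adj u v)

/-- The arrays used by a search are distinct from each other and from the arrays of the input. -/
structure SearchArrays (d par : ℕ) : Prop where
  d_par : d ≠ par
  d_queue : d ≠ 10
  par_queue : par ≠ 10
  d_zero : d ≠ 0
  d_one : d ≠ 1
  par_zero : par ≠ 0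
  par_one : par ≠ 1

/-- The situation while the adjacency list of the vertex `u` is being examined, up to position `j`. -/
structure VisitInv (H : SimpleGraph (Fin n)) (src : Fin n) (d par : ℕ) (s₀ : State) (h : ℕ) (u : Fin n)
    (q : List (Fin n)) (j : ℕ) (s : State) : Prop where
  agree : SearchAgree d par s₀ s
  head : s.var 22 = h
  vertex : s.var 24 = u
  position : s.var 25 = j
  limit : s.var 26 = s₀.arr 0 (u + 1)
  le_position : s₀.arr 0 u ≤ j
  position_le : j ≤ s₀.arr 0 (u + 1)
  holds : HoldsQueue H src d par q s
  inv : H.QueueInv src q h (H.dist src u)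
  current : q[h]? = some u
  seen : ∀ i, s₀.arr 0 u ≤ i → i < j → ∀ w : Fin n, s₀.arr 1 i = w → H.Adj u w → w ∈ q

theorem runs_bfsVisit {s₀ : State} {h j : ℕ} {u : Fin n} (hH : H.Connected)
    (hA : SearchArrays d par) (hG : HoldsGraph G N s₀) (hF : SelectsEdges W d par F G H s₀)
    (hW : N + 3 ≤ W) (hs : VisitInv H src d par s₀ h u q j s) (hj : j < s₀.arr 0 (u + 1)) :
    Runs W (bfsVisit d par F) s (F.cost + 30) fun s' =>
      ∃ q', q <+: q' ∧ VisitInv H src d par s₀ h u q' (j + 1) s' := by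
  have ha0 : s.arr 0 = s₀.arr 0 := hs.agree.2 0 hA.d_zero.symm hA.par_zero.symm (by decide)
  have ha1 : s.arr 1 = s₀.arr 1 := hs.agree.2 1 hA.d_one.symm hA.par_one.symm (by decide)
  have htot := hG.total
  have hjn : j < s₀.arr 0 n := hj.trans_le (hG.mono_le (by omega) le_rfl)
  have hlt := hG.lt j hjn
  obtain ⟨w, hw⟩ : ∃ w : Fin n, s₀.arr 1 j = w := ⟨⟨_, hlt⟩, rfl⟩
  have hadj : G.Adj u w := (hG.adj u w).2 ⟨j, hs.le_position, hj, hw⟩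
  have hlen : q.length ≤ n := by
    simpa using List.Nodup.length_le_card hs.inv.nodup
  have hdw := hs.holds.dist w
  have hdu := hs.holds.dist u
  have hdn := hH.dist_lt_card src
  rw [Fintype.card_fin] at hdn
  have hdn' := hdn u
  have huq : u ∈ q := List.mem_of_getElem? hs.current
  rw [if_pos huq] at hdu
  have hpos := hs.position
  have hver := hs.vertex
  have htail := hs.holds.tail
  have hseen : ∀ q' : List (Fin n), (∀ v ∈ q, v ∈ q') → (H.Adj u w → w ∈ q') →
      ∀ i, s₀.arr 0 u ≤ i → i < j + 1 → ∀ w : Fin n, s₀.arr 1 i = w → H.Adj u w → w ∈ q' := by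
    intro q' hq hw' i h1 h2 v h3 h4
    rcases Nat.lt_succ_iff_lt_or_eq.1 h2 with h5 | rfl
    · exact hq v (hs.seen i h1 h5 v h3 h4)
    · obtain rfl : v = w := Fin.ext (h3.symm.trans hw)
      exact hw' h4
  have hbd : s.arr d w < W := by
    rw [hdw]
    have := hdn w
    split_ifs <;> omega
  refine Runs.assign_seq ⟨by simp only [Expr.Fits]; omega, ?_⟩ (by simp only [Expr.cost]; omega) ?_
  · simp only [Expr.eval, ha1, hpos]; omega
  refine Runs.assign_seq ⟨?_, ?_, ?_⟩ (by simp only [Expr.cost]; omega) ?_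
  · simp [Expr.Fits]; omega
  · simp [Expr.Fits]; omega
  · simp [Expr.eval, Op.eval]; omega
  simp only [Expr.eval, Op.eval, State.var_setVar, ha1, hpos, hw, Expr.cost]
  have hagree : SearchAgree d par s₀ ((s.setVar 27 w).setVar 25 (j + 1)) :=
    ⟨by simpa using hs.agree.1, hs.agree.2⟩
  have hsame : (H.Adj u w → w ∈ q) → VisitInv H src d par s₀ h u q (j + 1)
      ((s.setVar 27 w).setVar 25 (j + 1)) := fun hmem =>
    { hs with
      agree := hagree
      head := by simpa using hs.head
      vertex := by simpa using hs.vertex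
      position := by simp
      limit := by simpa using hs.limit
      le_position := hs.le_position.trans (by omega)
      position_le := hj
      holds := hs.holds.congr (by simp) rfl
      seen := hseen q (fun _ h => h) hmem }
  refine Runs.ite_le ⟨by simp [Expr.Fits]; omega, ?_⟩ (by simp only [Expr.cost]; omega) ?_ ?_
  · simpa [Expr.eval] using hbd
  · intro h1
    have hwq : w ∈ q := by
      by_contra hwq
      simp [Expr.eval, hdw, hwq] at h1
    exact Runs.skip_le (by simp only [Expr.cost]; omega) ⟨q, List.prefix_rfl, hsame fun _ => hwq⟩
  intro h1
  have hwq : w ∉ q := by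
    intro hwq
    simp [Expr.eval, hdw, hwq] at h1
  obtain ⟨hF1, hF2⟩ := hF _ hagree u w hadj (by simpa using hver) (by simp)
  refine Runs.ite_le hF1 (by simp only [Expr.cost]; omega) ?_ ?_
  swap
  · intro h2
    refine Runs.skip_le (by simp only [Expr.cost]; omega) ⟨q, List.prefix_rfl, hsame fun h3 => ?_⟩
    exact absurd h2 (hF2.2 h3)
  intro h2
  have hHuw := hF2.1 h2
  have hn1 := hA.d_par
  have hn2 := hA.d_queue
  have hn3 := hA.par_queue
  refine Runs.put_seq ?_ ⟨⟨?_, ?_⟩, ?_, ?_⟩ (by simp only [Expr.cost]; omega) ?_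
  · simp [Expr.Fits]; omega
  · simp [Expr.Fits]; omega
  · simp [Expr.eval, hver, hdu]; omega
  · simp [Expr.Fits]; omega
  · simp [Expr.eval, Op.eval, hver, hdu]; omega
  refine Runs.put_seq ?_ ?_ (by simp only [Expr.cost]; omega) ?_
  · simp [Expr.Fits]; omega
  · simp [Expr.Fits]; omega
  refine Runs.put_seq ?_ ?_ (by simp only [Expr.cost]; omega) ?_
  · simp [Expr.Fits]; omega
  · simp [Expr.Fits]; omega
  refine Runs.assign_le ⟨?_, ?_, ?_⟩ (by simp only [Expr.cost]; omega) ?_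
  · simp [Expr.Fits]; omega
  · simp [Expr.Fits]; omega
  · simp [Expr.eval, Op.eval]; omega
  refine ⟨q ++ [w], List.prefix_append _ _, ?_⟩
  simp only [Expr.eval, Op.eval, State.var_setVar, State.var_setArr, State.arr_setVar, hver]
  constructor
  · refine ⟨by simpa using hs.agree.1, fun a h3 h4 h5 => ?_⟩
    simp [State.arr_setArr, h3, h4, h5, hs.agree.2 a h3 h4 h5]
  · simpa using hs.head
  · simpa using hs.vertex
  · simp
  · simpa using hs.limit
  · exact hs.le_position.trans (by omega)
  · exact hj
  · refine hs.holds.push hwq hHuw.symm (hs.inv.dist_eq_add_one hH hs.current hHuw hwq) ?_ ?_ ?_ ?_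
    · simp
    · simp [State.arr_setArr, hn2.symm, hn3.symm]
    · simp [State.arr_setArr, hn2, hn1, hdu]
    · simp [State.arr_setArr, hn3, hn1.symm]
  · exact hs.inv.concat hH hs.current hHuw hwq
  · obtain ⟨h5, h6⟩ := List.getElem?_eq_some_iff.1 hs.current
    rw [List.getElem?_append_left h5, hs.current]
  · exact hseen _ (fun v hv => List.mem_append_left _ hv) fun _ => by simp

/-- The situation between the processing of two vertices of the queue. -/
structure StepInv (H : SimpleGraph (Fin n)) (src : Fin n) (d par : ℕ) (s₀ : State)
    (q : List (Fin n)) (h : ℕ) (s : State) : Prop where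
  agree : SearchAgree d par s₀ s
  head : s.var 22 = h
  le_length : h ≤ q.length
  holds : HoldsQueue H src d par q s
  inv : ∃ D, H.QueueInv src q h D ∧ ∀ u, q[h]? = some u → D = H.dist src u

theorem runs_bfsStep {s₀ : State} {h : ℕ} {u : Fin n} (hH : H.Connected) (hHG : H ≤ G)
    (hA : SearchArrays d par) (hG : HoldsGraph G N s₀) (hF : SelectsEdges W d par F G H s₀)
    (hW : N + 3 ≤ W) (hs : StepInv H src d par s₀ q h s) (hu : q[h]? = some u) :
    Runs W (bfsStep d par F) s ((s₀.arr 0 (u + 1) - s₀.arr 0 u) * (F.cost + 34) + 19) fun s' =>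
      ∃ q', q <+: q' ∧ StepInv H src d par s₀ q' (h + 1) s' := by
  have ha0 : s.arr 0 = s₀.arr 0 := hs.agree.2 0 hA.d_zero.symm hA.par_zero.symm (by decide)
  have hlen : ∀ q', StepInv H src d par s₀ q' h s → q'.length ≤ n := fun q' h' => by
    obtain ⟨D, h1, -⟩ := h'.inv
    simpa using List.Nodup.length_le_card h1.nodup
  have hlen' := hlen q hs
  obtain ⟨hh, hhu⟩ := List.getElem?_eq_some_iff.1 hu
  have hque : s.arr 10 h = u := by rw [hs.holds.queue h hh, hhu]
  have htot := hG.total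
  have hhead := hs.head
  have hu1 := hG.mono_le (i := u + 1) (j := n) (by omega) le_rfl
  have hu2 := hG.mono u u.2
  obtain ⟨D, hD1, hD2⟩ := hs.inv
  obtain rfl := hD2 u hu
  refine Runs.assign_seq ⟨?_, ?_⟩ (by simp only [Expr.cost]; omega) ?_
  · simp [Expr.Fits]; omega
  · simp [Expr.eval, hhead, hque]; omega
  refine Runs.assign_seq ⟨?_, ?_⟩ (by simp only [Expr.cost]; omega) ?_
  · simp [Expr.Fits, Expr.eval, hhead, hque]; omega
  · simp [Expr.eval, hhead, hque, ha0]; omega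
  refine Runs.assign_seq ⟨⟨?_, ?_, ?_⟩, ?_⟩ (by simp only [Expr.cost]; omega) ?_
  · simp [Expr.Fits, Expr.eval, hhead, hque]; omega
  · simp [Expr.Fits]; omega
  · simp [Expr.eval, Op.eval, hhead, hque]; omega
  · simp [Expr.eval, Op.eval, hhead, hque, ha0]; omega
  simp only [Expr.eval, Op.eval, State.var_setVar, State.arr_setVar, hhead, hque, ha0, if_true,
    Expr.cost]
  set s₁ := ((s.setVar 24 u).setVar 25 (s₀.arr 0 u)).setVar 26 (s₀.arr 0 (u + 1)) with hs₁
  have hinit : VisitInv H src d par s₀ h u q (s₀.arr 0 u) s₁ :=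
    { agree := ⟨by simpa [hs₁] using hs.agree.1, hs.agree.2⟩
      head := by simpa [hs₁] using hs.head
      vertex := by simp [hs₁]
      position := by simp [hs₁]
      limit := by simp [hs₁]
      le_position := le_rfl
      position_le := hu2
      holds := hs.holds.congr (by simp [hs₁]) rfl
      inv := hD1
      current := hu
      seen := fun i h1 h2 => by omega }
  have hloop := Runs.loop (W := W) (s := s₁) (e := .bin .lt (.var 25) (.var 26))
    (p := bfsVisit d par F)
    (Q := fun s' => ∃ q', q <+: q' ∧ VisitInv H src d par s₀ h u q' (s₀.arr 0 (u + 1)) s')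
    (fun (g : List (Fin n) × ℕ) s' => q <+: g.1 ∧ VisitInv H src d par s₀ h u g.1 g.2 s')
    -- `34` is 30 for a visit plus 4 for the loop test; the final 4 is the failing test.
    (fun g => (s₀.arr 0 (u + 1) - g.2) * (F.cost + 34) + 4) ?_ ?_ ?_ (g := (q, s₀.arr 0 u))
    ⟨List.prefix_rfl, hinit⟩
  · refine Runs.seq_le (T' := (s₀.arr 0 (u + 1) - s₀.arr 0 u) * (F.cost + 34) + 4) (by omega)
      (hloop.mono le_rfl ?_)
    rintro s' ⟨q', hq', h1⟩
    have hq'n : q'.length ≤ n := by simpa using List.Nodup.length_le_card h1.inv.nodup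
    obtain ⟨hh', -⟩ := List.getElem?_eq_some_iff.1 h1.current
    have h22 := h1.head
    refine Runs.assign_le ⟨?_, ?_, ?_⟩ (by simp only [Expr.cost]; omega) ⟨q', hq', ?_⟩
    · simp [Expr.Fits]; omega
    · simp [Expr.Fits]; omega
    · simp [Expr.eval, Op.eval]; omega
    · refine ⟨⟨by simpa using h1.agree.1, h1.agree.2⟩, by simp [Expr.eval, Op.eval, h22], hh',
        h1.holds.congr (by simp) rfl, ?_⟩
      have hall : ∀ w, H.Adj u w → w ∈ q' := fun w hw => by
        obtain ⟨j, hj1, hj2, hj3⟩ := (hG.adj u w).1 (hHG hw)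
        exact h1.seen j hj1 hj2 w hj3 hw
      rcases hq : q'[h + 1]? with _ | u'
      · exact ⟨_, h1.inv.process h1.current hall (by simp [hq]) fun _ => rfl, by simp⟩
      · obtain ⟨h4, -⟩ := List.getElem?_eq_some_iff.1 hq
        exact ⟨_, h1.inv.process h1.current hall (D' := H.dist src u') (by simp [hq])
          fun h => by omega, by simp⟩
  · rintro ⟨q', j⟩ s' ⟨-, h1⟩
    have := h1.position
    have := h1.limit
    have := h1.position_le
    exact ⟨by simp only [Expr.Fits]; omega, by simp only [Expr.Fits]; omega,
      (Op.lt_eval_le_one _ _).trans_lt (by omega)⟩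
  · rintro ⟨q', j⟩ s' ⟨hq', h1⟩ h2
    have hj : j < s₀.arr 0 (u + 1) := by
      simpa [Expr.eval, Op.eval, h1.position, h1.limit] using h2
    refine ⟨F.cost + 30, (runs_bfsVisit hH hA hG hF hW h1 hj).mono le_rfl ?_⟩
    rintro s'' ⟨q'', h3, h4⟩
    refine ⟨(q'', j + 1), ⟨hq'.trans h3, h4⟩, ?_⟩
    obtain ⟨k, hk⟩ := Nat.exists_eq_add_of_lt hj
    rw [hk, show j + k + 1 - (j + 1) = k by omega, show j + k + 1 - j = k + 1 by omega]
    simp only [Expr.cost]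
    ring_nf
    omega
  · rintro ⟨q', j⟩ s' ⟨hq', h1⟩ h2
    have hj : s₀.arr 0 (u + 1) ≤ j := by
      simpa [Expr.eval, Op.eval, h1.position, h1.limit] using h2
    obtain rfl : j = s₀.arr 0 (u + 1) := le_antisymm h1.position_le hj
    exact ⟨by simp [Expr.cost], q', hq', h1⟩

/-- The result of a breadth-first search of `H` from `src`. -/
structure HoldsSearch (H : SimpleGraph (Fin n)) (src : Fin n) (d par : ℕ) (s : State) : Prop where
  dist : ∀ v : Fin n, s.arr d v = H.dist src v + 1
  parent : ∀ v, v ≠ src → ∃ w : Fin n, s.arr par v = w ∧ H.Adj v w ∧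
    H.dist src v = H.dist src w + 1
  last : ∃ x : Fin n, s.var 28 = x ∧ s.var 29 = H.dist src x + 1 ∧
    ∀ u, H.dist src u ≤ H.dist src x

theorem runs_bfs (hH : H.Connected) (hHG : H ≤ G) (hA : SearchArrays d par) (hG : HoldsGraph G N s)
    (hF : SelectsEdges W d par F G H s) (hW : N + 3 ≤ W) (hsrc : s.var 20 = src) :
    Runs W (bfs d par F) s ((F.cost + 45) * N + 28) (HoldsSearch H src d par) := by
  have htot := hG.total
  have hdn := hH.dist_lt_card src
  rw [Fintype.card_fin] at hdn
  have hsrcn := src.2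
  have hfor := Runs.forN (W := W) (n := n) (i := 21) (body := .put d (.var 21) (.const 0)) (s := s)
    (fun k s' => SearchAgree d par s s' ∧ s'.var 20 = src ∧ ∀ i < k, s'.arr d i = 0) (fun _ => 3)
    (by omega) rfl ⟨⟨rfl, fun _ _ _ _ => rfl⟩, hsrc, by simp⟩ (fun k s' h => h.1.1.trans hG.var_zero)
    (fun k s' z h => ⟨⟨by simpa using h.1.1, h.1.2⟩, by simpa using h.2.1, h.2.2⟩) ?_
  swap
  · rintro k hk s' ⟨h1, h2, h3⟩ h4
    refine Runs.put_le ?_ ?_ (by simp [Expr.cost]) ⟨⟨h1.1, fun a h5 h6 h7 => ?_⟩, h2, fun i hi => ?_⟩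
    · simp only [Expr.Fits]; omega
    · simp only [Expr.Fits]; omega
    · simp [State.arr_setArr, h5, h1.2 a h5 h6 h7]
    · simp only [Expr.eval, h4, State.arr_setArr_apply, true_and]
      split_ifs with h8
      · rfl
      · exact h3 i (by omega)
  have hN : (F.cost + 45) * N = 11 * N + (F.cost + 34) * N := by ring
  simp only [Finset.sum_const, Finset.card_range, smul_eq_mul] at hfor
  refine Runs.seq_le (by omega) (hfor.mono le_rfl ?_)
  rintro s₁ ⟨hag, h20, hzero⟩
  refine Runs.put_seq ?_ ?_ (by simp only [Expr.cost]; omega) ?_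
  · simp only [Expr.Fits]; omega
  · simp only [Expr.Fits]; omega
  refine Runs.put_seq ?_ ?_ (by simp only [Expr.cost]; omega) ?_
  · simp [Expr.Fits]; omega
  · simp [Expr.Fits]; omega
  refine Runs.assign_seq ?_ (by simp only [Expr.cost]; omega) ?_
  · simp [Expr.Fits]; omega
  refine Runs.assign_seq ?_ (by simp only [Expr.cost]; omega) ?_
  · simp [Expr.Fits]; omega
  simp only [Expr.eval, State.var_setArr, h20, Expr.cost]
  set s₂ := (((s₁.setArr 10 0 src).setArr d src 1).setVar 22 0).setVar 23 1 with hs₂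
  have hn1 := hA.d_par
  have hn2 := hA.d_queue
  have hn3 := hA.par_queue
  have hinit : StepInv H src d par s [src] 0 s₂ :=
    { agree := ⟨by simpa [hs₂] using hag.1, fun a h1 h2 h3 => by
        simp [hs₂, State.arr_setArr, h1, h3, hag.2 a h1 h2 h3]⟩
      head := by simp [hs₂]
      le_length := by simp
      holds :=
        { tail := by simp [hs₂]
          queue := fun i hi => by
            obtain rfl : i = 0 := by simpa using hi
            simp [hs₂, hn2.symm]
          dist := fun v => by
            by_cases hv : v = src
            · simp [hs₂, hv]
            · have : (v : ℕ) ≠ src := fun h => hv (Fin.ext h)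
              simp [hs₂, hv, this, hn2, hzero v v.2]
          parent := by simp }
      inv := ⟨0, .init, by simp⟩ }
  -- The price of processing `v`: its adjacency list, 19 for the rest of the step and 4 for the
  -- test. The potential is the total price of the unprocessed vertices.
  let w : Fin n → ℕ := fun v => (s.arr 0 (v + 1) - s.arr 0 v) * (F.cost + 34) + 23
  have hloop := Runs.loop (W := W) (s := s₂) (e := .bin .lt (.var 22) (.var 23))
    (p := bfsStep d par F)
    (Q := fun s' => ∃ q, StepInv H src d par s q q.length s')
    (fun (g : List (Fin n) × ℕ) s' => StepInv H src d par s g.1 g.2 s')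
    (fun g => ∑ v ∈ Finset.univ \ (g.1.take g.2).toFinset, w v + 4) ?_ ?_ ?_ (g := ([src], 0)) hinit
  · refine Runs.seq_le (T' := (F.cost + 34) * N + 4) (by omega) (hloop.mono ?_ ?_)
    · have : ∑ v, w v + 11 * n ≤ (F.cost + 34) * N := by
        simp only [w, Finset.sum_add_distrib, ← Finset.sum_mul, Finset.sum_const, Finset.card_univ,
          Fintype.card_fin, smul_eq_mul]
        rw [← hG.sum_eq]
        nlinarith [Nat.zero_le (F.cost * n)]
      simp only [List.take_zero, List.toFinset_nil, Finset.sdiff_empty]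
      omega
    rintro s' ⟨q, hq⟩
    obtain ⟨D, hD, -⟩ := hq.inv
    have hmem := hD.mem_of_length_le hH le_rfl
    have hlen : q.length ≤ n := by simpa using List.Nodup.length_le_card hD.nodup
    have hpos : 0 < q.length := List.length_pos_of_mem hD.src_mem
    have h23 := hq.holds.tail
    have hlast := hq.holds.queue (q.length - 1) (by omega)
    have hlastn := q[q.length - 1].2
    have hd := hq.holds.dist q[q.length - 1]
    rw [if_pos (hmem _)] at hd
    have hdn' := hdn q[q.length - 1]
    refine Runs.assign_seq ⟨⟨?_, ?_, ?_⟩, ?_⟩ (by simp only [Expr.cost]; omega) ?_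
    · simp only [Expr.Fits]; omega
    · simp only [Expr.Fits]; omega
    · simp only [Expr.eval, Op.eval]; omega
    · simp only [Expr.eval, Op.eval, h23, hlast]; omega
    simp only [Expr.eval, Op.eval, h23, hlast]
    refine Runs.assign_le ⟨?_, ?_⟩ (by simp only [Expr.cost]; omega) ⟨fun v => ?_, fun v hv => ?_, ?_⟩
    · simp only [Expr.Fits, State.var_setVar, if_true]; omega
    · simp only [Expr.eval, State.var_setVar, if_true, State.arr_setVar, hd]; omega
    · simpa [hmem v] using hq.holds.dist v
    · exact hq.holds.parent v (hmem v) hv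
    -- The queue is sorted by distance, so its last vertex is farthest from `src`.
    · refine ⟨q[q.length - 1], by simp, by simp [Expr.eval, hd], fun u => ?_⟩
      obtain ⟨i, hi, rfl⟩ := List.mem_iff_getElem.1 (hmem u)
      rcases eq_or_lt_of_le (show i ≤ q.length - 1 by omega) with rfl | h
      · exact le_rfl
      · exact List.pairwise_iff_getElem.1 hD.sorted i _ hi (by omega) h
  · rintro ⟨q, h⟩ s' h1
    have := h1.head
    have := h1.holds.tail
    have := h1.le_length
    obtain ⟨D, hD, -⟩ := h1.inv
    have : q.length ≤ n := by simpa using List.Nodup.length_le_card hD.nodup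
    simp only at *
    exact ⟨by simp only [Expr.Fits]; omega, by simp only [Expr.Fits]; omega,
      (Op.lt_eval_le_one _ _).trans_lt (by omega)⟩
  · rintro ⟨q, h⟩ s' h1 h2
    simp only at h1
    have hh : h < q.length := by
      simpa [Expr.eval, Op.eval, h1.head, h1.holds.tail] using h2
    have hu : q[h]? = some q[h] := List.getElem?_eq_getElem hh
    refine ⟨_, (runs_bfsStep hH hHG hA hG hF hW h1 hu).mono le_rfl ?_⟩
    rintro s'' ⟨q', ⟨l, rfl⟩, h4⟩
    refine ⟨(q ++ l, h + 1), h4, ?_⟩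
    obtain ⟨D, hD, -⟩ := h1.inv
    have hnot : q[h] ∉ q.take h := by
      intro hmem
      obtain ⟨i, hi, hi'⟩ := List.mem_iff_getElem.1 hmem
      rw [List.getElem_take] at hi'
      have := (List.Nodup.getElem_inj_iff hD.nodup).1 hi'
      simp at hi
      omega
    have htake : (q ++ l).take (h + 1) = q.take h ++ [q[h]] := by
      rw [List.take_append_of_le_length hh, List.take_append_getElem hh]
    have hset : Finset.univ \ ((q ++ l).take (h + 1)).toFinset =
        (Finset.univ \ (q.take h).toFinset).erase q[h] := by
      rw [htake]
      ext v
      simp only [Finset.mem_sdiff, Finset.mem_univ, true_and, List.mem_toFinset, List.mem_append,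
        List.mem_singleton, Finset.mem_erase]
      tauto
    have := Finset.add_sum_erase (Finset.univ \ (q.take h).toFinset) w (a := q[h]) (by simpa using hnot)
    simp only [hset, Expr.cost]
    simp only [w] at this ⊢
    omega
  · rintro ⟨q, h⟩ s' h1 h2
    simp only at h1
    have hh : q.length ≤ h := by
      simpa [Expr.eval, Op.eval, h1.head, h1.holds.tail] using h2
    obtain rfl := le_antisymm h1.le_length hh
    exact ⟨by simp [Expr.cost], q, h1⟩

end

end WordRAM

namespace SimpleGraph

theorem Connected.ecc_eq_of_forall_dist_le {V : Type*} [Finite V] {G : SimpleGraph V}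
    (hG : G.Connected) {v x : V} (h : ∀ u, G.dist v u ≤ G.dist v x) : G.ecc v = G.dist v x := by
  obtain ⟨u, hu⟩ := hG.exists_dist_eq_ecc v
  exact le_antisymm (hu ▸ h u) (hG.dist_le_ecc v x)

end SimpleGraph

namespace WordRAM

/-! ### The input -/

section
variable {n : ℕ} {G : SimpleGraph (Fin n)}

theorem AdjLists.sum_length (A : AdjLists G) :
    ∑ v, (A.nbrs v).length = 2 * G.edgeSet.ncard := by
  classical
  have h1 : ∀ v, (A.nbrs v).length = G.degree v := fun v => by
    rw [← List.toFinset_card_of_nodup (A.nodup v), ← SimpleGraph.card_neighborFinset_eq_degree]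
    congr 1
    ext w
    simp [A.mem_nbrs]
  simp_rw [h1]
  rw [G.sum_degrees_eq_twice_card_edges, ← SimpleGraph.coe_edgeFinset, Set.ncard_coe_finset]

theorem AdjLists.init_arr_zero (A : AdjLists G) {i : ℕ} (hi : i ≤ n) :
    A.init.arr 0 i = (((List.ofFn A.nbrs).take i).map List.length).sum := by
  simp [AdjLists.init, hi]

theorem AdjLists.init_arr_zero_last (A : AdjLists G) : A.init.arr 0 n = 2 * G.edgeSet.ncard := by
  rw [A.init_arr_zero le_rfl, List.take_of_length_le (by simp), List.map_ofFn, List.sum_ofFn,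
    ← A.sum_length]
  rfl

theorem AdjLists.flatten_length (A : AdjLists G) :
    (List.ofFn A.nbrs).flatten.length = A.init.arr 0 n := by
  rw [A.init_arr_zero le_rfl, List.take_of_length_le (by simp), List.length_flatten]

theorem AdjLists.init_arr_one (A : AdjLists G) {j : ℕ} (hj : j < (List.ofFn A.nbrs).flatten.length) :
    A.init.arr 1 j = (List.ofFn A.nbrs).flatten[j] := by
  simp only [AdjLists.init, if_neg one_ne_zero, if_true]
  rw [List.getD_eq_getElem _ _ (by rwa [List.length_map]), List.getElem_map]

theorem AdjLists.init_arr_zero_succ (A : AdjLists G) {i : ℕ} (hi : i < n) :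
    A.init.arr 0 (i + 1) = A.init.arr 0 i + (A.nbrs ⟨i, hi⟩).length := by
  rw [A.init_arr_zero hi.le, A.init_arr_zero hi, List.map_take, List.map_take,
    List.sum_take_succ _ _ (by simpa using hi)]
  simp

theorem AdjLists.holdsGraph_init (A : AdjLists G) :
    HoldsGraph G (n + 2 * G.edgeSet.ncard) A.init where
  var_zero := by simp [AdjLists.init]
  zero := by simp [AdjLists.init]
  mono i hi := by
    rw [A.init_arr_zero_succ hi]
    omega
  total := by rw [A.init_arr_zero_last]
  lt j hj := by
    rw [← A.flatten_length] at hj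
    rw [A.init_arr_one hj]
    exact Fin.is_lt _
  adj v w := by
    have hv := v.2
    have hmono : ∀ i j, i ≤ j → j ≤ n → A.init.arr 0 i ≤ A.init.arr 0 j := fun i j hij hj => by
      induction j, hij using Nat.le_induction with
      | base => exact le_rfl
      | succ k hk ih =>
        rw [A.init_arr_zero_succ (by omega)]
        exact (ih (by omega)).trans (by omega)
    have hle := A.flatten_length ▸ hmono (v + 1) n hv le_rfl
    have h := List.drop_take_succ_flatten_eq_getElem (List.ofFn A.nbrs) v (by simp)
    rw [← List.map_take, ← List.map_take, ← A.init_arr_zero (i := v + 1) hv, ← A.init_arr_zero hv.le,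
      List.getElem_ofFn] at h
    rw [← A.mem_nbrs]
    have h' : A.nbrs v = A.nbrs ⟨v, hv⟩ := rfl
    rw [h', ← h, List.mem_iff_getElem]
    constructor
    · rintro ⟨i, hi, rfl⟩
      simp only [List.length_drop, List.length_take] at hi
      refine ⟨A.init.arr 0 v + i, by omega, by omega, ?_⟩
      rw [A.init_arr_one (by omega)]
      simp
    · rintro ⟨j, h1, h2, h3⟩
      refine ⟨j - A.init.arr 0 v, by rw [List.length_drop, List.length_take]; omega, ?_⟩
      rw [A.init_arr_one (by omega)] at h3
      apply Fin.ext
      rw [← h3]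
      simp [Nat.add_sub_cancel' h1]

end

/-! ### Searches as parts of programs -/

section
variable {n : ℕ} {G H : SimpleGraph (Fin n)} {N W d par T : ℕ} {F : Expr} {src : Fin n} {s : State}

theorem HoldsGraph.of_frame {p : Prog} {s' : State} (h : HoldsGraph G N s) (hf : Frame p s s')
    (h0 : p.writesVar 0 = false) (h1 : p.writesArr 0 = false) (h2 : p.writesArr 1 = false) :
    HoldsGraph G N s' :=
  h.congr (hf.1 0 h0) (hf.2 0 h1) (hf.2 1 h2)

theorem HoldsGraph.setVar (h : HoldsGraph G N s) {x z : ℕ} (hx : x ≠ 0) :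
    HoldsGraph G N (s.setVar x z) :=
  h.congr (by simp [hx.symm]) rfl rfl

theorem HoldsGraph.setArr (h : HoldsGraph G N s) {a i z : ℕ} (h0 : a ≠ 0) (h1 : a ≠ 1) :
    HoldsGraph G N (s.setArr a i z) :=
  h.congr rfl (by simp [State.arr_setArr, h0.symm]) (by simp [State.arr_setArr, h1.symm])

/-- The configurations `s` and `s'` agree up to the registers and arrays used by a search. -/
structure SearchFrame (d par : ℕ) (s s' : State) : Prop where
  var : ∀ x, x < 21 ∨ 29 < x → s'.var x = s.var x
  arr : ∀ a, a ≠ d → a ≠ par → a ≠ 10 → s'.arr a = s.arr a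

theorem Runs.bfs_seq {p : Prog} {Q : State → Prop} (hH : H.Connected) (hHG : H ≤ G)
    (hA : SearchArrays d par) (hG : HoldsGraph G N s) (hF : SelectsEdges W d par F G H s)
    (hW : N + 3 ≤ W) (hsrc : s.var 20 = src) (hT : (F.cost + 45) * N + 28 ≤ T)
    (h : ∀ s', HoldsGraph G N s' → HoldsSearch H src d par s' → SearchFrame d par s s' →
      Runs W p s' (T - ((F.cost + 45) * N + 28)) Q) : Runs W (.seq (bfs d par F) p) s T Q := by
  refine Runs.seq_le hT ((runs_bfs hH hHG hA hG hF hW hsrc).frame.mono le_rfl ?_)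
  rintro s' ⟨h1, h2⟩
  have hf : SearchFrame d par s s' := by
    refine ⟨fun x hx => h2.1 x ?_, fun a h3 h4 h5 => h2.2 a ?_⟩
    · simp [bfs, bfsStep, bfsVisit, WordRAM.forN, Prog.writesVar]
      omega
    · simp [bfs, bfsStep, bfsVisit, WordRAM.forN, Prog.writesArr]
      omega
  refine h s' (hG.congr (hf.var 0 (by omega)) ?_ ?_) h1 hf
  · exact hf.arr 0 hA.d_zero.symm hA.par_zero.symm (by decide)
  · exact hf.arr 1 hA.d_one.symm hA.par_one.symm (by decide)

theorem selectsEdges_one (hW : 1 < W) : SelectsEdges W d par (.const 1) G G s :=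
  fun _ _ _ _ h _ _ => ⟨hW, by simp [Expr.eval, h]⟩

theorem HoldsSearch.exists_last (hH : H.Connected) (h : HoldsSearch H src d par s) :
    ∃ x : Fin n, s.var 28 = x ∧ s.var 29 = H.ecc src + 1 ∧ H.dist src x = H.ecc src := by
  obtain ⟨x, h1, h2, h3⟩ := h.last
  rw [← hH.ecc_eq_of_forall_dist_le h3] at h2
  exact ⟨x, h1, h2, (hH.ecc_eq_of_forall_dist_le h3).symm⟩

end

end WordRAM

namespace WordRAM

/-! ### Searching for a vertex of smaller eccentricity -/

/-- Breadth-first search of the input graph. -/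
abbrev search (d par : ℕ) : Prog := bfs d par (.const 1)

/-- Mark the neighbours of the vertex in register `32` that are closer to the source of array `8`. -/
def markCloser : Prog :=
  forN 33 <| .ite (.bin .mul (.bin .eq (.get 7 (.var 33)) (.const 2))
      (.bin .eq (.bin .add (.get 8 (.var 33)) (.const 1)) (.get 8 (.var 32))))
    (.put 6 (.var 33) (.const 1)) .skip

/-- Mark the candidates coming from the vertex in register `32`. -/
def markStep : Prog :=
  .ite (.bin .mul (.bin .lt (.get 4 (.var 32)) (.const 4))
      (.bin .eq (.bin .add (.get 4 (.var 32)) (.get 5 (.var 32))) (.bin .add (.var 31) (.const 1))))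
    (.seq (.put 6 (.var 32) (.const 1)) <|
     .seq (.assign 20 (.var 32)) <|
     .seq (search 7 9) <|
     .seq (.assign 20 (.var 28)) <|
     .seq (search 8 9) markCloser)
    .skip

/-- If the vertex in register `32` is marked, then compute its eccentricity and compare it with that
of the vertex in register `1`. -/
def compareStep : Prog :=
  .ite (.get 6 (.var 32))
    (.seq (.assign 20 (.var 32)) <|
     .seq (search 7 9) <|
     .ite (.bin .lt (.var 29) (.var 35))
      (.seq (.assign 35 (.var 29)) (.assign 1 (.var 32))) .skip)
    .skip

/-- Replace the vertex in register `1` by a vertex of smaller eccentricity, unless it is central. -/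
def improve : Prog :=
  .seq (.assign 20 (.var 1)) <|
  .seq (search 4 9) <|
  .seq (.assign 20 (.var 28)) <|
  .seq (.assign 31 (.var 29)) <|
  .seq (.assign 35 (.var 29)) <|
  .seq (search 5 9) <|
  .seq (forN 32 (.put 6 (.var 32) (.const 0))) <|
  .seq (forN 32 markStep) (forN 32 compareStep)

/-! ### Correctness of the marking of candidates -/

section
variable {n : ℕ} {G H : SimpleGraph (Fin n)} {N W T : ℕ} {s s' : State} {a c v z : Fin n}
  {S : Finset (Fin n)}

/-- The array `d` contains the distances from `src` plus one. -/
def HoldsDist (G : SimpleGraph (Fin n)) (src : Fin n) (d : ℕ) (s : State) : Prop :=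
  ∀ v : Fin n, s.arr d v = G.dist src v + 1

theorem HoldsDist.congr {d : ℕ} (h : HoldsDist G c d s) (h' : s'.arr d = s.arr d) :
    HoldsDist G c d s' := fun v => by rw [h', h v]

open Classical in
/-- The array `6` contains the indicator function of `S`. -/
def Marks (S : Finset (Fin n)) (s : State) : Prop :=
  ∀ b : Fin n, s.arr 6 b = if b ∈ S then 1 else 0

theorem Marks.congr (h : Marks S s) (h' : s'.arr 6 = s.arr 6) : Marks S s' := fun b => by
  rw [h', h b]

open Classical in
theorem Marks.insert (h : Marks S s) (h' : s'.arr 6 = Function.update (s.arr 6) a 1) :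
    Marks (insert a S) s' := fun b => by
  rw [h', Function.update_apply]
  by_cases hb : b = a
  · simp [hb]
  · have : (b : ℕ) ≠ a := fun h => hb (Fin.ext h)
    simp [hb, this, h b]

open Classical in
/-- The candidates contributed by `a`, where `z` is a vertex farthest from `a`. -/
noncomputable def candPart (G : SimpleGraph (Fin n)) (a z : Fin n) : Finset (Fin n) :=
  {b | b = a ∨ G.dist a b = 1 ∧ G.dist b z + 1 = G.dist a z}

open Classical in
theorem runs_markCloser (hH : G.Connected) (h0 : s.var 0 = n) (hW : 2 * n + 8 ≤ W)
    (ha : s.var 32 = a) (h7 : HoldsDist G a 7 s) (h8 : HoldsDist G z 8 s) (hS : Marks S s)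
    (haS : a ∈ S) : Runs W markCloser s (6 + n * 25) (Marks (S ∪ candPart G a z)) := by
  let P : Fin n → Prop := fun b => G.dist a b = 1 ∧ G.dist b z + 1 = G.dist a z
  have hdn := hH.dist_lt_card
  simp only [Fintype.card_fin] at hdn
  have h := Runs.forN (W := W) (n := n) (i := 33) (s := s)
    (body := .ite (.bin .mul (.bin .eq (.get 7 (.var 33)) (.const 2))
      (.bin .eq (.bin .add (.get 8 (.var 33)) (.const 1)) (.get 8 (.var 32))))
      (.put 6 (.var 33) (.const 1)) .skip)
    (fun k s' => s'.var 0 = n ∧ s'.var 32 = a ∧ HoldsDist G a 7 s' ∧ HoldsDist G z 8 s' ∧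
      Marks (S ∪ ({b | b < k ∧ P b} : Finset (Fin n))) s') (fun _ => 17)
    (by omega) rfl ⟨h0, ha, h7, h8, by simpa using hS⟩ (fun k s' h => h.1)
    (fun k s' z h => ⟨by simpa using h.1, by simpa using h.2.1, h.2.2.1, h.2.2.2.1, h.2.2.2.2⟩) ?_
  · refine h.mono (by simp) ?_
    rintro s' ⟨-, -, -, -, h1⟩
    convert h1 using 1
    ext b
    simp only [candPart, Finset.mem_union, Finset.mem_filter_univ, Fin.is_lt, true_and, P]
    constructor
    · rintro (h | rfl | h)
      exacts [.inl h, .inl haS, .inr h]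
    · rintro (h | h)
      exacts [.inl h, .inr (.inr h)]
  · rintro k hk s' ⟨h1, h2, h3, h4, h5⟩ h6
    obtain ⟨b, rfl⟩ : ∃ b : Fin n, k = b := ⟨⟨k, hk⟩, rfl⟩
    have h7b := h3 b
    have h8b := h4 b
    have h8a := h4 a
    have hd1 := hdn a b
    have hd2 := hdn z b
    have hd3 := hdn z a
    have hone : ∀ x y u w : ℕ, Op.mul.eval (Op.eq.eval x y) (Op.eq.eval u w) ≤ 1 := fun x y u w =>
      Nat.mul_le_mul (Op.eq_eval_le_one x y) (Op.eq_eval_le_one u w)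
    have hone' := Op.eq_eval_le_one
    -- Because of the shift, entry `2` of array `7` means adjacency to `a`; the product of the two
    -- tests is a conjunction.
    have hcond : ((.bin .mul (.bin .eq (.get 7 (.var 33)) (.const 2))
      (.bin .eq (.bin .add (.get 8 (.var 33)) (.const 1)) (.get 8 (.var 32))) : Expr).eval s' = 0) ↔
        ¬ P b := by
      simp only [Expr.eval, Op.eval, h6, h2, h7b, h8b, h8a, P, G.dist_comm (u := b) (v := z),
        G.dist_comm (u := a) (v := z), mul_eq_zero]
      split_ifs <;> simp [-SimpleGraph.dist_eq_one_iff_adj] <;> omega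
    refine Runs.ite_le ?_ (by simp [Expr.cost]) ?_ ?_
    · refine ⟨⟨⟨?_, ?_⟩, ?_, (hone' _ _).trans_lt (by omega)⟩,
        ⟨⟨⟨?_, ?_⟩, ?_, ?_⟩, ⟨?_, ?_⟩, (hone' _ _).trans_lt (by omega)⟩,
        (hone _ _ _ _).trans_lt (by omega)⟩ <;>
      simp only [Expr.Fits, Expr.eval, Op.eval, h6, h2, h7b, h8b, h8a] <;> omega
    · intro h
      have hb := not_not.1 (mt hcond.2 h)
      refine Runs.put_le ?_ ?_ (by simp [Expr.cost]) ⟨h1, h2, h3.congr ?_, h4.congr ?_, ?_⟩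
      · simp only [Expr.Fits]; omega
      · simp only [Expr.Fits]; omega
      · simp [State.arr_setArr]
      · simp [State.arr_setArr]
      · have h9 := h5.insert (s' := s'.setArr 6 b 1) (a := b) (by simp [State.arr_setArr])
        simp only [Expr.eval, h6]
        convert h9 using 1
        ext x
        simp only [Finset.mem_union, Finset.mem_filter_univ, Finset.mem_insert,
          Nat.lt_succ_iff_lt_or_eq, Fin.val_inj]
        constructor
        · rintro (h | ⟨h | rfl, h'⟩)
          exacts [.inr (.inl h), .inr (.inr ⟨h, h'⟩), .inl rfl]
        · rintro (rfl | h | ⟨h, h'⟩)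
          exacts [.inr ⟨.inr rfl, hb⟩, .inl h, .inr ⟨.inl h, h'⟩]
    · intro h
      have hb := hcond.1 h
      refine Runs.skip_le (by simp [Expr.cost]) ⟨h1, h2, h3, h4, ?_⟩
      convert h5 using 1
      ext x
      simp only [Finset.mem_union, Finset.mem_filter_univ, Nat.lt_succ_iff_lt_or_eq, Fin.val_inj]
      constructor
      · rintro (h | ⟨h | rfl, h'⟩)
        exacts [.inl h, .inr ⟨h, h'⟩, absurd h' hb]
      · rintro (h | ⟨h, h'⟩)
        exacts [.inl h, .inr ⟨.inl h, h'⟩]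

theorem searchArrays_nine {d : ℕ} (h : 4 ≤ d) (h' : d ≤ 8) : SearchArrays d 9 := by
  constructor <;> omega

open Classical in
-- The large term, two searches and one scan, is paid only for vertices of the near set.
theorem runs_markStep (hH : G.Connected) (hG : HoldsGraph G N s) (hW : 2 * N + 8 ≤ W)
    (ha : s.var 32 = a) (hk : s.var 31 = G.ecc c + 1) (hv : G.dist c v = G.ecc c)
    (h4 : HoldsDist G c 4 s) (h5 : HoldsDist G v 5 s) (hS : Marks S s) :
    Runs W markStep s (20 + if a ∈ G.nearSet c v then 118 * N + 100 else 0) fun s' =>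
      ∃ z, G.dist a z = G.ecc a ∧ Marks (if a ∈ G.nearSet c v then S ∪ candPart G a z else S) s' := by
  have hdn := hH.dist_lt_card
  simp only [Fintype.card_fin] at hdn
  have htot := hG.total
  have h4a := h4 a
  have h5a := h5 a
  have hd1 := hdn c a
  have hd2 := hdn v a
  have hd3 := hdn c v
  have hone : ∀ x y u w : ℕ, Op.mul.eval (Op.lt.eval x y) (Op.eq.eval u w) ≤ 1 := fun x y u w =>
    Nat.mul_le_mul (Op.lt_eval_le_one x y) (Op.eq_eval_le_one u w)
  have hone' := Op.eq_eval_le_one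
  have hone'' := Op.lt_eval_le_one
  -- With the shift, an entry below `4` means distance at most two. The sum of two entries carries
  -- two shifts and register `31` carries one, hence the extra `1`.
  have hcond : ((.bin .mul (.bin .lt (.get 4 (.var 32)) (.const 4))
      (.bin .eq (.bin .add (.get 4 (.var 32)) (.get 5 (.var 32)))
        (.bin .add (.var 31) (.const 1))) : Expr).eval s = 0) ↔ a ∉ G.nearSet c v := by
    rw [SimpleGraph.mem_nearSet]
    simp only [Expr.eval, Op.eval, ha, h4a, h5a, hk, hv, G.dist_comm (u := a) (v := v), mul_eq_zero]
    split_ifs <;> simp <;> omega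
  refine Runs.ite_le ?_ (by simp only [Expr.cost]; omega) ?_ ?_
  · refine ⟨⟨⟨?_, ?_⟩, ?_, (hone'' _ _).trans_lt (by omega)⟩,
      ⟨⟨⟨?_, ?_⟩, ⟨?_, ?_⟩, ?_⟩, ⟨?_, ?_, ?_⟩, (hone' _ _).trans_lt (by omega)⟩,
      (hone _ _ _ _).trans_lt (by omega)⟩ <;>
    simp only [Expr.Fits, Expr.eval, Op.eval, ha, h4a, h5a, hk] <;> omega
  · intro h
    have hnear := not_not.1 (mt hcond.2 h)
    simp only [hnear, if_true, Expr.cost]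
    refine Runs.put_seq ?_ ?_ (by simp only [Expr.cost]; omega) ?_
    · simp only [Expr.Fits]; omega
    · simp only [Expr.Fits]; omega
    refine Runs.assign_seq ?_ (by simp only [Expr.cost]; omega) ?_
    · simp only [Expr.Fits, State.var_setArr]; omega
    refine Runs.bfs_seq hH le_rfl (searchArrays_nine (by omega) (by omega))
      ((hG.setArr (by omega) (by omega)).setVar (by omega)) (selectsEdges_one (by omega)) (by omega)
      (src := a) (by simp [Expr.eval, ha]) (by simp only [Expr.cost]; omega) ?_
    intro s₁ hG₁ hs₁ hf₁
    obtain ⟨z, hz1, -, hz2⟩ := hs₁.exists_last hH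
    have hS₁ : Marks (insert a S) s₁ := hS.insert (by
      rw [hf₁.arr 6 (by omega) (by omega) (by omega)]
      simp [State.arr_setArr, Expr.eval, ha])
    have ha₁ : s₁.var 32 = a := by
      rw [hf₁.var 32 (by omega)]
      simpa using ha
    refine Runs.assign_seq ?_ (by simp only [Expr.cost]; omega) ?_
    · simp only [Expr.Fits]; omega
    refine Runs.bfs_seq hH le_rfl (searchArrays_nine (by omega) (by omega))
      (hG₁.setVar (by omega)) (selectsEdges_one (by omega)) (by omega)
      (src := z) (by simp [Expr.eval, hz1]) (by simp only [Expr.cost]; omega) ?_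
    intro s₂ hG₂ hs₂ hf₂
    refine (runs_markCloser (a := a) (z := z) (S := insert a S) hH hG₂.var_zero (by omega) ?_ ?_
      hs₂.dist ?_ (by simp)).mono (by simp only [Expr.cost]; omega) ?_
    · rw [hf₂.var 32 (by omega)]
      simpa using ha₁
    · exact HoldsDist.congr (s := s₁) hs₁.dist (hf₂.arr 7 (by omega) (by omega) (by omega))
    · exact hS₁.congr (hf₂.arr 6 (by omega) (by omega) (by omega))
    · intro s' h'
      refine ⟨z, hz2, ?_⟩
      convert h' using 1
      ext x
      simp only [candPart, Finset.mem_union, Finset.mem_insert, Finset.mem_filter_univ]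
      tauto
  · intro h
    obtain ⟨z, hz⟩ := hH.exists_dist_eq_ecc a
    refine Runs.skip_le (by simp only [Expr.cost]; omega) ⟨z, hz, ?_⟩
    rwa [if_neg (hcond.1 h)]

end

end WordRAM

namespace WordRAM

section
variable {n : ℕ} {G H : SimpleGraph (Fin n)} {N W T : ℕ} {s s' : State} {a c v z : Fin n}
  {S : Finset (Fin n)}

open Classical in
-- Separates the cost `A` paid by every vertex from the cost `C` paid only on `S`; with a search as
-- `C`, this keeps the total below quadratic.
theorem Runs.forN_fin {i A C : ℕ} {body : Prog} (S : Finset (Fin n)) (I : ℕ → State → Prop)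
    (hn : n + 1 < W) (hi : body.writesVar i = false) (h0 : I 0 s)
    (hvar : ∀ k s, I k s → s.var 0 = n) (hset : ∀ k s z, I k s → I k (s.setVar i z))
    (hbody : ∀ (a : Fin n) s, I a s → s.var i = a →
      Runs W body s (A + if a ∈ S then C else 0) (I (a + 1))) :
    Runs W (WordRAM.forN i body) s (6 + n * (A + 8) + S.card * C) (I n) := by
  refine (Runs.forN I (fun k => A + if ∃ a ∈ S, (a : ℕ) = k then C else 0) hn hi h0 hvar hset
    ?_).mono ?_ fun _ h => h
  · intro k hk s' h1 h2
    refine (hbody ⟨k, hk⟩ s' h1 h2).mono (Nat.add_le_add_left (le_of_eq (if_congr ?_ rfl rfl)) _)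
      fun _ h => h
    exact ⟨fun h => ⟨_, h, rfl⟩, fun ⟨a, ha, hak⟩ => by convert ha; exact hak.symm⟩
  · have h1 : ∀ i : Fin n, (∃ a ∈ S, (a : ℕ) = i) ↔ i ∈ S := fun i =>
      ⟨fun ⟨a, ha, h⟩ => Fin.ext h ▸ ha, fun h => ⟨i, h, rfl⟩⟩
    rw [Finset.sum_range]
    simp only [h1, Finset.sum_add_distrib, Finset.sum_const, Finset.card_univ, Fintype.card_fin,
      smul_eq_mul, Finset.sum_ite_mem, Finset.univ_inter]
    ring_nf
    omega

open Classical in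
theorem runs_compareStep (hH : G.Connected) (hG : HoldsGraph G N s) (hW : N + 3 ≤ W)
    (ha : s.var 32 = a) (hS : Marks S s) (hc : s.var 1 = c) (hk : s.var 35 = G.ecc c + 1) :
    Runs W compareStep s (5 + if a ∈ S then 46 * N + 40 else 0) fun s' =>
      ∃ c' : Fin n, s'.var 1 = c' ∧ s'.var 35 = G.ecc c' + 1 ∧ G.ecc c' ≤ G.ecc c ∧
        (a ∈ S → G.ecc c' ≤ G.ecc a) := by
  have htot := hG.total
  have hecc : ∀ c, G.ecc c < n := fun c => by
    obtain ⟨x, hx⟩ := hH.exists_dist_eq_ecc c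
    simpa [← hx] using hH.dist_lt_card c x
  have h6 := hS a
  refine Runs.ite_le ⟨?_, ?_⟩ (by simp only [Expr.cost]; omega) ?_ ?_
  · simp only [Expr.Fits]; omega
  · simp only [Expr.eval, ha, h6]; split_ifs <;> omega
  · intro h
    have haS : a ∈ S := by
      by_contra haS
      simp [Expr.eval, ha, h6, haS] at h
    simp only [haS, if_true, Expr.cost]
    refine Runs.assign_seq ?_ (by simp only [Expr.cost]; omega) ?_
    · simp only [Expr.Fits]; omega
    refine Runs.bfs_seq hH le_rfl (searchArrays_nine (by omega) (by omega))
      (hG.setVar (by omega)) (selectsEdges_one (by omega)) (by omega)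
      (src := a) (by simp [Expr.eval, ha]) (by simp only [Expr.cost]; omega) ?_
    intro s₁ hG₁ hs₁ hf₁
    obtain ⟨x, -, hx, -⟩ := hs₁.exists_last hH
    have h35 : s₁.var 35 = G.ecc c + 1 := by
      rw [hf₁.var 35 (by omega)]
      simpa using hk
    have h1 : s₁.var 1 = c := by
      rw [hf₁.var 1 (by omega)]
      simpa using hc
    have h32 : s₁.var 32 = a := by
      rw [hf₁.var 32 (by omega)]
      simpa using ha
    have hea := hecc a
    have hec := hecc c
    refine Runs.ite_le ⟨?_, ?_, (Op.lt_eval_le_one _ _).trans_lt (by omega)⟩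
      (by simp only [Expr.cost]; omega) ?_ ?_
    · simp only [Expr.Fits]; omega
    · simp only [Expr.Fits]; omega
    · intro hlt
      have hlt' : G.ecc a < G.ecc c := by simpa [Expr.eval, Op.eval, hx, h35] using hlt
      refine Runs.assign_seq ?_ (by simp only [Expr.cost]; omega) ?_
      · simp only [Expr.Fits]; omega
      refine Runs.assign_le ?_ (by simp only [Expr.cost]; omega) ⟨a, ?_⟩
      · simp [Expr.Fits]; omega
      · simp [Expr.eval, hx, h32, hlt'.le]
    · intro hlt
      have hlt' : G.ecc c ≤ G.ecc a := by simpa [Expr.eval, Op.eval, hx, h35] using hlt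
      exact Runs.skip_le (by simp only [Expr.cost]; omega) ⟨c, h1, h35, le_rfl, fun _ => hlt'⟩
  · intro h
    have haS : a ∉ S := by
      intro haS
      simp [Expr.eval, ha, h6, haS] at h
    exact Runs.skip_le (by simp only [Expr.cost]; omega) ⟨c, hc, hk, le_rfl, fun h => absurd h haS⟩

open Classical in
-- The function `z` is built along the loop: an arbitrary choice of farthest vertices is overwritten
-- at `a` by the one which the search returned, without affecting earlier contributions.
theorem runs_mark (hH : G.Connected) (hG : HoldsGraph G N s) (hW : 2 * N + 8 ≤ W)
    (hk : s.var 31 = G.ecc c + 1) (hv : G.dist c v = G.ecc c)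
    (h4 : HoldsDist G c 4 s) (h5 : HoldsDist G v 5 s) (h6 : ∀ i < n, s.arr 6 i = 0) :
    Runs W (forN 32 markStep) s (6 + n * 28 + (G.nearSet c v).card * (118 * N + 100)) fun s' =>
      ∃ z, (∀ a, G.dist a (z a) = G.ecc a) ∧ Marks (G.candSet c v z) s' := by
  have htot := hG.total
  refine (Runs.forN_fin (G.nearSet c v) (fun k s' => HoldsGraph G N s' ∧ s'.var 31 = G.ecc c + 1 ∧
      HoldsDist G c 4 s' ∧ HoldsDist G v 5 s' ∧ ∃ z : Fin n → Fin n, (∀ a, G.dist a (z a) = G.ecc a) ∧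
        Marks {b | ∃ a ∈ G.nearSet c v, a < k ∧ b ∈ candPart G a (z a)} s')
    (by omega) rfl ?_ (fun k s' h => h.1.var_zero) ?_ ?_).mono le_rfl ?_
  · choose z hz using hH.exists_dist_eq_ecc
    exact ⟨hG, hk, h4, h5, z, hz, fun b => by simpa using h6 b b.2⟩
  · rintro k s' x ⟨h1, h2, h3, h4, h5⟩
    exact ⟨h1.setVar (by omega), by simpa using h2, h3, h4, h5⟩
  · rintro a s' ⟨h1, h2, h3, h4, z, hz, h5⟩ ha
    refine (runs_markStep hH h1 hW ha h2 hv h3 h4 h5).frame.mono le_rfl ?_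
    rintro s'' ⟨⟨x, hx, h6⟩, hf⟩
    refine ⟨h1.of_frame hf rfl rfl rfl, (hf.1 31 rfl).trans h2, h3.congr (hf.2 4 rfl),
      h4.congr (hf.2 5 rfl), Function.update z a x, fun a' => ?_, ?_⟩
    · by_cases h : a' = a
      · subst h; simpa using hx
      · simpa [h] using hz a'
    · convert h6 using 1
      ext b
      have hne : ∀ a' : Fin n, (a' : ℕ) < a → Function.update z a x a' = z a' := fun a' h =>
        Function.update_of_ne (fun h' => by simp [h'] at h) _ _
      simp only [Finset.mem_filter_univ, Nat.lt_succ_iff_lt_or_eq, Fin.val_inj]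
      constructor
      · rintro ⟨a', h7, h8 | rfl, h9⟩
        · rw [hne a' h8] at h9
          split_ifs
          · exact Finset.mem_union_left _ ((Finset.mem_filter_univ _).2 ⟨a', h7, h8, h9⟩)
          · exact (Finset.mem_filter_univ _).2 ⟨a', h7, h8, h9⟩
        · rw [Function.update_self] at h9
          rw [if_pos h7]
          exact Finset.mem_union_right _ h9
      · intro h
        have hold : (∃ a' ∈ G.nearSet c v, (a' : ℕ) < a ∧ b ∈ candPart G a' (z a')) →
            ∃ a' ∈ G.nearSet c v, ((a' : ℕ) < a ∨ a' = a) ∧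
              b ∈ candPart G a' (Function.update z a x a') := fun ⟨a', h7, h8, h9⟩ =>
          ⟨a', h7, .inl h8, by rwa [hne a' h8]⟩
        split_ifs at h with h7
        · rcases Finset.mem_union.1 h with h | h
          · exact hold (by simpa only [Finset.mem_filter_univ] using h)
          · exact ⟨a, h7, .inr rfl, by rwa [Function.update_self]⟩
        · exact hold (by simpa only [Finset.mem_filter_univ] using h)
  · rintro s' ⟨-, -, -, -, z, hz, h⟩
    refine ⟨z, hz, ?_⟩
    convert h using 1
    ext b
    simp [SimpleGraph.mem_candSet, candPart]

open Classical in
theorem runs_compare (hH : G.Connected) (hG : HoldsGraph G N s) (hW : N + 3 ≤ W)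
    (hS : Marks S s) (hc : s.var 1 = c) (hk : s.var 35 = G.ecc c + 1) :
    Runs W (forN 32 compareStep) s (6 + n * 13 + S.card * (46 * N + 40)) fun s' =>
      ∃ c' : Fin n, s'.var 1 = c' ∧ G.ecc c' ≤ G.ecc c ∧ ∀ a ∈ S, G.ecc c' ≤ G.ecc a := by
  have htot := hG.total
  refine (Runs.forN_fin S (fun k s' => HoldsGraph G N s' ∧ Marks S s' ∧
      ∃ c' : Fin n, s'.var 1 = c' ∧ s'.var 35 = G.ecc c' + 1 ∧ G.ecc c' ≤ G.ecc c ∧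
        ∀ a ∈ S, a < k → G.ecc c' ≤ G.ecc a)
    (by omega) rfl ⟨hG, hS, c, hc, hk, le_rfl, by simp⟩ (fun k s' h => h.1.var_zero) ?_ ?_).mono
    le_rfl ?_
  · rintro k s' x ⟨h1, h2, c', h3, h4, h5⟩
    exact ⟨h1.setVar (by omega), h2, c', by simpa using h3, by simpa using h4, h5⟩
  · rintro a s' ⟨h1, h2, c', h3, h4, h5, h6⟩ ha
    refine (runs_compareStep hH h1 hW ha h2 h3 h4).frame.mono le_rfl ?_
    rintro s'' ⟨⟨c'', h7, h8, h9, h10⟩, hf⟩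
    refine ⟨h1.of_frame hf rfl rfl rfl, h2.congr (hf.2 6 rfl), c'', h7, h8, h9.trans h5,
      fun b hb hba => ?_⟩
    rcases Nat.lt_succ_iff_lt_or_eq.1 hba with h | h
    · exact h9.trans (h6 b hb h)
    · obtain rfl := Fin.ext h
      exact h10 hb
  · rintro s' ⟨-, -, c', h1, -, h2, h3⟩
    exact ⟨c', h1, h2, fun a ha => h3 a ha a.2⟩

open Classical in
-- By `exists_ecc_lt` the marked set contains a better vertex unless `c` is central. The near set is
-- part of the candidate set, so `M` bounds the number of expensive iterations of both loops.
theorem runs_improve {M : ℕ} (hα : G.IsAlphaMetric 1) (hH : G.Connected) (hG : HoldsGraph G N s)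
    (hW : 2 * N + 8 ≤ W) (hM : ∀ c v z, (G.candSet c v z).card ≤ M) (hc : s.var 1 = c) :
    Runs W improve s ((M + 1) * (200 * N + 200)) fun s' =>
      HoldsGraph G N s' ∧ ∃ c' : Fin n, s'.var 1 = c' ∧ G.ecc c' ≤ G.ecc c ∧
        (c ∉ G.center → G.ecc c' < G.ecc c) := by
  have htot := hG.total
  have hecc : ∀ c, G.ecc c < n := fun c => by
    obtain ⟨x, hx⟩ := hH.exists_dist_eq_ecc c
    simpa [← hx] using hH.dist_lt_card c x
  have hec := hecc c
  have hMN : (M + 1) * (200 * N + 200) = M * (164 * N + 140) + (M * (36 * N + 60) + 200 * N + 200) := by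
    ring
  have hle : M * (164 * N + 140) + 200 * N + 200 ≤ (M + 1) * (200 * N + 200) := by
    rw [hMN]; omega
  refine Runs.mono (T := M * (164 * N + 140) + 200 * N + 200)
    (Q := fun s' => ∃ c' : Fin n, s'.var 1 = c' ∧ G.ecc c' ≤ G.ecc c ∧
        (c ∉ G.center → G.ecc c' < G.ecc c)) ?_ le_rfl (fun _ h => h) |>.frame.mono hle
    fun s' h => ⟨hG.of_frame h.2 rfl rfl rfl, h.1⟩
  refine Runs.assign_seq ?_ (by simp only [Expr.cost]; omega) ?_
  · simp only [Expr.Fits]; omega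
  refine Runs.bfs_seq hH le_rfl (searchArrays_nine (by omega) (by omega))
    (hG.setVar (by omega)) (selectsEdges_one (by omega)) (by omega)
    (src := c) (by simp [Expr.eval, hc]) (by simp only [Expr.cost]; omega) ?_
  intro s₁ hG₁ hs₁ hf₁
  obtain ⟨v, hv1, hv2, hv3⟩ := hs₁.exists_last hH
  have h1 : s₁.var 1 = c := by
    rw [hf₁.var 1 (by omega)]
    simpa using hc
  refine Runs.assign_seq ?_ (by simp only [Expr.cost]; omega) ?_
  · simp only [Expr.Fits]; omega
  refine Runs.assign_seq ?_ (by simp only [Expr.cost]; omega) ?_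
  · simp [Expr.Fits]; omega
  refine Runs.assign_seq ?_ (by simp only [Expr.cost]; omega) ?_
  · simp [Expr.Fits]; omega
  refine Runs.bfs_seq hH le_rfl (searchArrays_nine (by omega) (by omega))
    (((hG₁.setVar (by omega)).setVar (by omega)).setVar (by omega))
    (selectsEdges_one (by omega)) (by omega)
    (src := v) (by simp [Expr.eval, hv1]) (by simp only [Expr.cost]; omega) ?_
  intro s₂ hG₂ hs₂ hf₂
  have hk₂ : s₂.var 31 = G.ecc c + 1 ∧ s₂.var 35 = G.ecc c + 1 ∧ s₂.var 1 = c := by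
    rw [hf₂.var 31 (by omega), hf₂.var 35 (by omega), hf₂.var 1 (by omega)]
    simp [Expr.eval, hv2, h1]
  have h4₂ : HoldsDist G c 4 s₂ :=
    HoldsDist.congr (s := s₁) hs₁.dist (hf₂.arr 4 (by omega) (by omega) (by omega))
  have hclear := Runs.forN (W := W) (n := n) (i := 32) (body := .put 6 (.var 32) (.const 0)) (s := s₂)
    (fun k s' => s'.var 0 = n ∧ ∀ i < k, s'.arr 6 i = 0) (fun _ => 3)
    (by omega) rfl ⟨hG₂.var_zero, by simp⟩ (fun k s' h => h.1)
    (fun k s' z h => ⟨by simpa using h.1, h.2⟩) ?_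
  swap
  · rintro k hk s' ⟨h2, h3⟩ h4
    refine Runs.put_le ?_ ?_ (by simp [Expr.cost]) ⟨h2, fun i hi => ?_⟩
    · simp only [Expr.Fits]; omega
    · simp only [Expr.Fits]; omega
    · simp only [Expr.eval, h4, State.arr_setArr_apply, true_and]
      split_ifs with h8
      · rfl
      · exact h3 i (by omega)
  simp only [Finset.sum_const, Finset.card_range, smul_eq_mul] at hclear
  refine Runs.seq_le (by simp only [Expr.cost]; omega) (hclear.frame.mono le_rfl ?_)
  rintro s₃ ⟨⟨-, hzero⟩, hf₃⟩
  have hnear := (Finset.card_le_card (SimpleGraph.nearSet_subset_candSet (z := id))).trans (hM c v id)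
  have hnear' := Nat.mul_le_mul_right (118 * N + 100) hnear
  have hN : M * (164 * N + 140) = M * (118 * N + 100) + M * (46 * N + 40) := by ring
  refine Runs.seq_le (by simp only [Expr.cost]; omega)
    ((runs_mark hH (hG₂.of_frame hf₃ rfl rfl rfl) hW ((hf₃.1 31 rfl).trans hk₂.1) hv3
      (h4₂.congr (hf₃.2 4 rfl)) (HoldsDist.congr (s := s₂) hs₂.dist (hf₃.2 5 rfl)) hzero).frame.mono
      le_rfl ?_)
  rintro s₄ ⟨⟨z, hz, hS⟩, hf₄⟩
  have hcard' := Nat.mul_le_mul_right (46 * N + 40) (hM c v z)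
  refine (runs_compare (c := c) hH ((hG₂.of_frame hf₃ rfl rfl rfl).of_frame hf₄ rfl rfl rfl) (by omega) hS
    (((hf₄.1 1 rfl).trans (hf₃.1 1 rfl)).trans hk₂.2.2)
    (((hf₄.1 35 rfl).trans (hf₃.1 35 rfl)).trans hk₂.2.1)).mono ?_ ?_
  · simp only [Expr.cost]; omega
  · rintro s' ⟨c', h2, h3, h4⟩
    refine ⟨c', h2, h3, fun hcc => ?_⟩
    obtain ⟨u, hu, a, ha1, ha2, ha3⟩ := hα.exists_ecc_lt hH hcc hv3 hz
    exact (h4 u (SimpleGraph.mem_candSet.2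
      ⟨a, SimpleGraph.mem_nearSet.2 ⟨ha1, ha2⟩, ha3⟩)).trans_lt hu

end

end WordRAM

namespace WordRAM

/-! ### A vertex of almost minimum eccentricity -/

/-- Keep the vertex in register `32` if it is a middle vertex of the pair of sources of the arrays `5`
and `7`. -/
def midStep : Prog :=
  .ite (.bin .mul (.bin .eq (.get 5 (.var 32))
        (.bin .add (.bin .div (.bin .sub (.var 31) (.const 1)) (.const 2)) (.const 1)))
      (.bin .eq (.bin .add (.get 5 (.var 32)) (.get 7 (.var 32))) (.bin .add (.var 31) (.const 1))))
    (.assign 1 (.var 32)) .skip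

/-- Write to register `1` a middle vertex of a pair found by three searches. -/
def findMiddle : Prog :=
  .seq (.assign 20 (.const 0)) <|
  .seq (search 4 9) <|
  .seq (.assign 20 (.var 28)) <|
  .seq (search 5 9) <|
  .seq (.assign 31 (.var 29)) <|
  .seq (.assign 20 (.var 28)) <|
  .seq (search 7 9) (forN 32 midStep)

/-- The `r`-fold repetition of a program. -/
def repeatProg (p : Prog) : ℕ → Prog
  | 0 => .skip
  | r + 1 => .seq p (repeatProg p r)

/-! ### The eccentricities in a tree -/

/-- Tests whether one of the vertices in the registers `24` and `27` is the parent of the other. -/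
def treeEdge : Expr :=
  .bin .add (.bin .eq (.get 2 (.var 24)) (.var 27)) (.bin .eq (.get 2 (.var 27)) (.var 24))

/-- Write the larger of the entries of the arrays `4` and `5`, minus one, to the array `3`. -/
def maxStep : Prog :=
  .ite (.bin .lt (.get 4 (.var 32)) (.get 5 (.var 32)))
    (.put 3 (.var 32) (.bin .sub (.get 5 (.var 32)) (.const 1)))
    (.put 3 (.var 32) (.bin .sub (.get 4 (.var 32)) (.const 1)))

/-- Compute a breadth-first-search tree rooted at the vertex in register `1`, and the eccentricities
in this tree. -/
def treeEcc : Prog :=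
  .seq (.assign 20 (.var 1)) <|
  .seq (search 4 2) <|
  .seq (.put 2 (.var 1) (.var 0)) <|
  .seq (bfs 4 9 treeEdge) <|
  .seq (.assign 20 (.var 28)) <|
  .seq (bfs 4 9 treeEdge) <|
  .seq (.assign 20 (.var 28)) <|
  .seq (bfs 5 9 treeEdge) (forN 32 maxStep)

/-! ### Correctness of the middle vertex, the repeated improvement and the tree eccentricities -/

section
variable {n : ℕ} {G H : SimpleGraph (Fin n)} {N W T : ℕ} {s s' : State} {a b c v x y z : Fin n}

theorem runs_forN_midStep (hH : G.Connected) (hG : HoldsGraph G N s) (hW : 2 * N + 8 ≤ W)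
    (h31 : s.var 31 = G.dist x y + 1) (h5 : HoldsDist G x 5 s) (h7 : HoldsDist G y 7 s) :
    Runs W (forN 32 midStep) s (6 + n * 32) fun s' => ∃ c : Fin n, s'.var 1 = c ∧
      G.dist x c = G.dist x y / 2 ∧ G.dist x c + G.dist y c = G.dist x y := by
  have htot := hG.total
  have hdn := hH.dist_lt_card
  simp only [Fintype.card_fin] at hdn
  let P : Fin n → Prop := fun c =>
    G.dist x c = G.dist x y / 2 ∧ G.dist x c + G.dist y c = G.dist x y
  refine (Runs.forN (fun k s' => HoldsGraph G N s' ∧ s'.var 31 = G.dist x y + 1 ∧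
      HoldsDist G x 5 s' ∧ HoldsDist G y 7 s' ∧
      ((∃ c : Fin n, c < k ∧ P c) → ∃ c : Fin n, s'.var 1 = c ∧ P c)) (fun _ => 24) (by omega) rfl
      ⟨hG, h31, h5, h7, by simp⟩ (fun k s' h => h.1.var_zero) ?_ ?_).mono (by simp) ?_
  · rintro k s' z ⟨h1, h2, h3, h4, h5⟩
    exact ⟨h1.setVar (by omega), by simpa using h2, h3, h4, by simpa using h5⟩
  · rintro k hk s' ⟨h1, h2, h3, h4, h5⟩ h6
    obtain ⟨c, rfl⟩ : ∃ c : Fin n, k = c := ⟨⟨k, hk⟩, rfl⟩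
    have h3c := h3 c
    have h4c := h4 c
    have hd1 := hdn x y
    have hd2 := hdn x c
    have hd3 := hdn y c
    have hone : ∀ x y u w : ℕ, Op.mul.eval (Op.eq.eval x y) (Op.eq.eval u w) ≤ 1 := fun x y u w =>
      Nat.mul_le_mul (Op.eq_eval_le_one x y) (Op.eq_eval_le_one u w)
    have hone' := Op.eq_eval_le_one
    have hcond : ((.bin .mul (.bin .eq (.get 5 (.var 32))
        (.bin .add (.bin .div (.bin .sub (.var 31) (.const 1)) (.const 2)) (.const 1)))
      (.bin .eq (.bin .add (.get 5 (.var 32)) (.get 7 (.var 32))) (.bin .add (.var 31) (.const 1))) :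
        Expr).eval s' = 0) ↔ ¬ P c := by
      simp only [Expr.eval, Op.eval, h6, h2, h3c, h4c, P, mul_eq_zero]
      split_ifs <;> simp <;> omega
    refine Runs.ite_le ?_ (by simp [Expr.cost]) ?_ ?_
    · refine ⟨⟨⟨?_, ?_⟩, ⟨⟨⟨?_, ?_, ?_⟩, ?_, ?_⟩, ?_, ?_⟩, (hone' _ _).trans_lt (by omega)⟩,
        ⟨⟨⟨?_, ?_⟩, ⟨?_, ?_⟩, ?_⟩, ⟨?_, ?_, ?_⟩, (hone' _ _).trans_lt (by omega)⟩,
        (hone _ _ _ _).trans_lt (by omega)⟩ <;>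
      simp only [Expr.Fits, Expr.eval, Op.eval, h6, h2, h3c, h4c] <;> omega
    · intro h
      have hc := not_not.1 (mt hcond.2 h)
      refine Runs.assign_le ?_ (by simp [Expr.cost]) ⟨h1.setVar (by omega), by simpa using h2, h3, h4,
        fun _ => ⟨c, by simp [Expr.eval, h6], hc⟩⟩
      simp only [Expr.Fits]; omega
    · intro h
      refine Runs.skip_le (by simp [Expr.cost]) ⟨h1, h2, h3, h4, ?_⟩
      rintro ⟨c', h7, h8⟩
      rcases Nat.lt_succ_iff_lt_or_eq.1 h7 with h9 | h9
      · exact h5 ⟨c', h9, h8⟩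
      · obtain rfl := Fin.ext h9
        exact absurd h8 (hcond.1 h)
  · rintro s' ⟨-, -, -, -, h⟩
    obtain ⟨c, hc1, hc2⟩ := hH.exists_dist_eq_add (a := x) (b := y) (Nat.div_le_self _ 2)
    exact h ⟨c, c.2, hc1, by rwa [G.dist_comm (u := y)]⟩

theorem runs_findMiddle (hα : G.IsAlphaMetric 1) (hH : G.Connected) (hG : HoldsGraph G N s)
    (hW : 2 * N + 8 ≤ W) : Runs W findMiddle s (200 * N + 200) fun s' =>
      HoldsGraph G N s' ∧ ∃ c : Fin n, s'.var 1 = c ∧ ∀ o, G.ecc c ≤ G.ecc o + 14 := by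
  have htot := hG.total
  obtain ⟨i⟩ := hH.nonempty
  have hn : 0 < n := i.pos
  refine Runs.mono (T := 200 * N + 200) (Q := fun s' => ∃ c : Fin n, s'.var 1 = c ∧
    ∀ o, G.ecc c ≤ G.ecc o + 14) ?_ le_rfl (fun _ h => h) |>.frame.mono le_rfl
    fun s' h => ⟨hG.of_frame h.2 rfl rfl rfl, h.1⟩
  refine Runs.assign_seq ?_ (by simp only [Expr.cost]; omega) ?_
  · simp only [Expr.Fits]; omega
  refine Runs.bfs_seq hH le_rfl (searchArrays_nine (by omega) (by omega))
    (hG.setVar (by omega)) (selectsEdges_one (by omega)) (by omega)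
    (src := ⟨0, hn⟩) (by simp [Expr.eval]) (by simp only [Expr.cost]; omega) ?_
  intro s₁ hG₁ hs₁ hf₁
  obtain ⟨x, hx1, -, hx2⟩ := hs₁.last
  refine Runs.assign_seq ?_ (by simp only [Expr.cost]; omega) ?_
  · simp only [Expr.Fits]; omega
  refine Runs.bfs_seq hH le_rfl (searchArrays_nine (by omega) (by omega))
    (hG₁.setVar (by omega)) (selectsEdges_one (by omega)) (by omega)
    (src := x) (by simp [Expr.eval, hx1]) (by simp only [Expr.cost]; omega) ?_
  intro s₂ hG₂ hs₂ hf₂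
  obtain ⟨y, hy1, hy2, hy3⟩ := hs₂.last
  have hd := hH.dist_lt_card x y
  rw [Fintype.card_fin] at hd
  refine Runs.assign_seq ?_ (by simp only [Expr.cost]; omega) ?_
  · simp only [Expr.Fits]; omega
  refine Runs.assign_seq ?_ (by simp only [Expr.cost]; omega) ?_
  · simp [Expr.Fits]; omega
  refine Runs.bfs_seq hH le_rfl (searchArrays_nine (by omega) (by omega))
    ((hG₂.setVar (by omega)).setVar (by omega)) (selectsEdges_one (by omega)) (by omega)
    (src := y) (by simp [Expr.eval, hy1]) (by simp only [Expr.cost]; omega) ?_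
  intro s₃ hG₃ hs₃ hf₃
  refine (runs_forN_midStep (x := x) (y := y) hH hG₃ hW ?_ ?_ hs₃.dist).mono
    (by simp only [Expr.cost]; omega) ?_
  · rw [hf₃.var 31 (by omega)]
    simp [Expr.eval, hy2]
  · exact HoldsDist.congr (s := s₂) hs₂.dist (hf₃.arr 5 (by omega) (by omega) (by omega))
  · rintro s' ⟨c, h1, h2, h3⟩
    exact ⟨c, h1, fun o => hα.ecc_mid_le hH hx2 hy3 h2 h3⟩

/-- Each round lowers the excess over the minimum eccentricity by at least one, unless the vertex is
already central and then stays so. -/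
theorem runs_improve_repeat {M r : ℕ} (hα : G.IsAlphaMetric 1) (hH : G.Connected)
    (hG : HoldsGraph G N s) (hW : 2 * N + 8 ≤ W) (hM : ∀ c v z, (G.candSet c v z).card ≤ M)
    (hc : s.var 1 = c) (hr : ∀ o, G.ecc c ≤ G.ecc o + r) :
    Runs W (repeatProg improve r) s (r * ((M + 1) * (200 * N + 200)) + 1) fun s' =>
      HoldsGraph G N s' ∧ ∃ c ∈ G.center, s'.var 1 = (c : Fin n) := by
  induction r generalizing s c with
  | zero => exact Runs.skip_le (by omega) ⟨hG, c, hH.mem_center_iff_ecc.2 (by simpa using hr), hc⟩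
  | succ r ih =>
    refine (Runs.seq (T := (M + 1) * (200 * N + 200)) (T' := r * ((M + 1) * (200 * N + 200)) + 1)
      ((runs_improve hα hH hG hW hM hc).mono le_rfl ?_)).mono (by linarith) fun _ h => h
    rintro s₁ ⟨hG₁, c', h1, h2, h3⟩
    refine ih hG₁ h1 fun o => ?_
    by_cases hcc : c ∈ G.center
    · have := hH.mem_center_iff_ecc.1 hcc o
      omega
    · have := hr o
      have := h3 hcc
      omega

theorem runs_forN_maxStep (hH : H.Connected) (h0 : s.var 0 = n) (hW : n + 3 ≤ W)
    (h4 : HoldsDist H a 4 s) (h5 : HoldsDist H b 5 s) :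
    Runs W (forN 32 maxStep) s (6 + n * 22) fun s' =>
      ∀ v : Fin n, s'.arr 3 v = max (H.dist a v) (H.dist b v) := by
  have hdn := hH.dist_lt_card
  simp only [Fintype.card_fin] at hdn
  refine (Runs.forN (fun k s' => s'.var 0 = n ∧ HoldsDist H a 4 s' ∧ HoldsDist H b 5 s' ∧
      ∀ v : Fin n, v < k → s'.arr 3 v = max (H.dist a v) (H.dist b v)) (fun _ => 14) (by omega) rfl
      ⟨h0, h4, h5, by simp⟩ (fun k s' h => h.1) ?_ ?_).mono (by simp) ?_
  · rintro k s' z ⟨h1, h2, h3, h4⟩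
    exact ⟨by simpa using h1, h2, h3, h4⟩
  · rintro k hk s' ⟨h1, h2, h3, h4⟩ h6
    obtain ⟨v, rfl⟩ : ∃ c : Fin n, k = c := ⟨⟨k, hk⟩, rfl⟩
    have h2v := h2 v
    have h3v := h3 v
    have hd1 := hdn a v
    have hd2 := hdn b v
    have hfin : ∀ z, z = max (H.dist a v) (H.dist b v) →
        (s'.setArr 3 v z).var 0 = n ∧ HoldsDist H a 4 (s'.setArr 3 v z) ∧
          HoldsDist H b 5 (s'.setArr 3 v z) ∧ ∀ w : Fin n, (w : ℕ) < v + 1 →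
            (s'.setArr 3 v z).arr 3 w = max (H.dist a w) (H.dist b w) := by
      rintro z rfl
      refine ⟨h1, h2.congr (by simp [State.arr_setArr]), h3.congr (by simp [State.arr_setArr]),
        fun w hw => ?_⟩
      rcases Nat.lt_succ_iff_lt_or_eq.1 hw with h | h
      · rw [State.arr_setArr_apply, if_neg (by omega), h4 w h]
      · obtain rfl := Fin.ext h
        simp
    refine Runs.ite_le ⟨⟨?_, ?_⟩, ⟨?_, ?_⟩, (Op.lt_eval_le_one _ _).trans_lt (by omega)⟩
      (by simp [Expr.cost]) ?_ ?_
    any_goals simp only [Expr.Fits, Expr.eval, h6, h2v, h3v]; omega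
    · intro h
      have h' : H.dist a v < H.dist b v := by simpa [Expr.eval, Op.eval, h6, h2v, h3v] using h
      refine Runs.put_le ?_ ⟨⟨?_, ?_⟩, ?_, ?_⟩ (by simp [Expr.cost]) ?_
      any_goals simp only [Expr.Fits, Expr.eval, Op.eval, h6, h3v]; omega
      simp only [Expr.eval, Op.eval, h6, h3v]
      exact hfin _ (by omega)
    · intro h
      have h' : H.dist b v ≤ H.dist a v := by simpa [Expr.eval, Op.eval, h6, h2v, h3v] using h
      refine Runs.put_le ?_ ⟨⟨?_, ?_⟩, ?_, ?_⟩ (by simp [Expr.cost]) ?_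
      any_goals simp only [Expr.Fits, Expr.eval, Op.eval, h6, h2v]; omega
      simp only [Expr.eval, Op.eval, h6, h2v]
      exact hfin _ (by omega)
  · rintro s' ⟨-, -, -, h⟩ v
    exact h v v.2

/-- The sum of the two comparisons acts as a disjunction. The root's entry is `n`, which is no
vertex, so the test cannot succeed through it. -/
theorem selectsEdges_treeEdge {d : ℕ} (hd : d ≠ 2) (hH : H.IsParentArray c (s.arr 2))
    (hc : s.arr 2 c = n) (hlt : ∀ v : Fin n, s.arr 2 v ≤ n) (hW : n + 3 ≤ W) :
    SelectsEdges W d 9 treeEdge G H s := by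
  rintro s' hs' u v - hu hv
  have h2 := hs'.2 2 hd.symm (by decide) (by decide)
  have hu' := hlt u
  have hv' := hlt v
  have h1 := Op.eq_eval_le_one (s.arr 2 u) v
  have h3 := Op.eq_eval_le_one (s.arr 2 v) u
  constructor
  · refine ⟨⟨⟨?_, ?_⟩, ?_, ?_⟩, ⟨⟨?_, ?_⟩, ?_, ?_⟩, ?_⟩ <;>
    simp only [Expr.Fits, Expr.eval, hu, hv, h2] <;> first | omega | simp only [Op.eval] at *; omega
  · have hcu : ∀ x y : Fin n, s.arr 2 x = y → x ≠ c := by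
      rintro x y h rfl
      have := y.2
      omega
    rw [hH u v]
    simp only [treeEdge, Expr.eval, hu, hv, h2, Op.eval]
    have h4 := hcu u v
    have h5 := hcu v u
    by_cases h6 : s.arr 2 u = v <;> by_cases h7 : s.arr 2 v = u <;> simp_all

theorem runs_treeEcc (hH : G.Connected) (hG : HoldsGraph G N s) (hW : 2 * N + 8 ≤ W)
    (hc : s.var 1 = c) : Runs W treeEcc s (240 * N + 200) fun s' => s'.var 1 = c ∧
      ∃ T : SimpleGraph (Fin n), G.IsBFSTree c T ∧ T.IsParentArray c (s'.arr 2) ∧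
        ∀ v : Fin n, s'.arr 3 v = T.ecc v := by
  have htot := hG.total
  have hcost : treeEdge.cost = 9 := rfl
  refine Runs.assign_seq ?_ (by simp only [Expr.cost]; omega) ?_
  · simp only [Expr.Fits]; omega
  refine Runs.bfs_seq hH le_rfl (by constructor <;> decide)
    (hG.setVar (by omega)) (selectsEdges_one (by omega)) (by omega)
    (src := c) (by simp [Expr.eval, hc]) (by simp only [Expr.cost]; omega) ?_
  intro s₁ hG₁ hs₁ hf₁
  have h1 : s₁.var 1 = c := by rw [hf₁.var 1 (by omega)]; simpa using hc
  have h20 : s₁.var 20 = c := by rw [hf₁.var 20 (by omega)]; simpa [Expr.eval] using hc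
  have h0 := hG₁.var_zero
  have hpar : ∀ v, ∃ w : Fin n, v ≠ c → s₁.arr 2 v = w ∧ G.Adj v w ∧ G.dist c v = G.dist c w + 1 := by
    intro v
    by_cases hv : v = c
    · exact ⟨v, fun h => absurd hv h⟩
    · obtain ⟨w, hw⟩ := hs₁.parent v hv
      exact ⟨w, fun _ => hw⟩
  choose par hpar using hpar
  -- The search leaves the root's parent entry meaningless; overwriting it by `n` prevents a
  -- spurious edge at the root.
  refine Runs.put_seq ?_ ?_ (by simp only [Expr.cost]; omega) ?_
  · simp only [Expr.Fits]; omega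
  · simp only [Expr.Fits]; omega
  simp only [Expr.eval, h1, h0]
  set s₂ := s₁.setArr 2 c n with hs₂
  have hT : G.IsBFSTree c (SimpleGraph.parentTree c par) :=
    SimpleGraph.isBFSTree_parentTree hH fun v hv => (hpar v hv).2
  set T := SimpleGraph.parentTree c par with hTdef
  have hcon : T.Connected := hT.1.2.1
  have h2 : ∀ v, v ≠ c → s₂.arr 2 v = par v := fun v hv => by
    rw [hs₂, State.arr_setArr_apply, if_neg (by simpa [Fin.val_inj] using hv), (hpar v hv).1]
  have h2c : s₂.arr 2 c = n := by simp [hs₂]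
  have hTpar : T.IsParentArray c (s₂.arr 2) := by
    intro v w
    rw [hTdef, SimpleGraph.parentTree, SimpleGraph.fromRel_adj]
    have h3 : ∀ v w : Fin n, (v ≠ c ∧ s₂.arr 2 v = w) ↔ v ≠ c ∧ par v = w := fun v w =>
      and_congr_right fun hv => by rw [h2 v hv, Fin.val_inj]
    rw [h3, h3]
    refine and_iff_right_of_imp ?_
    rintro (⟨h4, rfl⟩ | ⟨h4, rfl⟩)
    · exact (hpar v h4).2.1.ne
    · exact (hpar w h4).2.1.ne'
  have hlt : ∀ v : Fin n, s₂.arr 2 v ≤ n := fun v => by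
    by_cases hv : v = c
    · rw [hv, h2c]
    · rw [h2 v hv]; omega
  have hsel : ∀ {s : State} {d : ℕ}, d ≠ 2 → s.arr 2 = s₂.arr 2 →
      SelectsEdges W d 9 treeEdge G T s := fun hd h =>
    selectsEdges_treeEdge hd (h ▸ hTpar) (h ▸ h2c) (h ▸ hlt) (by omega)
  -- Register `20` still holds `c`. This sweep only serves to find `a`; the next two, from `a` and
  -- from `b`, provide the distances whose maxima are the eccentricities.
  refine Runs.bfs_seq hcon hT.1.1 (searchArrays_nine (by omega) (by omega))
    (hG₁.setArr (by omega) (by omega)) (hsel (by omega) rfl) (by omega)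
    (src := c) h20 (by simp only [Expr.cost, hcost]; omega) ?_
  intro s₃ hG₃ hs₃ hf₃
  obtain ⟨a, ha1, -, ha2⟩ := hs₃.last
  have h23 : s₃.arr 2 = s₂.arr 2 := hf₃.arr 2 (by omega) (by omega) (by omega)
  refine Runs.assign_seq ?_ (by simp only [Expr.cost, hcost]; omega) ?_
  · simp only [Expr.Fits]; omega
  refine Runs.bfs_seq hcon hT.1.1 (searchArrays_nine (by omega) (by omega))
    (hG₃.setVar (by omega)) (hsel (by omega) h23) (by omega)
    (src := a) (by simp [Expr.eval, ha1]) (by simp only [Expr.cost, hcost]; omega) ?_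
  intro s₄ hG₄ hs₄ hf₄
  obtain ⟨b, hb1, -, hb2⟩ := hs₄.last
  have h24 : s₄.arr 2 = s₂.arr 2 := (hf₄.arr 2 (by omega) (by omega) (by omega)).trans h23
  refine Runs.assign_seq ?_ (by simp only [Expr.cost, hcost]; omega) ?_
  · simp only [Expr.Fits]; omega
  refine Runs.bfs_seq hcon hT.1.1 (searchArrays_nine (by omega) (by omega))
    (hG₄.setVar (by omega)) (hsel (by omega) h24) (by omega)
    (src := b) (by simp [Expr.eval, hb1]) (by simp only [Expr.cost, hcost]; omega) ?_
  intro s₅ hG₅ hs₅ hf₅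
  have h25 : s₅.arr 2 = s₂.arr 2 := (hf₅.arr 2 (by omega) (by omega) (by omega)).trans h24
  have h4 : HoldsDist T a 4 s₅ :=
    HoldsDist.congr (s := s₄) hs₄.dist (hf₅.arr 4 (by omega) (by omega) (by omega))
  refine (runs_forN_maxStep hcon hG₅.var_zero (by omega) h4 hs₅.dist).frame.mono
    (by simp only [Expr.cost, hcost]; omega) ?_
  rintro s' ⟨h, hf⟩
  refine ⟨?_, T, hT, ?_, fun v => ?_⟩
  · rw [hf.1 1 rfl, hf₅.var 1 (by omega)]
    simp only [State.var_setVar]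
    rw [if_neg (by omega), hf₄.var 1 (by omega)]
    simp only [State.var_setVar]
    rw [if_neg (by omega), hf₃.var 1 (by omega)]
    exact h1
  · rw [hf.2 2 rfl, h25]
    exact hTpar
  · rw [h v]
    refine le_antisymm ?_ ?_
    · rw [T.dist_comm (u := a), T.dist_comm (u := b)]
      exact max_le (hcon.dist_le_ecc v a) (hcon.dist_le_ecc v b)
    · obtain ⟨w, hw⟩ := hcon.exists_dist_eq_ecc v
      rw [← hw]
      exact hT.1.2.dist_le_max ha2 hb2 v w

end

end WordRAM

namespace WordRAM

/-! ### The whole program and its exponent -/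

/-- Compute a central vertex and the eccentricities in a breadth-first-search tree rooted there. -/
def centralTree : Prog :=
  .seq findMiddle (.seq (repeatProg improve 14) treeEcc)

theorem runs_centralTree {n : ℕ} {G : SimpleGraph (Fin n)} {N W M : ℕ} {s : State}
    (hα : G.IsAlphaMetric 1) (hH : G.Connected) (hG : HoldsGraph G N s)
    (hW : 2 * N + 8 ≤ W) (hM : ∀ c v z, (G.candSet c v z).card ≤ M) :
    Runs W centralTree s ((M + 1) * (4000 * N + 4000)) fun s' => ∃ c ∈ G.center, s'.var 1 = (c : Fin n) ∧
      ∃ T : SimpleGraph (Fin n), G.IsBFSTree c T ∧ T.IsParentArray c (s'.arr 2) ∧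
        ∀ v : Fin n, s'.arr 3 v = T.ecc v := by
  refine (Runs.seq (T := 200 * N + 200)
    (T' := 14 * ((M + 1) * (200 * N + 200)) + 1 + (240 * N + 200))
    ((runs_findMiddle hα hH hG hW).mono le_rfl ?_)).mono ?_ fun _ h => h
  · rintro s₁ ⟨hG₁, c₀, h1, h2⟩
    refine Runs.seq ((runs_improve_repeat hα hH hG₁ hW hM h1 h2).mono le_rfl ?_)
    rintro s₂ ⟨hG₂, c, hc, h3⟩
    exact (runs_treeEcc hH hG₂ hW h3).mono le_rfl fun s' h => ⟨c, hc, h⟩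
  · have : (M + 1) * (4000 * N + 4000) =
        14 * ((M + 1) * (200 * N + 200)) + M * (1200 * N + 1200) + (1200 * N + 1200) := by ring
    omega

theorem exists_exec_centralTree {n : ℕ} {G : SimpleGraph (Fin n)} (A : AdjLists G)
    (hH : G.Connected) (hα : G.IsAlphaMetric 1) : ∃ (t : ℕ) (s : State),
      Exec ((G.edgeSet.ncard + 2) ^ 7) centralTree A.init t s ∧
      (t : ℝ) ≤ 500000 * ((G.edgeSet.ncard : ℝ) + 1) ^ (15 / 8 : ℝ) ∧
      ∃ c ∈ G.center, s.var 1 = (c : Fin n) ∧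
        ∃ T : SimpleGraph (Fin n), G.IsBFSTree c T ∧ T.IsParentArray c (s.arr 2) ∧
          ∀ v : Fin n, s.arr 3 v = T.ecc v := by
  set m := G.edgeSet.ncard with hm
  have hnm : n ≤ m + 1 := by
    have := hH.card_vert_le_card_edgeSet_add_one
    rwa [Nat.card_eq_fintype_card, Fintype.card_fin, Nat.card_coe_set_eq] at this
  obtain ⟨i⟩ := hH.nonempty
  have hn : 0 < n := i.pos
  set N := n + 2 * m with hN
  -- As `n ≤ m + 1`, the left side is at most `6 * m + 10`, well below `64 * (m + 2)`.
  have hW : 2 * N + 8 ≤ (m + 2) ^ 7 := by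
    have h1 : 2 ^ 6 ≤ (m + 2) ^ 6 := Nat.pow_le_pow_left (by omega) 6
    have h2 : 2 ^ 6 * (m + 2) ≤ (m + 2) ^ 7 := by
      rw [pow_succ (m + 2) 6]
      exact Nat.mul_le_mul_right _ h1
    omega
  set x : ℝ := (N : ℝ) ^ (7 / 8 : ℝ) with hx
  have hN1 : (1 : ℝ) ≤ N := by exact_mod_cast (by omega : 1 ≤ N)
  have hx1 : 1 ≤ x := Real.one_le_rpow hN1 (by norm_num)
  have hM : ∀ c v z, (G.candSet c v z).card ≤ ⌊5 * x⌋₊ := fun c v z => by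
    refine Nat.le_floor ((hα.card_candSet_le hH c v z).trans_eq ?_)
    rw [hx, hN, Fintype.card_fin, add_comm]
  obtain ⟨t, s, h1, h2, h3⟩ := runs_centralTree hα hH A.holdsGraph_init hW hM
  refine ⟨t, s, h1, ?_, h3⟩
  have hfloor : (⌊5 * x⌋₊ : ℝ) ≤ 5 * x := Nat.floor_le (by positivity)
  have hNm : (N : ℝ) ≤ 3 * ((m : ℝ) + 1) := by
    have : N ≤ 3 * (m + 1) := by omega
    exact_mod_cast this
  have hm0 : (0 : ℝ) ≤ m := Nat.cast_nonneg m
  -- About `N ^ (7/8)` candidates at linear cost each give the exponent `15/8`. The constant comes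
  -- from `N ≤ 3 * (m + 1)`, `3 ^ (15/8) ≤ 9` and `48000 * 9 ≤ 500000`.
  calc (t : ℝ) ≤ ((⌊5 * x⌋₊ + 1) * (4000 * N + 4000) : ℕ) := by exact_mod_cast h2
    _ = ((⌊5 * x⌋₊ : ℝ) + 1) * (4000 * N + 4000) := by push_cast; ring
    _ ≤ (6 * x) * (8000 * N) := by
      apply mul_le_mul (by linarith) (by linarith) (by positivity) (by positivity)
    _ = 48000 * (N : ℝ) ^ (15 / 8 : ℝ) := by
      rw [show (15 / 8 : ℝ) = 7 / 8 + 1 by norm_num, Real.rpow_add (by linarith), Real.rpow_one, ← hx]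
      ring
    _ ≤ 48000 * (3 * ((m : ℝ) + 1)) ^ (15 / 8 : ℝ) := by gcongr
    _ = 48000 * (3 : ℝ) ^ (15 / 8 : ℝ) * ((m : ℝ) + 1) ^ (15 / 8 : ℝ) := by
      rw [Real.mul_rpow (by norm_num) (by positivity)]
      ring
    _ ≤ 500000 * ((m : ℝ) + 1) ^ (15 / 8 : ℝ) := by
      have : (3 : ℝ) ^ (15 / 8 : ℝ) ≤ 3 ^ (2 : ℝ) :=
        Real.rpow_le_rpow_of_exponent_le (by norm_num) (by norm_num)
      rw [Real.rpow_two] at this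
      gcongr
      linarith

end WordRAM

/-- (1) Every finite connected `α₁`-metric graph has an eccentricity `3`-approximating spanning tree;
it has breadth-first-search trees rooted at vertices of `C(C(G))`, and all of these have this property.
(2) Every breadth-first-search tree rooted at a central vertex is an eccentricity `4`-approximating
spanning tree. (3) There are a program and a constant `b < 2` such that, on the adjacency lists of any
connected `α₁`-metric graph with `m` edges, the program, working with words of `O(log m)` bits, halts
within `O((m + 1) ^ b)` steps with a central vertex `c` in register `1`, the parent array of a
breadth-first-search tree `T` rooted at `c` in array `2`, and the numbers `e_T(v)`, which satisfy
`e_G(v) ≤ e_T(v) ≤ e_G(v) + 4`, in array `3`. -/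
theorem mainTheorem10 :
    (∀ (V : Type*) [Finite V] (G : SimpleGraph V), G.Connected → G.IsAlphaMetric 1 →
      (∃ c ∈ G.centerOfCenter, ∃ T : SimpleGraph V,
        G.IsBFSTree c T ∧ G.IsEccApproxSpanningTree 3 T) ∧
      (∀ c ∈ G.centerOfCenter, ∀ T : SimpleGraph V,
        G.IsBFSTree c T → G.IsEccApproxSpanningTree 3 T) ∧
      (∀ c ∈ G.center, ∀ T : SimpleGraph V,
        G.IsBFSTree c T → G.IsEccApproxSpanningTree 4 T)) ∧
    (∃ (p : WordRAM.Prog) (k : ℕ) (C b : ℝ), b < 2 ∧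
      ∀ (n : ℕ) (G : SimpleGraph (Fin n)) (A : WordRAM.AdjLists G),
        G.Connected → G.IsAlphaMetric 1 →
        ∃ (t : ℕ) (s : WordRAM.State),
          WordRAM.Exec ((G.edgeSet.ncard + 2) ^ k) p A.init t s ∧
          (t : ℝ) ≤ C * ((G.edgeSet.ncard : ℝ) + 1) ^ b ∧
          ∃ c ∈ G.center, s.var 1 = c ∧
            ∃ T : SimpleGraph (Fin n), G.IsBFSTree c T ∧ T.IsParentArray c (s.arr 2) ∧
              ∀ v : Fin n, (s.arr 3 v : ℕ∞) = T.eccent v ∧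
                G.eccent v ≤ (s.arr 3 v : ℕ∞) ∧ (s.arr 3 v : ℕ∞) ≤ G.eccent v + 4) := by
  refine ⟨fun V _ G hG hα => ⟨?_, fun c hc T hT => ?_, fun c hc T hT => ?_⟩,
    WordRAM.centralTree, 7, 500000, 15 / 8, by norm_num, fun n G A hG hα => ?_⟩
  · obtain ⟨c, hc⟩ := SimpleGraph.centerOfCenter_nonempty hG
    obtain ⟨T, hT⟩ := SimpleGraph.exists_isBFSTree hG c
    exact ⟨c, hc, T, hT, hα.isEccApproxSpanningTree hG (hα.dist_le_two_of_mem_centerOfCenter hG hc).1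
      (hα.dist_le_two_of_mem_centerOfCenter hG hc).2 hT⟩
  · exact hα.isEccApproxSpanningTree hG (hα.dist_le_two_of_mem_centerOfCenter hG hc).1
      (hα.dist_le_two_of_mem_centerOfCenter hG hc).2 hT
  · exact hα.isEccApproxSpanningTree hG hc (fun y hy => hα.dist_le_three_of_mem_center hG hc hy) hT
  · obtain ⟨t, s, h1, h2, c, hc, h3, T, hT, h4, h5⟩ := WordRAM.exists_exec_centralTree A hG hα
    refine ⟨t, s, h1, h2, c, hc, h3, T, hT, h4, fun v => ?_⟩
    have hv : (s.arr 3 v : ℕ∞) = T.eccent v := by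
      rw [h5 v]
      exact SimpleGraph.Connected.coe_ecc hT.1.2.1 v
    have h6 := (hα.isEccApproxSpanningTree hG hc
      (fun y hy => hα.dist_le_three_of_mem_center hG hc hy) hT).2 v
    refine ⟨hv, ?_, hv ▸ h6⟩
    rw [hv]
    -- Passing to the subgraph `T` can only increase distances.
    exact (G.eccent_le_iff v _).2 fun u =>
      (SimpleGraph.edist_anti hT.1.1).trans SimpleGraph.edist_le_eccent
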